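/- Let $0<\lambda_0<\lambda_1<\lambda_2<\cdots$ be a sequence of real numbers with $\lambda_k\to\infty$, and let $N(u)=\#\{k\ge 0:\lambda_k\le u\}$ be its counting function. Let $$\Lambda=\Big\{\sum_{k=0}^{l} n_k\lambda_k:\ l\ge 0,\ n_k\in\{0,1,2,\dots\}\Big\}$$ be the additive semigroup (with $0$) generated by the $\lambda_k$. For $r\in\Lambda$ let $p(r)$ be the number of ways of writing $r=\sum_{k} n_k\lambda_k$, that is, the number of finitely supported sequences $(n_k)_{k\ge0}$ of non-negative integers with $\sum_k n_k\lambda_k=r$, and put $$P(u)=\sum_{r\in\Lambda,\ r\le u}p(r).$$ Let $A,\alpha,B,C,D$ be real numbers with $A>0$ and $\alpha>0$, and suppose that, as $u\to\infty$, $$\int_0^u\frac{N(t)}{t}\,dt=\frac{A}{\alpha}u^{\alpha}+B\log^2u+C\log u+D+o(1).$$ Then, as $u\to\infty$, $$P(u)\sim\left(\frac{1-\beta}{2\pi}\right)^{1/2}e^{D'}M^{-(C+\frac12)}\,u^{C-\beta C-\frac{\beta}{2}}\exp\left(\frac{Mu^{\beta}}{\beta}+B\log^2\left(\frac{u^{1-\beta}}{M}\right)\right),$$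 where $$\beta=\frac{\alpha}{\alpha+1},\qquad M=\big(A\alpha\,\Gamma(\alpha+1)\zeta(\alpha+1)\big)^{\frac{1}{\alpha+1}},\qquad D'=D+\left(\frac{\pi^2}{6}-2\gamma_1-\gamma^2\right)B.$$ Here $\Gamma$ is Euler's Gamma function, $\zeta$ the Riemann zeta function, $\gamma$ the Euler–Mascheroni constant, and $\gamma_1=\lim_{n\to\infty}\Big(\sum_{k=1}^n\frac{\log k}{k}-\frac{\log^2 n}{2}\Big)$ the first Stieltjes constant. -/

import Mathlib

open Filter Topology

noncomputable section

namespace PartitionAsymptotics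

/-- The counting function `N(u) = #{k : lam k ≤ u}`. -/
def countingFn (lam : ℕ → ℝ) (u : ℝ) : ℕ := {k : ℕ | lam k ≤ u}.ncard

/-- The value `∑ n_k lam_k` of a finitely supported choice of multiplicities `n`. -/
def weight (lam : ℕ → ℝ) (n : ℕ →₀ ℕ) : ℝ := n.sum fun k m => (m : ℝ) * lam k

/-- The additive semigroup (with `0`) of all finite sums `∑ n_k lam_k`, `n_k ∈ ℕ`. -/
def semigroupSet (lam : ℕ → ℝ) : Set ℝ := {r | ∃ n : ℕ →₀ ℕ, r = weight lam n}

/-- `p(r)`: the number of ways of writing `r = ∑ n_k lam_k`. -/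
def partitionCount (lam : ℕ → ℝ) (r : ℝ) : ℕ := {n : ℕ →₀ ℕ | r = weight lam n}.ncard

/-- `P(u)`: the sum of `p(r)` over `r` in the semigroup with `r ≤ u`. -/
def summedPartition (lam : ℕ → ℝ) (u : ℝ) : ℕ :=
  ∑ᶠ r ∈ {r : ℝ | r ∈ semigroupSet lam ∧ r ≤ u}, partitionCount lam r

/-- The sequence `∑_{k=1}^n (log k)/k - (log n)^2/2`. -/
def stieltjesSeq (n : ℕ) : ℝ :=
  ∑ k ∈ Finset.Icc 1 n, Real.log k / k - Real.log n ^ 2 / 2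

/-- The Stieltjes constant `γ₁`. -/
def stieltjesGammaOne : ℝ := limUnder atTop stieltjesSeq

/-! The cardinalities, the sum and the limit above are genuine, not default values. -/

theorem finite_setOf_le {lam : ℕ → ℝ} (htop : Tendsto lam atTop atTop) (u : ℝ) :
    {k : ℕ | lam k ≤ u}.Finite := by
  obtain ⟨K, hK⟩ := eventually_atTop.1 (htop.eventually_gt_atTop u)
  refine (Set.finite_lt_nat K).subset fun k hk => ?_
  by_contra h
  exact absurd (hK k (not_lt.1 h)) (not_lt.2 hk)

theorem finite_setOf_weight_le {lam : ℕ → ℝ} (hpos : 0 < lam 0) (hmono : StrictMono lam)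
    (htop : Tendsto lam atTop atTop) (u : ℝ) :
    {n : ℕ →₀ ℕ | weight lam n ≤ u}.Finite := by
  have hp : ∀ k, lam 0 ≤ lam k := fun k => hmono.monotone (Nat.zero_le k)
  set S := (finite_setOf_le htop u).toFinset with hS
  obtain ⟨m, hm⟩ := exists_nat_ge (u / lam 0)
  have hfin : (Set.Iic (Finsupp.indicator S fun _ _ => m : ℕ →₀ ℕ)).Finite := Set.finite_Iic _
  refine hfin.subset fun n hn => ?_
  intro k
  by_cases hk : n k = 0
  · simp [hk]
  have hterm : (n k : ℝ) * lam k ≤ u := by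
    refine le_trans ?_ hn
    unfold weight Finsupp.sum
    exact Finset.single_le_sum (f := fun i => (n i : ℝ) * lam i)
      (fun i _ => mul_nonneg (Nat.cast_nonneg _) (hpos.le.trans (hp i)))
      (Finsupp.mem_support_iff.2 hk)
  have h1 : (1 : ℝ) ≤ n k := by exact_mod_cast Nat.one_le_iff_ne_zero.2 hk
  have hkS : k ∈ S := by
    simp only [hS, Set.Finite.mem_toFinset, Set.mem_ofPred_eq]
    nlinarith [hp k]
  rw [Finsupp.indicator_of_mem hkS]
  have h2 : (n k : ℝ) ≤ u / lam 0 := by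
    rw [le_div_iff₀ hpos]
    exact le_trans (mul_le_mul_of_nonneg_left (hp k) (Nat.cast_nonneg _)) hterm
  exact_mod_cast h2.trans hm

theorem finite_setOf_weight_eq {lam : ℕ → ℝ} (hpos : 0 < lam 0) (hmono : StrictMono lam)
    (htop : Tendsto lam atTop atTop) (r : ℝ) :
    {n : ℕ →₀ ℕ | r = weight lam n}.Finite :=
  (finite_setOf_weight_le hpos hmono htop r).subset fun _ hn => le_of_eq (Eq.symm hn)

theorem finite_semigroupSet_le {lam : ℕ → ℝ} (hpos : 0 < lam 0) (hmono : StrictMono lam)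
    (htop : Tendsto lam atTop atTop) (u : ℝ) :
    {r : ℝ | r ∈ semigroupSet lam ∧ r ≤ u}.Finite := by
  refine ((finite_setOf_weight_le hpos hmono htop u).image (weight lam)).subset ?_
  rintro r ⟨⟨n, rfl⟩, hn⟩
  exact ⟨n, hn, rfl⟩

theorem tendsto_stieltjesSeq : Tendsto stieltjesSeq atTop (𝓝 stieltjesGammaOne) := by
  have key : ∀ n : ℕ, 3 ≤ n →
      Real.log (n + 1 : ℕ) / (n + 1 : ℕ) ≤ Real.log (n + 1 : ℕ) ^ 2 / 2 - Real.log n ^ 2 / 2 ∧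
      Real.log (n + 1 : ℕ) ^ 2 / 2 - Real.log n ^ 2 / 2 ≤ Real.log n / n := by
    intro n hn
    have hn' : (3 : ℝ) ≤ n := by exact_mod_cast hn
    have hd : ∀ x ∈ Set.Icc (n : ℝ) (n + 1),
        HasDerivAt (fun x => Real.log x ^ 2 / 2) (Real.log x / x) x := by
      intro x hx
      have hx0 : x ≠ 0 := by have := hx.1; intro h; linarith
      have h := ((Real.hasDerivAt_log hx0).fun_pow 2).div_const 2
      refine h.congr_deriv ?_
      field_simp
      norm_num
    obtain ⟨c, hc, hc'⟩ := exists_hasDerivAt_eq_slope (fun x => Real.log x ^ 2 / 2)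
      (fun x => Real.log x / x) (show (n : ℝ) < n + 1 by linarith)
      (fun x hx => (hd x hx).continuousAt.continuousWithinAt)
      (fun x hx => hd x ⟨hx.1.le, hx.2.le⟩)
    have he : Real.exp 1 ≤ n := by linarith [Real.exp_one_lt_d9]
    have hce : Real.exp 1 ≤ c := he.trans hc.1.le
    have a1 := Real.log_div_self_antitoneOn (show Real.exp 1 ≤ (n : ℝ) from he) hce hc.1.le
    have a2 := Real.log_div_self_antitoneOn hce
      (show Real.exp 1 ≤ (n : ℝ) + 1 by linarith) hc.2.le
    simp only [add_sub_cancel_left, div_one] at hc'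
    push_cast
    rw [← hc']
    exact ⟨a2, a1⟩
  have hstep : ∀ n : ℕ, stieltjesSeq (n + 1) = stieltjesSeq n + Real.log (n + 1 : ℕ) / (n + 1 : ℕ)
      - (Real.log (n + 1 : ℕ) ^ 2 / 2 - Real.log n ^ 2 / 2) := by
    intro n
    unfold stieltjesSeq
    rw [Finset.sum_Icc_succ_top (by omega)]
    ring
  have hanti : Antitone fun n => stieltjesSeq (n + 3) := by
    refine antitone_nat_of_succ_le fun n => ?_
    have := (key (n + 3) (by omega)).1
    have h2 := hstep (n + 3)
    rw [show n + 1 + 3 = n + 3 + 1 by ring]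
    linarith
  have hmon : Monotone fun n : ℕ => stieltjesSeq (n + 3) - Real.log (n + 3 : ℕ) / (n + 3 : ℕ) := by
    refine monotone_nat_of_le_succ fun n => ?_
    have := (key (n + 3) (by omega)).2
    have h2 := hstep (n + 3)
    rw [show n + 1 + 3 = n + 3 + 1 by ring]
    linarith
  have hbdd : BddBelow (Set.range fun n => stieltjesSeq (n + 3)) := by
    refine ⟨stieltjesSeq (0 + 3) - Real.log (0 + 3 : ℕ) / (0 + 3 : ℕ), ?_⟩
    rintro _ ⟨n, rfl⟩
    have h1 := hmon (Nat.zero_le n)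
    have h2 : 0 ≤ Real.log (n + 3 : ℕ) / (n + 3 : ℕ) :=
      div_nonneg (Real.log_natCast_nonneg _) (Nat.cast_nonneg _)
    simp only at h1 ⊢
    linarith
  have hlim := (tendsto_add_atTop_iff_nat 3).1 (tendsto_atTop_ciInf hanti hbdd)
  exact tendsto_nhds_limUnder ⟨_, hlim⟩

end PartitionAsymptotics

end

noncomputable section

namespace PartitionAsymptotics

open MeasureTheory Set

/-! The proof is a saddle point argument in probabilistic form. `P(u)` counts the multiplicity
vectors `n` of weight at most `u`. Give `n` the probability `exp (-σ weight n - logGen σ)`, where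
`logGen` is the logarithm of the generating product, and put `X = σ (weight n - u)`. Then `P(u) =
exp (logGen σ + σ u) * E[e ^ X; X ≤ 0]` for every admissible `σ` (`summedPartition_eq_integral`).
The choice `u = a α σ ^ (-α - 1)` centres `X` to leading order. Its standard deviation is then
asymptotic to `T = saddleScale`, which tends to infinity, and a local limit theorem at unit scale
makes the expectation asymptotic to `1 / (T √(2π))`.

The prefactor needs `logGen` up to `o(1)`. With the kernel `w = -(z / (e ^ z - 1))'` one has `-log
(1 - e ^ (-y)) = ∫ log⁺ (z / y) w(z) dz`, and `∑ log⁺ (u / λ_k)` is exactly `∫_0^u N(t) / t dt`.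
Hence `logGen σ` is the average against `w` of the function in the hypothesis, evaluated at `z / σ`
(`hasSum_log_one_sub_exp`), and the assumed expansion can be integrated term by term
(`tendsto_logGen`). The Mellin transform of `w` is `s Γ(s+1) ζ(s+1)`. Its value at `α` gives the
main term, and its second order expansion at `s = 0` gives the moments `∫ log w = 0` and `∫ log² w =
π²/6 - 2γ₁ - γ²`, which turn `D` into `D'`.

The local limit theorem has to work from an `o(1)` expansion on the real axis alone. The logarithm
of the moment generating function is a sum of terms `c (e ^ (τ w) - 1)` with `c, w ≥ 0` (a compound
Poisson structure), so convergence of the recentred cumulant function at the four real points `τ =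
±1, ±2` already forces the Gaussian limit of the characteristic function
(`tendsto_logCharFun_of_tendsto_cumulant`). A Gaussian bound on each band `|y| ≤ Δ` comes from a
lower bound for the number of `λ_k` comparable to `1/σ` (`exists_charFun_gaussian_bound`). Larger
frequencies are not controlled, so the law is reweighted by a positive kernel with compactly
supported transform, for which only a band matters; Lévy's continuity theorem and a sandwich by
cut-offs finish (`tendsto_integral_indicator_exp`). -/

/-! ### The averaging kernel: decay, integrability and Mellin transform. -/

/-- The function `x / (e ^ x - 1)`. -/
def bernoulliFn (x : ℝ) : ℝ := x / (Real.exp x - 1)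

/-- Minus the derivative of `x / (e ^ x - 1)`. -/
def kernelFn (x : ℝ) : ℝ :=
  (x * Real.exp x - Real.exp x + 1) / (Real.exp x - 1) ^ 2

theorem exp_sub_one_pos {x : ℝ} (hx : 0 < x) : 0 < Real.exp x - 1 := by
  linarith [Real.add_one_lt_exp hx.ne']

theorem hasDerivAt_bernoulliFn {x : ℝ} (hx : 0 < x) :
    HasDerivAt bernoulliFn (-kernelFn x) x := by
  have h0 := (exp_sub_one_pos hx).ne'
  have h := (hasDerivAt_id x).div ((Real.hasDerivAt_exp x).sub_const 1) h0
  refine h.congr_deriv ?_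
  simp only [kernelFn, id]
  rw [← neg_div]
  congr 1
  ring

theorem kernelFn_nonneg (x : ℝ) : 0 ≤ kernelFn x := by
  have h1 : 1 - x ≤ Real.exp (-x) := by linarith [Real.add_one_le_exp (-x)]
  have h2 : Real.exp (-x) * Real.exp x = 1 := by rw [← Real.exp_add]; simp
  refine div_nonneg ?_ (sq_nonneg _)
  nlinarith [Real.exp_pos x]

/-- With `a = e ^ (x/2)`, the numerator is at most `(a² - 1)²` because `x ≤ a² - 1`; this handles `x
≤ 1`, where `a ≤ 2`. For `x ≥ 1` half of the exponential decay pays for the factor `x ≤ 2a`, and `a⁴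
≤ 4 (a² - 1)²` produces the constant 8. -/
theorem kernelFn_le {x : ℝ} (hx : 0 < x) : kernelFn x ≤ 8 * Real.exp (-(1 / 2) * x) := by
  have hpos := exp_sub_one_pos hx
  set a := Real.exp (x / 2) with ha
  have ha0 : 0 < a := Real.exp_pos _
  have hinv : Real.exp (-(1 / 2) * x) = a⁻¹ := by rw [ha, ← Real.exp_neg]; ring_nf
  have haa : Real.exp x = a ^ 2 := by rw [ha, sq, ← Real.exp_add]; ring_nf
  have h1 : x / 2 + 1 ≤ a := Real.add_one_le_exp _
  rw [hinv, kernelFn, div_le_iff₀ (by positivity)]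
  rw [haa] at hpos ⊢
  rw [mul_assoc, mul_comm a⁻¹, ← mul_assoc, ← div_eq_mul_inv, le_div_iff₀ ha0]
  rcases le_total x 1 with h | h
  · have h3 : a ≤ 2 := by
      have : a ≤ Real.exp (1 / 2) := Real.exp_le_exp.2 (by linarith)
      have h4 : Real.exp (1 / 2) ^ 2 < 4 := by
        rw [← Real.exp_nat_mul]; norm_num; linarith [Real.exp_one_lt_d9]
      nlinarith [Real.exp_pos (1 / 2 : ℝ)]
    have h5 : x + 1 ≤ a ^ 2 := by rw [← haa]; exact Real.add_one_le_exp _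
    have h6 : x * a ^ 2 - a ^ 2 + 1 ≤ (a ^ 2 - 1) ^ 2 := by nlinarith [sq_nonneg a]
    nlinarith [sq_nonneg (a ^ 2 - 1)]
  · have h5 : 2 ≤ a ^ 2 := by rw [← haa]; linarith [Real.add_one_le_exp x]
    have h6 : a ^ 2 / 2 ≤ a ^ 2 - 1 := by linarith
    have h7 : (a ^ 2) ^ 2 / 4 ≤ (a ^ 2 - 1) ^ 2 := by nlinarith
    have h8 : x * a ^ 2 - a ^ 2 + 1 ≤ x * a ^ 2 := by linarith
    have h9 : (x * a ^ 2 - a ^ 2 + 1) * a ≤ (x * a ^ 2) * a :=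
      mul_le_mul_of_nonneg_right h8 ha0.le
    have h10 : x * a ^ 3 ≤ 2 * a ^ 4 := by
      have : x ≤ 2 * a := by linarith
      have := mul_le_mul_of_nonneg_right this (pow_nonneg ha0.le 3)
      nlinarith
    nlinarith

theorem measurable_kernelFn : Measurable kernelFn := by
  unfold kernelFn
  fun_prop

/-- The majorant `x ^ (-1/2) + x ^ p`. -/
def powMajorant (p x : ℝ) : ℝ := x ^ (-(1 / 2) : ℝ) + x ^ p

theorem integrableOn_powMajorant_mul_kernelFn {p : ℝ} (hp : -1 < p) :
    IntegrableOn (fun x => powMajorant p x * kernelFn x) (Ioi 0) := by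
  have key : ∀ q : ℝ, -1 < q → IntegrableOn (fun x => x ^ q * Real.exp (-(1 / 2) * x)) (Ioi 0) := by
    intro q hq
    have := integrableOn_rpow_mul_exp_neg_mul_rpow (p := 1) (b := 1 / 2) hq one_pos (by norm_num)
    simpa using this
  have h := ((key _ (by norm_num : (-1 : ℝ) < -(1 / 2))).add (key p hp)).const_mul 8
  refine Integrable.mono' h ?_ ?_
  · refine Measurable.aestronglyMeasurable ?_
    have := measurable_kernelFn
    unfold powMajorant
    fun_prop
  · filter_upwards [ae_restrict_mem measurableSet_Ioi] with x hx
    have hx : 0 < x := hx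
    have h1 := kernelFn_nonneg x
    have h2 := kernelFn_le hx
    have h3 : 0 ≤ powMajorant p x := by unfold powMajorant; positivity
    rw [Real.norm_of_nonneg (mul_nonneg h3 h1)]
    simp only [Pi.add_apply]
    calc powMajorant p x * kernelFn x ≤ powMajorant p x * (8 * Real.exp (-(1 / 2) * x)) := by gcongr
      _ = _ := by unfold powMajorant; ring

/-- All moments needed below have this shape: a singularity at 0 weaker than `x ^ (-1/2)`, and
polynomial growth at infinity. -/
theorem integrableOn_mul_kernelFn {f : ℝ → ℝ} {p K : ℝ} (hp : -1 < p) (hf : Measurable f)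
    (hb : ∀ x, 0 < x → |f x| ≤ K * powMajorant p x) :
    IntegrableOn (fun x => f x * kernelFn x) (Ioi 0) := by
  refine Integrable.mono' ((integrableOn_powMajorant_mul_kernelFn hp).const_mul K) ?_ ?_
  · exact (hf.mul measurable_kernelFn).aestronglyMeasurable
  · filter_upwards [ae_restrict_mem measurableSet_Ioi] with x hx
    rw [norm_mul, Real.norm_of_nonneg (kernelFn_nonneg x), ← mul_assoc]
    exact mul_le_mul_of_nonneg_right (hb x hx) (kernelFn_nonneg x)

/-- This is `t ^ n / n! ≤ e ^ t` at `t = ε |log x|`; the two powers cover both signs of the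
logarithm. -/
theorem abs_log_pow_le {x : ℝ} (hx : 0 < x) {ε : ℝ} (hε : 0 < ε) (n : ℕ) :
    |Real.log x| ^ n ≤ n.factorial / ε ^ n * (x ^ (-ε) + x ^ ε) := by
  have h1 := Real.pow_div_factorial_le_exp (ε * |Real.log x|) (by positivity) n
  have h2 : Real.exp (ε * |Real.log x|) ≤ x ^ (-ε) + x ^ ε := by
    rw [Real.rpow_def_of_pos hx, Real.rpow_def_of_pos hx]
    rcases abs_cases (Real.log x) with ⟨h, _⟩ | ⟨h, _⟩
    · rw [h, mul_comm]; linarith [Real.exp_pos (Real.log x * -ε)]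
    · rw [h, show ε * -Real.log x = Real.log x * -ε by ring]
      linarith [Real.exp_pos (Real.log x * ε)]
  have h3 := h1.trans h2
  rw [mul_pow, div_le_iff₀ (by positivity)] at h3
  rw [div_mul_eq_mul_div, le_div_iff₀ (by positivity)]
  linarith

theorem rpow_le_powMajorant {x : ℝ} (hx : 0 < x) {p q : ℝ} (hq : -(1 / 2) ≤ q) (hqp : q ≤ p) :
    x ^ q ≤ powMajorant p x := by
  unfold powMajorant
  rcases le_total x 1 with h | h
  · have := Real.rpow_le_rpow_of_exponent_ge hx h hq
    linarith [Real.rpow_pos_of_pos hx p]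
  · have := Real.rpow_le_rpow_of_exponent_le h hqp
    linarith [Real.rpow_pos_of_pos hx (-(1 / 2))]

theorem abs_log_pow_le_powMajorant {x : ℝ} (hx : 0 < x) (n : ℕ) :
    |Real.log x| ^ n ≤ n.factorial * 4 ^ n * 2 * powMajorant (1 / 2) x := by
  refine (abs_log_pow_le hx (by norm_num : (0 : ℝ) < 1 / 4) n).trans ?_
  have h1 := rpow_le_powMajorant hx (p := 1 / 2) (q := 1 / 4) (by norm_num) (by norm_num)
  have h2 := rpow_le_powMajorant hx (p := 1 / 2) (q := -(1 / 4)) (by norm_num) (by norm_num)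
  have h3 : (n.factorial : ℝ) / (1 / 4) ^ n = n.factorial * 4 ^ n := by
    rw [div_pow, one_pow]; field_simp
  rw [h3]
  have : (0 : ℝ) ≤ n.factorial * 4 ^ n := by positivity
  nlinarith

theorem integrableOn_log_pow_mul_kernelFn (n : ℕ) :
    IntegrableOn (fun x => Real.log x ^ n * kernelFn x) (Ioi 0) :=
  integrableOn_mul_kernelFn (p := 1 / 2) (by norm_num) (by fun_prop) fun x hx => by
    rw [abs_pow]; exact abs_log_pow_le_powMajorant hx n

theorem integrableOn_rpow_mul_kernelFn {s : ℝ} (hs : 0 ≤ s) :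
    IntegrableOn (fun x => x ^ s * kernelFn x) (Ioi 0) :=
  integrableOn_mul_kernelFn (p := s) (K := 1) (by linarith) (by fun_prop) fun x hx => by
    rw [abs_of_pos (Real.rpow_pos_of_pos hx s), one_mul]
    exact rpow_le_powMajorant hx (by linarith) le_rfl

theorem integrableOn_kernelFn : IntegrableOn kernelFn (Ioi 0) := by
  simpa using integrableOn_log_pow_mul_kernelFn 0

theorem bernoulliFn_nonneg {x : ℝ} (hx : 0 < x) : 0 ≤ bernoulliFn x :=
  div_nonneg hx.le (exp_sub_one_pos hx).le

/-- `x ^ s * (x / (e ^ x - 1))` tends to `0` at infinity. -/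
theorem tendsto_rpow_mul_bernoulliFn (s : ℝ) :
    Tendsto (fun x => x ^ s * bernoulliFn x) atTop (𝓝 0) := by
  have h := (tendsto_rpow_mul_exp_neg_mul_atTop_nhds_zero (s + 1) 1 one_pos).const_mul 2
  rw [mul_zero] at h
  refine squeeze_zero' ?_ ?_ h
  · filter_upwards [eventually_gt_atTop 0] with x hx
    exact mul_nonneg (Real.rpow_nonneg hx.le _) (bernoulliFn_nonneg hx)
  · filter_upwards [eventually_ge_atTop 1] with x hx
    have hx0 : 0 < x := by linarith
    have h2 : 2 ≤ Real.exp x := by linarith [Real.add_one_le_exp x]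
    rw [bernoulliFn, Real.rpow_add_one hx0.ne', ← mul_div_assoc, div_le_iff₀ (exp_sub_one_pos hx0)]
    have h3 : Real.exp (-1 * x) * Real.exp x = 1 := by rw [← Real.exp_add]; simp
    have h4 : 0 ≤ x ^ s * x := by positivity
    have h5 : 1 ≤ 2 * Real.exp (-1 * x) * (Real.exp x - 1) := by
      have : Real.exp (-1 * x) ≤ 1 / 2 := by
        have := Real.exp_pos (-1 * x); nlinarith
      nlinarith
    nlinarith

theorem tendsto_bernoulliFn_zero : Tendsto bernoulliFn (𝓝[>] 0) (𝓝 1) := by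
  have h := (Real.hasDerivAt_exp 0).tendsto_slope_zero_right
  have h2 := h.inv₀ (by simp)
  simp only [zero_add, Real.exp_zero, inv_one] at h2
  refine h2.congr' ?_
  filter_upwards [self_mem_nhdsWithin] with x hx
  simp [bernoulliFn, div_eq_mul_inv, mul_comm]

theorem integral_kernelFn : ∫ x in Ioi 0, kernelFn x = 1 := by
  -- Integration by parts against the constant `-1` serves as the fundamental theorem of calculus on
  -- an open half-line, with the boundary values `1` at `0+` and `0` at infinity taken as limits.
  have h := integral_Ioi_deriv_mul_eq_sub (a := 0) (u := bernoulliFn) (v := fun _ => (-1 : ℝ))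
    (u' := fun x => -kernelFn x) (v' := fun _ => 0) (a' := -1) (b' := 0)
    (fun x hx => hasDerivAt_bernoulliFn hx) (fun x _ => hasDerivAt_const _ _)
    (by
      refine integrableOn_kernelFn.congr (ae_of_all _ fun x => ?_)
      simp)
    (by
      have := tendsto_bernoulliFn_zero.neg
      refine this.congr fun x => ?_
      simp)
    (by
      have := (tendsto_rpow_mul_bernoulliFn 0).neg
      simp only [neg_zero] at this
      refine this.congr fun x => ?_
      simp)
  simpa using h

/-- The Mellin transform of `1 / (e ^ x - 1)`, with its integrability. -/
theorem integral_rpow_sub_one_mul_bernoulliFn {s : ℝ} (hs : 0 < s) :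
    IntegrableOn (fun x => x ^ (s - 1) * bernoulliFn x) (Ioi 0) ∧
    ∫ x in Ioi 0, x ^ (s - 1) * bernoulliFn x =
      Real.Gamma (s + 1) * ∑' n : ℕ, 1 / (n + 1 : ℝ) ^ (s + 1) := by
  set f : ℕ → ℝ → ℝ := fun n x => x ^ s * Real.exp (-(((n : ℝ) + 1) * x)) with hf
  have hintegr : ∀ n, IntegrableOn (f n) (Ioi 0) := by
    intro n
    have := integrableOn_rpow_mul_exp_neg_mul_rpow (s := s) (p := 1) (b := (n : ℝ) + 1)
      (by linarith) one_pos (by positivity)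
    refine this.congr (ae_of_all _ fun x => ?_)
    simp only [hf, Real.rpow_one]
    ring_nf
  have hval : ∀ n, ∫ x in Ioi 0, f n x = 1 / (n + 1 : ℝ) ^ (s + 1) * Real.Gamma (s + 1) := by
    intro n
    have := Real.integral_rpow_mul_exp_neg_mul_Ioi (a := s + 1) (r := (n : ℝ) + 1) (by linarith)
      (by positivity)
    rw [add_sub_cancel_right] at this
    rw [this, Real.div_rpow zero_le_one (by positivity), Real.one_rpow]
  have hsum : Summable fun n : ℕ => 1 / (n + 1 : ℝ) ^ (s + 1) := by
    have := (summable_nat_add_iff 1).2 (Real.summable_one_div_nat_rpow.2 (by linarith : 1 < s + 1))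
    exact_mod_cast this
  have hnorm : ∀ n, ∫ x in Ioi 0, ‖f n x‖ = ∫ x in Ioi 0, f n x := fun n =>
    setIntegral_congr_fun measurableSet_Ioi fun x hx =>
      Real.norm_of_nonneg (mul_nonneg (Real.rpow_nonneg (le_of_lt hx) _) (Real.exp_pos _).le)
  have hS : Summable fun n => ∫ x in Ioi 0, ‖f n x‖ := by
    simp_rw [hnorm, hval]
    exact hsum.mul_right _
  have hpt : ∀ x ∈ Ioi (0 : ℝ), HasSum (fun n => f n x) (x ^ (s - 1) * bernoulliFn x) := by
    intro x hx
    have hx : 0 < x := hx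
    have hlt : Real.exp (-x) < 1 := by simpa using hx
    have h := (hasSum_geometric_of_lt_one (Real.exp_pos (-x)).le hlt).mul_left (x ^ s * Real.exp (-x))
    have e1 : (fun n => f n x) = fun i => x ^ s * Real.exp (-x) * Real.exp (-x) ^ i := by
      ext n
      rw [mul_assoc, ← Real.exp_nat_mul, ← Real.exp_add]
      simp only [hf]
      ring_nf
    have e2 : x ^ (s - 1) * bernoulliFn x = x ^ s * Real.exp (-x) * (1 - Real.exp (-x))⁻¹ := by
      rw [Real.rpow_sub_one hx.ne']
      unfold bernoulliFn
      have h1 := (exp_sub_one_pos hx).ne'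
      have h2 : 1 - Real.exp (-x) ≠ 0 := by linarith
      have h3 : Real.exp (-x) * Real.exp x = 1 := by rw [← Real.exp_add]; simp
      field_simp
      linear_combination -h3
    rw [e1, e2]
    exact h
  have hae : ∀ᵐ x ∂volume.restrict (Ioi (0 : ℝ)), ∑' n, f n x = x ^ (s - 1) * bernoulliFn x := by
    filter_upwards [ae_restrict_mem measurableSet_Ioi] with x hx
    exact (hpt x hx).tsum_eq
  have hv : ∫ x in Ioi 0, x ^ (s - 1) * bernoulliFn x =
      Real.Gamma (s + 1) * ∑' n : ℕ, 1 / (n + 1 : ℝ) ^ (s + 1) := by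
    rw [← integral_congr_ae hae]
    rw [← integral_tsum_of_summable_integral_norm hintegr hS]
    simp_rw [hval]
    rw [tsum_mul_right, mul_comm]
  -- The integral of a non-integrable function is 0 by convention, so positivity of the computed
  -- value gives integrability.
  refine ⟨Integrable.of_integral_ne_zero ?_, hv⟩
  rw [hv]
  have h1 := Real.Gamma_pos_of_pos (by linarith : 0 < s + 1)
  have h2 := hsum.tsum_pos (fun n => by positivity) 0 (by simp)
  positivity

/-- Integration by parts moves the derivative onto `x ^ s`; both boundary terms vanish because `s >
0`. -/
theorem integral_rpow_mul_kernelFn {s : ℝ} (hs : 0 < s) :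
    ∫ x in Ioi 0, x ^ s * kernelFn x =
      s * (Real.Gamma (s + 1) * ∑' n : ℕ, 1 / (n + 1 : ℝ) ^ (s + 1)) := by
  obtain ⟨hi, hv⟩ := integral_rpow_sub_one_mul_bernoulliFn hs
  have h := integral_Ioi_mul_deriv_eq_deriv_mul (a := 0) (u := fun x : ℝ => x ^ s)
    (v := bernoulliFn) (u' := fun x => s * x ^ (s - 1)) (v' := fun x => -kernelFn x)
    (a' := 0) (b' := 0)
    (fun x hx => Real.hasDerivAt_rpow_const (Or.inl (ne_of_gt hx)))
    (fun x hx => hasDerivAt_bernoulliFn hx)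
    (by
      refine (integrableOn_rpow_mul_kernelFn hs.le).neg.congr (ae_of_all _ fun x => ?_)
      simp)
    (by
      refine (hi.const_mul s).congr (ae_of_all _ fun x => ?_)
      simp [mul_assoc])
    (by
      have h1 : Tendsto (fun x : ℝ => x ^ s) (𝓝[>] 0) (𝓝 0) := by
        have := (Real.continuousAt_rpow_const 0 s (Or.inr hs.le)).tendsto
        rw [Real.zero_rpow hs.ne'] at this
        exact this.mono_left nhdsWithin_le_nhds
      simpa [Pi.mul_def] using h1.mul tendsto_bernoulliFn_zero)
    (tendsto_rpow_mul_bernoulliFn s)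
  simp only [mul_neg, integral_neg, mul_assoc, integral_const_mul, hv] at h
  linarith

theorem zeta_re_eq_tsum {s : ℝ} (hs : 0 < s) :
    ((riemannZeta ((s : ℂ) + 1)).re) = ∑' n : ℕ, 1 / (n + 1 : ℝ) ^ (s + 1) := by
  have h : riemannZeta ((s : ℂ) + 1) = ((∑' n : ℕ, 1 / (n + 1 : ℝ) ^ (s + 1) : ℝ) : ℂ) := by
    rw [zeta_eq_tsum_one_div_nat_add_one_cpow (by simpa using hs), Complex.ofReal_tsum]
    congr 1 with n
    push_cast
    rw [Complex.ofReal_cpow (by positivity)]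
    push_cast
    rfl
  rw [h, Complex.ofReal_re]

/-- `-log (1 - e ^ (-y))` as an average of `log⁺ (z / y)`. -/
theorem integral_posLog_mul_kernelFn {y : ℝ} (hy : 0 < y) :
    IntegrableOn (fun z => Real.posLog (z / y) * kernelFn z) (Ioi 0) ∧
    ∫ z in Ioi 0, Real.posLog (z / y) * kernelFn z = -Real.log (1 - Real.exp (-y)) := by
  -- An antiderivative of `kernelFn z * (log z - log y)` that vanishes at infinity. At `z = y` its
  -- first summand vanishes and only `log (1 - e ^ (-y))` remains.
  set G : ℝ → ℝ := fun z => -bernoulliFn z * (Real.log z - Real.log y) +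
    Real.log (1 - Real.exp (-z)) with hG
  have hlt : ∀ z : ℝ, 0 < z → 0 < 1 - Real.exp (-z) := fun z hz => by
    have : Real.exp (-z) < 1 := by simpa using hz
    linarith
  have hd : ∀ z ∈ Ici y, HasDerivAt G (kernelFn z * (Real.log z - Real.log y)) z := by
    intro z hz
    have hz : 0 < z := hy.trans_le hz
    have h1 := (hasDerivAt_bernoulliFn hz).fun_neg.fun_mul
      ((Real.hasDerivAt_log hz.ne').sub_const (Real.log y))
    have h2 := (((hasDerivAt_neg z).exp).const_sub 1).log (hlt z hz).ne'
    refine (h1.fun_add h2).congr_deriv ?_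
    have h3 : Real.exp (-z) * Real.exp z = 1 := by rw [← Real.exp_add]; simp
    have h4 := (exp_sub_one_pos hz).ne'
    have h5 := (hlt z hz).ne'
    simp only [bernoulliFn, neg_neg, mul_neg, mul_one]
    have : -(z / (Real.exp z - 1)) * z⁻¹ + Real.exp (-z) / (1 - Real.exp (-z)) = 0 := by
      field_simp
      linear_combination h3
    linarith
  have hlim : Tendsto G atTop (𝓝 0) := by
    have h1 : Tendsto (fun z => bernoulliFn z * (Real.log z - Real.log y)) atTop (𝓝 0) := by
      have a1 : Tendsto (fun z => z ^ (1 : ℝ) * bernoulliFn z) atTop (𝓝 0) :=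
        tendsto_rpow_mul_bernoulliFn 1
      have a0 : Tendsto bernoulliFn atTop (𝓝 0) := by
        simpa using tendsto_rpow_mul_bernoulliFn 0
      have a2 : Tendsto (fun z : ℝ => bernoulliFn z * Real.log z) atTop (𝓝 0) := by
        refine squeeze_zero' ?_ ?_ a1
        · filter_upwards [eventually_ge_atTop 1] with z hz
          exact mul_nonneg (bernoulliFn_nonneg (by linarith)) (Real.log_nonneg hz)
        · filter_upwards [eventually_ge_atTop 1] with z hz
          rw [Real.rpow_one, mul_comm]
          exact mul_le_mul_of_nonneg_right (Real.log_le_self (by linarith))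
            (bernoulliFn_nonneg (by linarith))
      have := a2.sub (a0.mul_const (Real.log y))
      simp only [zero_mul, sub_zero] at this
      refine this.congr fun z => by ring
    have h2 : Tendsto (fun z : ℝ => Real.log (1 - Real.exp (-z))) atTop (𝓝 0) := by
      have : Tendsto (fun z : ℝ => 1 - Real.exp (-z)) atTop (𝓝 1) := by
        simpa using (Real.tendsto_exp_neg_atTop_nhds_zero).const_sub 1
      simpa using this.log one_ne_zero
    have := h1.neg.add h2
    simp only [neg_zero, add_zero] at this
    refine this.congr fun z => by simp only [hG]; ring
  have hnn : ∀ z ∈ Ioi y, 0 ≤ kernelFn z * (Real.log z - Real.log y) := fun z hz =>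
    mul_nonneg (kernelFn_nonneg z) (sub_nonneg.2 (Real.log_le_log hy (le_of_lt hz)))
  have hI := integrableOn_Ioi_deriv_of_nonneg' hd hnn hlim
  have hV := integral_Ioi_of_hasDerivAt_of_nonneg' hd hnn hlim
  have heq : EqOn (fun z => Real.posLog (z / y) * kernelFn z)
      ((Ioi y).indicator fun z => kernelFn z * (Real.log z - Real.log y)) (Ioi 0) := by
    intro z hz
    have hz : 0 < z := hz
    by_cases h : y < z
    · rw [indicator_of_mem (by exact h), ← Real.log_div hz.ne' hy.ne']
      have h1 : 1 ≤ |z / y| := by rw [abs_of_pos (by positivity)]; exact (one_le_div hy).2 h.le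
      simp only [Real.posLog_eq_log h1]
      ring
    · rw [indicator_of_notMem (by exact h)]
      have h1 : |z / y| ≤ 1 := by
        rw [abs_of_pos (by positivity)]; exact (div_le_one hy).2 (not_lt.1 h)
      simp [(Real.posLog_eq_zero_iff _).2 h1]
  have hsub : Ioi y ∩ Ioi (0 : ℝ) = Ioi y := inter_eq_left.2 (Ioi_subset_Ioi hy.le)
  constructor
  · rw [integrableOn_congr_fun heq measurableSet_Ioi]
    rw [IntegrableOn, integrable_indicator_iff measurableSet_Ioi, IntegrableOn,
      Measure.restrict_restrict measurableSet_Ioi, hsub]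
    exact hI
  · rw [setIntegral_congr_fun measurableSet_Ioi heq, setIntegral_indicator measurableSet_Ioi,
      inter_comm, hsub, hV]
    simp [hG]

-- Second order expansions of `ζ` and `Γ` at 1.

local notation "γ" => Real.eulerMascheroniConstant

/-- Minus the derivative at `s = 1` of `ZetaAsymptotics.term n s`. -/
def zetaLogTerm (n : ℕ) : ℝ := ∫ x : ℝ in n..(n + 1), (x - n) / x ^ 2 * Real.log x

theorem zetaLogTerm_eq {n : ℕ} (hn : 0 < n) :
    zetaLogTerm n = (Real.log (n + 1) ^ 2 / 2 - Real.log n ^ 2 / 2) +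
      (Real.log (n + 1) - Real.log n) - Real.log (n + 1) / (n + 1) - 1 / (n + 1) := by
  have hn' : (0 : ℝ) < n := by exact_mod_cast hn
  have hpos : ∀ x ∈ uIcc (n : ℝ) (n + 1), 0 < x := fun x hx => by
    rw [uIcc_of_le (by linarith)] at hx; exact hn'.trans_le hx.1
  have hd : ∀ x ∈ uIcc (n : ℝ) (n + 1),
      HasDerivAt (fun x => Real.log x ^ 2 / 2 + n * ((Real.log x + 1) / x))
        ((x - n) / x ^ 2 * Real.log x) x := by
    intro x hx
    have hx0 := (hpos x hx).ne'
    have h1 := ((Real.hasDerivAt_log hx0).fun_pow 2).div_const 2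
    have h2 := ((((Real.hasDerivAt_log hx0).add_const 1).fun_div (hasDerivAt_id x) hx0)).const_mul (n : ℝ)
    refine (h1.fun_add h2).congr_deriv ?_
    simp only [id]
    field_simp
    push_cast
    ring
  rw [zetaLogTerm, intervalIntegral.integral_eq_sub_of_hasDerivAt hd]
  · field_simp
    ring
  · refine ContinuousOn.intervalIntegrable ?_
    refine ContinuousOn.mul (ContinuousOn.div (by fun_prop) (by fun_prop) ?_) ?_
    · intro x hx; exact pow_ne_zero _ (hpos x hx).ne'
    · exact Real.continuousOn_log.mono fun x hx => (hpos x hx).ne'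

theorem zetaLogTerm_nonneg (n : ℕ) : 0 ≤ zetaLogTerm (n + 1) := by
  refine intervalIntegral.integral_nonneg (by linarith) fun x hx => ?_
  have h0 : (0 : ℝ) ≤ n := n.cast_nonneg
  have h1 := hx.1
  push_cast at h1
  refine mul_nonneg (div_nonneg ?_ (sq_nonneg _)) (Real.log_nonneg (by linarith))
  push_cast
  linarith

/-- The sum telescopes: the `log²` part rebuilds `stieltjesSeq`, and the rest rebuilds `harmonic -
log`. The index starts at 1, where the integrand is non-negative. -/
theorem sum_zetaLogTerm (N : ℕ) : ∑ n ∈ Finset.range N, zetaLogTerm (n + 1) =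
    1 - stieltjesSeq (N + 1) - (harmonic (N + 1) - Real.log (N + 1 : ℕ)) := by
  induction N with
  | zero => simp [stieltjesSeq]
  | succ N ih =>
    rw [Finset.sum_range_succ, ih, zetaLogTerm_eq (Nat.succ_pos N), harmonic_succ (N + 1)]
    have : stieltjesSeq (N + 1 + 1) = stieltjesSeq (N + 1)
        + Real.log (N + 1 + 1 : ℕ) / (N + 1 + 1 : ℕ)
        - (Real.log (N + 1 + 1 : ℕ) ^ 2 / 2 - Real.log (N + 1 : ℕ) ^ 2 / 2) := by
      unfold stieltjesSeq
      rw [Finset.sum_Icc_succ_top (by omega)]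
      ring
    rw [this]
    push_cast
    ring

theorem hasSum_zetaLogTerm :
    HasSum (fun n => zetaLogTerm (n + 1)) (1 - stieltjesGammaOne - γ) := by
  rw [hasSum_iff_tendsto_nat_of_nonneg zetaLogTerm_nonneg]
  simp_rw [sum_zetaLogTerm]
  refine (tendsto_const_nhds.sub (tendsto_stieltjesSeq.comp (tendsto_add_atTop_nat 1))).sub ?_
  have := Real.tendsto_harmonic_sub_log.comp (tendsto_add_atTop_nat 1)
  exact this

/-- The difference quotient of `x ^ (-s)` at `s = 0`, with an explicit error linear in `s`, so that
the limit can be taken inside each integral by squeezing. -/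
theorem one_sub_rpow_neg_bounds {x s : ℝ} (hx : 1 ≤ x) (hs : 0 < s) :
    Real.log x - s * Real.log x ^ 2 ≤ (1 - x ^ (-s)) / s ∧ (1 - x ^ (-s)) / s ≤ Real.log x := by
  have hl := Real.log_nonneg hx
  have h0 : 0 < x := by linarith
  rw [Real.rpow_def_of_pos h0, le_div_iff₀ hs, div_le_iff₀ hs]
  constructor
  · have h1 := Real.abs_exp_sub_one_sub_id_le (x := Real.log x * -s)
    by_cases h : Real.log x * s ≤ 1
    · have h2 := h1 (by rw [mul_neg, abs_neg, abs_of_nonneg (by positivity)]; exact h)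
      have := (abs_le.1 h2).2
      nlinarith
    · have h3 : Real.exp (Real.log x * -s) ≤ 1 := by
        rw [Real.exp_le_one_iff]; nlinarith [mul_nonneg hl hs.le]
      have : 0 ≤ (Real.log x * s) * (Real.log x * s - 1) :=
        mul_nonneg (by positivity) (by linarith)
      nlinarith
  · linarith [Real.add_one_le_exp (Real.log x * -s)]

theorem zeta_term_diff {n : ℕ} {s : ℝ} (hs : 0 < s) :
    (ZetaAsymptotics.term (n + 1) 1 - ZetaAsymptotics.term (n + 1) (1 + s)) / s =
      ∫ x : ℝ in (n + 1 : ℕ)..((n + 1 : ℕ) + 1), (x - (n + 1 : ℕ)) / x ^ 2 *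
        ((1 - x ^ (-s)) / s) := by
  rw [ZetaAsymptotics.term, ZetaAsymptotics.term,
    ← intervalIntegral.integral_sub (ZetaAsymptotics.term_welldef n.succ_pos one_pos)
      (ZetaAsymptotics.term_welldef n.succ_pos (by linarith)), ← intervalIntegral.integral_div]
  refine intervalIntegral.integral_congr fun x hx => ?_
  rw [uIcc_of_le (by linarith)] at hx
  have hx0 : 0 < x := lt_of_lt_of_le (by positivity) hx.1
  have e1 : x ^ ((1 : ℝ) + 1) = x ^ 2 := by norm_num
  have e2 : x ^ (1 + s + 1) = x ^ 2 * x ^ s := by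
    rw [show 1 + s + 1 = 2 + s by ring, Real.rpow_add hx0]; norm_num
  simp only [e1, e2, Real.rpow_neg hx0.le]
  have := (Real.rpow_pos_of_pos hx0 s).ne'
  field_simp

/-- The first two bounds supply the summable majorant and the third the termwise limit, for
dominated convergence in `tendsto_zeta_termTSum_slope`. -/
theorem zeta_term_diff_bounds (n : ℕ) {s : ℝ} (hs : 0 < s) :
    0 ≤ (ZetaAsymptotics.term (n + 1) 1 - ZetaAsymptotics.term (n + 1) (1 + s)) / s ∧
    (ZetaAsymptotics.term (n + 1) 1 - ZetaAsymptotics.term (n + 1) (1 + s)) / s ≤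
      zetaLogTerm (n + 1) ∧
    zetaLogTerm (n + 1) - s * (∫ x : ℝ in (n + 1 : ℕ)..((n + 1 : ℕ) + 1),
        (x - (n + 1 : ℕ)) / x ^ 2 * Real.log x ^ 2) ≤
      (ZetaAsymptotics.term (n + 1) 1 - ZetaAsymptotics.term (n + 1) (1 + s)) / s := by
  rw [zeta_term_diff hs, zetaLogTerm]
  have hle : ((n + 1 : ℕ) : ℝ) ≤ (n + 1 : ℕ) + 1 := by linarith
  have hone : ∀ x ∈ Icc ((n + 1 : ℕ) : ℝ) ((n + 1 : ℕ) + 1), 1 ≤ x := fun x hx => by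
    refine le_trans ?_ hx.1; push_cast; linarith [(n.cast_nonneg : (0 : ℝ) ≤ n)]
  have hw : ∀ x ∈ Icc ((n + 1 : ℕ) : ℝ) ((n + 1 : ℕ) + 1), 0 ≤ (x - (n + 1 : ℕ)) / x ^ 2 :=
    fun x hx => div_nonneg (sub_nonneg.2 hx.1) (sq_nonneg _)
  have hcw : ContinuousOn (fun x : ℝ => (x - (n + 1 : ℕ)) / x ^ 2)
      (uIcc ((n + 1 : ℕ) : ℝ) ((n + 1 : ℕ) + 1)) := by
    rw [uIcc_of_le hle]
    refine ContinuousOn.div (by fun_prop) (by fun_prop) fun x hx => pow_ne_zero _ ?_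
    linarith [hone x hx]
  have hcl : ContinuousOn Real.log (uIcc ((n + 1 : ℕ) : ℝ) ((n + 1 : ℕ) + 1)) := by
    rw [uIcc_of_le hle]
    exact Real.continuousOn_log.mono fun x hx => by
      have := hone x hx; simp only [mem_compl_iff, mem_singleton_iff]; linarith
  have hcp : ContinuousOn (fun x : ℝ => (1 - x ^ (-s)) / s)
      (uIcc ((n + 1 : ℕ) : ℝ) ((n + 1 : ℕ) + 1)) := by
    rw [uIcc_of_le hle]
    refine ContinuousOn.div_const (continuousOn_const.sub fun x hx => ?_) _
    exact (Real.continuousAt_rpow_const x _ (Or.inl (by linarith [hone x hx]))).continuousWithinAt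
  refine ⟨?_, ?_, ?_⟩
  · refine intervalIntegral.integral_nonneg hle fun x hx => mul_nonneg (hw x hx) ?_
    have : x ^ (-s) ≤ 1 := Real.rpow_le_one_of_one_le_of_nonpos (hone x hx) (by linarith)
    exact div_nonneg (by linarith) hs.le
  · exact intervalIntegral.integral_mono_on hle (hcw.mul hcp).intervalIntegrable
      (hcw.mul hcl).intervalIntegrable fun x hx =>
        mul_le_mul_of_nonneg_left (one_sub_rpow_neg_bounds (hone x hx) hs).2 (hw x hx)
  · have i1 : IntervalIntegrable (fun x : ℝ => (x - (n + 1 : ℕ)) / x ^ 2 * Real.log x) volume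
        (n + 1 : ℕ) ((n + 1 : ℕ) + 1) := (hcw.mul hcl).intervalIntegrable
    have i2 : IntervalIntegrable (fun x : ℝ => s * ((x - (n + 1 : ℕ)) / x ^ 2 * Real.log x ^ 2))
        volume (n + 1 : ℕ) ((n + 1 : ℕ) + 1) :=
      (hcw.mul (hcl.pow 2)).intervalIntegrable.const_mul s
    rw [← intervalIntegral.integral_const_mul, ← intervalIntegral.integral_sub i1 i2]
    refine intervalIntegral.integral_mono_on hle (i1.sub i2)
      (hcw.mul hcp).intervalIntegrable fun x hx => ?_
    have := mul_le_mul_of_nonneg_left (one_sub_rpow_neg_bounds (hone x hx) hs).1 (hw x hx)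
    linarith

theorem summable_zeta_term {s : ℝ} (hs : 0 < s) :
    Summable fun n => ZetaAsymptotics.term (n + 1) (1 + s) := by
  refine ZetaAsymptotics.term_tsum_one.summable.of_nonneg_of_le
    (fun n => ZetaAsymptotics.term_nonneg _ _) fun n => ?_
  have := (zeta_term_diff_bounds n hs).1
  rw [le_div_iff₀ hs] at this
  linarith

theorem tendsto_zeta_termTSum_slope :
    Tendsto (fun s => (ZetaAsymptotics.termTSum 1 - ZetaAsymptotics.termTSum (1 + s)) / s)
      (𝓝[>] 0) (𝓝 (1 - stieltjesGammaOne - γ)) := by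
  rw [← hasSum_zetaLogTerm.tsum_eq]
  have key : Tendsto (fun s => ∑' n,
      (ZetaAsymptotics.term (n + 1) 1 - ZetaAsymptotics.term (n + 1) (1 + s)) / s)
      (𝓝[>] 0) (𝓝 (∑' n, zetaLogTerm (n + 1))) := by
    refine tendsto_tsum_of_dominated_convergence (bound := fun n => zetaLogTerm (n + 1))
      hasSum_zetaLogTerm.summable (fun n => ?_) ?_
    · set J := ∫ x : ℝ in (n + 1 : ℕ)..((n + 1 : ℕ) + 1),
        (x - (n + 1 : ℕ)) / x ^ 2 * Real.log x ^ 2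
      have h1 : Tendsto (fun s : ℝ => zetaLogTerm (n + 1) - s * J) (𝓝[>] 0)
          (𝓝 (zetaLogTerm (n + 1))) := by
        have : Tendsto (fun s : ℝ => zetaLogTerm (n + 1) - s * J) (𝓝 0)
            (𝓝 (zetaLogTerm (n + 1) - 0 * J)) :=
          (continuous_const.sub (continuous_id.mul continuous_const)).tendsto 0
        rw [zero_mul, sub_zero] at this
        exact this.mono_left nhdsWithin_le_nhds
      refine tendsto_of_tendsto_of_tendsto_of_le_of_le' h1 tendsto_const_nhds ?_ ?_
      · filter_upwards [self_mem_nhdsWithin] with s hs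
        exact (zeta_term_diff_bounds n hs).2.2
      · filter_upwards [self_mem_nhdsWithin] with s hs
        exact (zeta_term_diff_bounds n hs).2.1
    · filter_upwards [self_mem_nhdsWithin] with s hs n
      obtain ⟨h1, h2, -⟩ := zeta_term_diff_bounds n hs
      rw [Real.norm_of_nonneg h1]
      exact h2
  refine key.congr' ?_
  filter_upwards [self_mem_nhdsWithin] with s hs
  rw [tsum_div_const, (ZetaAsymptotics.term_tsum_one.summable).tsum_sub (summable_zeta_term hs)]
  rfl

/-- The expansion `s ζ(s + 1) = 1 + γ s - γ₁ s² + o(s²)`. -/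
theorem tendsto_zeta_second_order :
    Tendsto (fun s : ℝ => (s * ∑' n : ℕ, 1 / (n + 1 : ℝ) ^ (s + 1) - 1 - γ * s) / s ^ 2)
      (𝓝[>] 0) (𝓝 (-stieltjesGammaOne)) := by
  have hT1 : ZetaAsymptotics.termTSum 1 = 1 - γ := ZetaAsymptotics.term_tsum_one.tsum_eq
  have h1 := tendsto_zeta_termTSum_slope
  have h2 : Tendsto (fun s : ℝ => ZetaAsymptotics.termTSum (1 + s)) (𝓝[>] 0) (𝓝 (1 - γ)) := by
    have h := h1.mul (tendsto_nhdsWithin_of_tendsto_nhds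
      (s := Ioi (0 : ℝ)) (tendsto_id (α := ℝ) (x := 𝓝 0)))
    have h' := h.const_sub (1 - γ)
    simp only [id, mul_zero, sub_zero] at h'
    refine h'.congr' ?_
    filter_upwards [self_mem_nhdsWithin] with s hs
    rw [div_mul_cancel₀ _ (ne_of_gt hs), hT1]
    ring
  -- Since `s ζ(s+1) = 1 + s - s (s+1) T(1+s)` with `T = termTSum` and `T(1) = 1 - γ`, the quotient
  -- equals `(T(1) - T(1+s)) / s - T(1+s)`.
  have h3 := h1.sub h2
  rw [show 1 - stieltjesGammaOne - γ - (1 - γ) = -stieltjesGammaOne by ring] at h3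
  refine h3.congr' ?_
  filter_upwards [self_mem_nhdsWithin] with s hs
  have hs : 0 < s := hs
  have h4 := ZetaAsymptotics.zeta_limit_aux1 (s := s + 1) (by linarith)
  have h5 : ∑' n : ℕ, 1 / (n + 1 : ℝ) ^ (s + 1) =
      1 / s + 1 - (s + 1) * ZetaAsymptotics.termTSum (1 + s) := by
    rw [add_sub_cancel_right] at h4
    rw [add_comm 1 s]
    linarith
  rw [h5, hT1]
  field_simp
  ring

/-- Only existence of the limit is obtained here, from analyticity: `Γ(1 + z)` is holomorphic on the
unit disc, hence so is its divided difference iterated twice at 0. The value is found afterwards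
from the reflection formula, which needs the limit from both sides. -/
theorem exists_tendsto_Gamma_second_order :
    ∃ b : ℝ, Tendsto (fun s : ℝ => (Real.Gamma (1 + s) - 1 + γ * s) / s ^ 2) (𝓝[≠] 0) (𝓝 b) := by
  set f : ℂ → ℂ := fun z => Complex.Gamma (1 + z) with hf
  have hU : Metric.ball (0 : ℂ) 1 ∈ 𝓝 (0 : ℂ) := Metric.ball_mem_nhds _ one_pos
  have hfd : DifferentiableOn ℂ f (Metric.ball 0 1) := by
    intro z hz
    refine DifferentiableAt.differentiableWithinAt ?_
    refine DifferentiableAt.comp z (Complex.differentiableAt_Gamma _ fun m hm => ?_) (by fun_prop)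
    have hz' : ‖z‖ < 1 := by simpa using hz
    have h1 : z = -(m + 1 : ℕ) := by push_cast; linear_combination hm
    rw [h1, norm_neg, Complex.norm_natCast] at hz'
    push_cast at hz'
    linarith [(m.cast_nonneg : (0 : ℝ) ≤ m)]
  have h1 := (Complex.differentiableOn_dslope hU).2 hfd
  have h2 := (Complex.differentiableOn_dslope hU).2 h1
  have hcont : ContinuousAt (dslope (dslope f 0) 0) 0 := (h2.differentiableAt hU).continuousAt
  have hder : HasDerivAt f (-γ) 0 := by
    have h := Complex.hasDerivAt_Gamma_one
    rw [← add_zero (1 : ℂ)] at h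
    exact h.comp_const_add 1 0
  refine ⟨(dslope (dslope f 0) 0 0).re, ?_⟩
  have hre : Tendsto (fun s : ℝ => (dslope (dslope f 0) 0 (s : ℂ)).re) (𝓝[≠] 0)
      (𝓝 (dslope (dslope f 0) 0 0).re) := by
    have h3 : Tendsto (fun s : ℝ => (s : ℂ)) (𝓝 0) (𝓝 0) := by
      simpa using (Complex.continuous_ofReal.tendsto 0)
    exact ((Complex.continuous_re.tendsto _).comp (hcont.tendsto.comp h3)).mono_left
      nhdsWithin_le_nhds
  refine hre.congr' ?_
  filter_upwards [self_mem_nhdsWithin] with s hs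
  have hs0 : (s : ℂ) ≠ 0 := by exact_mod_cast hs
  have e : dslope (dslope f 0) 0 (s : ℂ) = (((Real.Gamma (1 + s) - 1 + γ * s) / s ^ 2 : ℝ) : ℂ) := by
    rw [dslope_of_ne _ hs0, slope_def_field, dslope_of_ne _ hs0, slope_def_field, dslope_same,
      hder.deriv]
    simp only [hf, add_zero, Complex.Gamma_one, sub_zero]
    push_cast
    rw [← Complex.Gamma_ofReal]
    push_cast
    field_simp
    ring
  rw [e, Complex.ofReal_re]

theorem tendsto_mul_pi_div_sin_second_order :
    Tendsto (fun s : ℝ => (Real.pi * s / Real.sin (Real.pi * s) - 1) / s ^ 2) (𝓝[≠] 0)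
      (𝓝 (Real.pi ^ 2 / 6)) := by
  have hx : Tendsto (fun x : ℝ => (x / Real.sin x - 1) / x ^ 2) (𝓝[≠] 0) (𝓝 (1 / 6)) := by
    have h1 : Tendsto (fun x : ℝ => (x - Real.sin x) / x ^ 3) (𝓝[≠] 0) (𝓝 (1 / 6)) := by
      have h0 : Tendsto (fun x : ℝ => |x| * (5 / 96)) (𝓝[≠] 0) (𝓝 0) := by
        have : Tendsto (fun x : ℝ => |x| * (5 / 96)) (𝓝 0) (𝓝 (|0| * (5 / 96))) :=
          (continuous_abs.mul continuous_const).tendsto 0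
        simp only [abs_zero, zero_mul] at this
        exact this.mono_left nhdsWithin_le_nhds
      rw [tendsto_iff_norm_sub_tendsto_zero]
      refine squeeze_zero' (Eventually.of_forall fun _ => norm_nonneg _) ?_ h0
      have hsm : ∀ᶠ x : ℝ in 𝓝[≠] 0, |x| ≤ 1 := by
        have : Metric.closedBall (0 : ℝ) 1 ∈ 𝓝 (0 : ℝ) := Metric.closedBall_mem_nhds _ one_pos
        filter_upwards [nhdsWithin_le_nhds this] with x hx
        simpa using hx
      filter_upwards [self_mem_nhdsWithin, hsm] with x hx hx1
      have hx0 : x ≠ 0 := hx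
      have hb := Real.sin_bound hx1
      have e : (x - Real.sin x) / x ^ 3 - 1 / 6 = -(Real.sin x - (x - x ^ 3 / 6)) / x ^ 3 := by
        field_simp
        ring
      rw [e, Real.norm_eq_abs, abs_div, abs_neg, abs_pow, div_le_iff₀ (by positivity)]
      calc _ ≤ _ := hb
        _ ≤ _ := by nlinarith [pow_nonneg (abs_nonneg x) 4, pow_nonneg (abs_nonneg x) 5]
    have h2 : Tendsto (fun x : ℝ => x / Real.sin x) (𝓝[≠] 0) (𝓝 1) := by
      have := (Real.hasDerivAt_sin 0).tendsto_slope_zero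
      have := this.inv₀ (by simp)
      simp only [zero_add, Real.sin_zero, sub_zero, smul_eq_mul, Real.cos_zero, inv_one] at this
      refine this.congr fun x => ?_
      rw [mul_inv, inv_inv, div_eq_mul_inv]
    have h3 := h1.mul h2
    rw [mul_one] at h3
    have hsin : ∀ᶠ x : ℝ in 𝓝[≠] 0, Real.sin x ≠ 0 := by
      filter_upwards [h2.eventually_ne one_ne_zero] with x hx h
      simp [h] at hx
    refine h3.congr' ?_
    filter_upwards [self_mem_nhdsWithin, hsin] with x hx hs
    have hx0 : x ≠ 0 := hx
    field_simp
  have hpi : Tendsto (fun s : ℝ => Real.pi * s) (𝓝[≠] 0) (𝓝[≠] 0) := by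
    refine tendsto_nhdsWithin_of_tendsto_nhds_of_eventually_within _ ?_ ?_
    · have : Tendsto (fun s : ℝ => Real.pi * s) (𝓝 0) (𝓝 (Real.pi * 0)) :=
        (continuous_const.mul continuous_id).tendsto 0
      rw [mul_zero] at this
      exact this.mono_left nhdsWithin_le_nhds
    · filter_upwards [self_mem_nhdsWithin] with s hs
      exact mul_ne_zero Real.pi_ne_zero hs
  have h4 := (hx.comp hpi).const_mul (Real.pi ^ 2)
  rw [show Real.pi ^ 2 * (1 / 6) = Real.pi ^ 2 / 6 by ring] at h4
  refine h4.congr' ?_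
  filter_upwards [self_mem_nhdsWithin] with s hs
  have hs0 : s ≠ 0 := hs
  have := Real.pi_ne_zero
  simp only [Function.comp]
  field_simp

/-- The expansion `Γ(1 + s) = 1 - γ s + (γ² / 2 + π² / 12) s² + o(s²)`. -/
theorem tendsto_Gamma_second_order :
    Tendsto (fun s : ℝ => (Real.Gamma (1 + s) - 1 + γ * s) / s ^ 2) (𝓝[>] 0)
      (𝓝 (γ ^ 2 / 2 + Real.pi ^ 2 / 12)) := by
  obtain ⟨b, hb⟩ := exists_tendsto_Gamma_second_order
  set p : ℝ → ℝ := fun s => (Real.Gamma (1 + s) - 1 + γ * s) / s ^ 2 with hp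
  have hneg : Tendsto (fun s : ℝ => -s) (𝓝[≠] 0) (𝓝[≠] 0) := by
    refine tendsto_nhdsWithin_of_tendsto_nhds_of_eventually_within _ ?_ ?_
    · have : Tendsto (fun s : ℝ => -s) (𝓝 0) (𝓝 (-0)) := continuous_neg.tendsto 0
      rw [neg_zero] at this
      exact this.mono_left nhdsWithin_le_nhds
    · filter_upwards [self_mem_nhdsWithin] with s hs
      exact neg_ne_zero.2 hs
  have hbn := hb.comp hneg
  have hid : Tendsto (fun s : ℝ => s) (𝓝[≠] 0) (𝓝 0) := nhdsWithin_le_nhds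
  -- This is `(Γ(1+s) Γ(1-s) - 1) / s²` expanded through `Γ(1 ± s) = 1 ∓ γ s + s² p(±s)`. Its limit
  -- `2b - γ²` must equal the `π²/6` coming from `π s / sin (π s)`.
  have hL : Tendsto (fun s => p s + p (-s) - γ ^ 2 + γ * s * (p s - p (-s)) +
      s ^ 2 * (p s * p (-s))) (𝓝[≠] 0) (𝓝 (b + b - γ ^ 2 + γ * 0 * (b - b) + 0 ^ 2 * (b * b))) :=
    (((hb.add hbn).sub tendsto_const_nhds).add
      ((hid.const_mul γ).mul (hb.sub hbn))).add ((hid.pow 2).mul (hb.mul hbn))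
  have hR := tendsto_mul_pi_div_sin_second_order
  have heq : ∀ᶠ s : ℝ in 𝓝[≠] 0, p s + p (-s) - γ ^ 2 + γ * s * (p s - p (-s)) +
      s ^ 2 * (p s * p (-s)) = (Real.pi * s / Real.sin (Real.pi * s) - 1) / s ^ 2 := by
    filter_upwards [self_mem_nhdsWithin] with s hs
    have hs0 : s ≠ 0 := hs
    have h1 : Real.Gamma (1 + s) * Real.Gamma (1 - s) = Real.pi * s / Real.sin (Real.pi * s) := by
      rw [add_comm, Real.Gamma_add_one hs0, mul_assoc, Real.Gamma_mul_Gamma_one_sub]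
      ring
    rw [← h1]
    simp only [hp, ← sub_eq_add_neg]
    field_simp
    ring
  have huniq := tendsto_nhds_unique (hL.congr' heq) hR
  have hbv : b = γ ^ 2 / 2 + Real.pi ^ 2 / 12 := by linarith
  rw [← hbv]
  exact hb.mono_left (nhdsWithin_mono _ fun s hs => ne_of_gt hs)

/-- The second order expansion at `s = 0` of `s Γ(s + 1) ζ(s + 1)`. -/
theorem tendsto_mellin_kernelFn_second_order :
    Tendsto (fun s : ℝ => ((∫ x in Ioi 0, x ^ s * kernelFn x) - 1) / s ^ 2) (𝓝[>] 0)
      (𝓝 ((Real.pi ^ 2 / 6 - 2 * stieltjesGammaOne - γ ^ 2) / 2)) := by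
  have hid : Tendsto (fun s : ℝ => s) (𝓝[>] 0) (𝓝 0) := nhdsWithin_le_nhds
  have hp := tendsto_Gamma_second_order
  have hq := tendsto_zeta_second_order
  set p : ℝ → ℝ := fun s => (Real.Gamma (1 + s) - 1 + γ * s) / s ^ 2 with hpdef
  set q : ℝ → ℝ := fun s => (s * ∑' n : ℕ, 1 / (n + 1 : ℝ) ^ (s + 1) - 1 - γ * s) / s ^ 2
    with hqdef
  -- The product `(1 - γ s + s² p)(1 + γ s + s² q)` has no linear term, and its `s²` coefficient
  -- tends to `lim p + lim q - γ²`.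
  have h := (((hp.add hq).sub (tendsto_const_nhds (x := γ ^ 2))).add
    ((hid.const_mul γ).mul (hp.sub hq))).add ((hid.pow 2).mul (hp.mul hq))
  refine (h.congr' ?_).trans (le_of_eq ?_)
  · filter_upwards [self_mem_nhdsWithin] with s hs
    have hs : 0 < s := hs
    rw [integral_rpow_mul_kernelFn hs, add_comm s 1]
    have e1 : Real.Gamma (1 + s) = 1 - γ * s + s ^ 2 * p s := by
      simp only [hpdef]; field_simp; ring
    have e2 : s * ∑' n : ℕ, 1 / (n + 1 : ℝ) ^ (1 + s) = 1 + γ * s + s ^ 2 * q s := by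
      simp only [hqdef, add_comm 1 s]; field_simp; ring
    have e3 : s * (Real.Gamma (1 + s) * ∑' n : ℕ, 1 / (n + 1 : ℝ) ^ (1 + s)) =
        (1 - γ * s + s ^ 2 * p s) * (1 + γ * s + s ^ 2 * q s) := by
      rw [mul_left_comm, e1, e2]
    rw [e3]
    field_simp
    ring
  · congr 1
    ring

/-! ### Logarithmic moments of the kernel. -/

/-- The cubic Taylor remainder is at most `|log x|³ e ^ (s |log x|) s³`. For `s ≤ 1/4` each of the
first two factors is bounded by powers `x ^ (±1/4)` (`384 = 3! * 4³`), and their product fits under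
`powMajorant (1/2)`. -/
theorem abs_rpow_sub_taylor_le {x s : ℝ} (hx : 0 < x) (hs : 0 < s) (hs1 : s ≤ 1 / 4) :
    |x ^ s - (1 + s * Real.log x + s ^ 2 / 2 * Real.log x ^ 2)| ≤
      s ^ 3 * (3072 * powMajorant (1 / 2) x) := by
  have h : ‖x ^ s - ∑ m ∈ Finset.range 3, (Real.log x * s) ^ m / (m.factorial : ℝ)‖ ≤
      ‖Real.log x * s‖ ^ 3 * Real.exp ‖Real.log x * s‖ := by
    have h := Complex.norm_exp_sub_sum_le_norm_mul_exp ((Real.log x * s : ℝ) : ℂ) 3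
    rw [Complex.norm_real] at h
    refine le_trans (le_of_eq ?_) h
    rw [Real.rpow_def_of_pos hx, ← Complex.norm_real]
    push_cast
    rfl
  have e : ∑ m ∈ Finset.range 3, (Real.log x * s) ^ m / (m.factorial : ℝ) =
      1 + s * Real.log x + s ^ 2 / 2 * Real.log x ^ 2 := by
    simp [Finset.sum_range_succ, Nat.factorial]
    ring
  rw [e, Real.norm_eq_abs, Real.norm_eq_abs, abs_mul, abs_of_pos hs, mul_pow] at h
  refine h.trans ?_
  have h1 := abs_log_pow_le hx (by norm_num : (0 : ℝ) < 1 / 4) 3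
  have h2 : Real.exp (|Real.log x| * s) ≤ x ^ (-(1 / 4) : ℝ) + x ^ (1 / 4 : ℝ) := by
    have h3 : Real.exp (|Real.log x| * s) ≤ Real.exp (|Real.log x| * (1 / 4)) :=
      Real.exp_le_exp.2 (mul_le_mul_of_nonneg_left hs1 (abs_nonneg _))
    refine h3.trans ?_
    rw [Real.rpow_def_of_pos hx, Real.rpow_def_of_pos hx]
    rcases abs_cases (Real.log x) with ⟨h, _⟩ | ⟨h, _⟩
    · rw [h]; linarith [Real.exp_pos (Real.log x * -(1 / 4))]
    · rw [h, show -Real.log x * (1 / 4) = Real.log x * -(1 / 4) by ring]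
      linarith [Real.exp_pos (Real.log x * (1 / 4))]
  set a := x ^ (1 / 4 : ℝ) with ha
  set b := x ^ (-(1 / 4) : ℝ) with hb
  have ha0 : 0 < a := Real.rpow_pos_of_pos hx _
  have hb0 : 0 < b := Real.rpow_pos_of_pos hx _
  have haa : powMajorant (1 / 2) x = b ^ 2 + a ^ 2 := by
    rw [powMajorant, ha, hb, ← Real.rpow_natCast, ← Real.rpow_natCast, ← Real.rpow_mul hx.le,
      ← Real.rpow_mul hx.le]
    norm_num
  rw [haa]
  have h4 : |Real.log x| ^ 3 ≤ 384 * (b + a) := by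
    refine h1.trans (le_of_eq ?_)
    norm_num [Nat.factorial]
  have h5 : |Real.log x| ^ 3 * Real.exp (|Real.log x| * s) ≤ 384 * (b + a) * (b + a) :=
    mul_le_mul h4 h2 (Real.exp_pos _).le (by positivity)
  have h6 : 384 * (b + a) * (b + a) ≤ 3072 * (b ^ 2 + a ^ 2) := by nlinarith [sq_nonneg (b - a)]
  calc |Real.log x| ^ 3 * s ^ 3 * Real.exp (|Real.log x| * s)
      = s ^ 3 * (|Real.log x| ^ 3 * Real.exp (|Real.log x| * s)) := by ring
    _ ≤ s ^ 3 * (3072 * (b ^ 2 + a ^ 2)) :=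
        mul_le_mul_of_nonneg_left (h5.trans h6) (by positivity)

theorem exists_mellin_kernelFn_taylor :
    ∃ K : ℝ, ∀ s : ℝ, 0 < s → s ≤ 1 / 4 →
      |(∫ x in Ioi 0, x ^ s * kernelFn x) - (1 + s * (∫ x in Ioi 0, Real.log x * kernelFn x) +
        s ^ 2 / 2 * ∫ x in Ioi 0, Real.log x ^ 2 * kernelFn x)| ≤ s ^ 3 * K := by
  refine ⟨∫ x in Ioi 0, 3072 * powMajorant (1 / 2) x * kernelFn x, fun s hs hs1 => ?_⟩
  have i0 := integrableOn_rpow_mul_kernelFn hs.le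
  have i1 : IntegrableOn (fun x => s * (Real.log x * kernelFn x)) (Ioi 0) := by
    have := (integrableOn_log_pow_mul_kernelFn 1).const_mul s
    simp only [pow_one] at this
    exact this
  have i2 : IntegrableOn (fun x => s ^ 2 / 2 * (Real.log x ^ 2 * kernelFn x)) (Ioi 0) :=
    (integrableOn_log_pow_mul_kernelFn 2).const_mul _
  have iw := integrableOn_kernelFn
  have e : (∫ x in Ioi 0, x ^ s * kernelFn x) - (1 + s * (∫ x in Ioi 0, Real.log x * kernelFn x) +
        s ^ 2 / 2 * ∫ x in Ioi 0, Real.log x ^ 2 * kernelFn x) =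
      ∫ x in Ioi 0, (x ^ s * kernelFn x - (kernelFn x + s * (Real.log x * kernelFn x) +
        s ^ 2 / 2 * (Real.log x ^ 2 * kernelFn x))) := by
    have i3 : IntegrableOn (fun x => kernelFn x + s * (Real.log x * kernelFn x)) (Ioi 0) :=
      iw.add i1
    have i4 : IntegrableOn (fun x => kernelFn x + s * (Real.log x * kernelFn x) +
        s ^ 2 / 2 * (Real.log x ^ 2 * kernelFn x)) (Ioi 0) := i3.add i2
    rw [integral_sub i0 i4, integral_add i3 i2, integral_add iw i1,
      integral_const_mul, integral_const_mul, integral_kernelFn]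
  rw [e, ← Real.norm_eq_abs, ← integral_const_mul]
  refine norm_integral_le_of_norm_le ?_ ?_
  · have := (integrableOn_powMajorant_mul_kernelFn (p := 1 / 2) (by norm_num)).const_mul (s ^ 3 * 3072)
    refine this.congr (ae_of_all _ fun x => ?_)
    simp only
    ring
  · filter_upwards [ae_restrict_mem measurableSet_Ioi] with x hx
    have h1 := abs_rpow_sub_taylor_le hx hs hs1
    have h2 := kernelFn_nonneg x
    have e2 : x ^ s * kernelFn x - (kernelFn x + s * (Real.log x * kernelFn x) +
        s ^ 2 / 2 * (Real.log x ^ 2 * kernelFn x)) =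
        (x ^ s - (1 + s * Real.log x + s ^ 2 / 2 * Real.log x ^ 2)) * kernelFn x := by ring
    rw [e2, norm_mul, Real.norm_eq_abs, Real.norm_of_nonneg h2]
    calc _ ≤ s ^ 3 * (3072 * powMajorant (1 / 2) x) * kernelFn x := by gcongr
      _ = _ := by ring

/-- Two expansions of the Mellin transform `H(s)` at 0 are compared. As `(H - 1) / s²` has a finite
limit, the linear Taylor coefficient `I₁` must vanish, and then that limit is `I₂ / 2`. -/
theorem integral_log_mul_kernelFn_and_sq :
    (∫ x in Ioi 0, Real.log x * kernelFn x = 0) ∧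
    ∫ x in Ioi 0, Real.log x ^ 2 * kernelFn x =
      Real.pi ^ 2 / 6 - 2 * stieltjesGammaOne - γ ^ 2 := by
  obtain ⟨K, hK⟩ := exists_mellin_kernelFn_taylor
  have hq := tendsto_mellin_kernelFn_second_order
  set H : ℝ → ℝ := fun s => ∫ x in Ioi 0, x ^ s * kernelFn x
  set I₁ := ∫ x in Ioi 0, Real.log x * kernelFn x
  set I₂ := ∫ x in Ioi 0, Real.log x ^ 2 * kernelFn x
  have hid : Tendsto (fun s : ℝ => s) (𝓝[>] 0) (𝓝 0) := nhdsWithin_le_nhds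
  have hsm : ∀ᶠ s : ℝ in 𝓝[>] 0, 0 < s ∧ s ≤ 1 / 4 :=
    Ioc_mem_nhdsGT (by norm_num)
  have hr : Tendsto (fun s => (H s - 1) / s ^ 2 - I₁ / s - I₂ / 2) (𝓝[>] 0) (𝓝 0) := by
    have h0 : Tendsto (fun s : ℝ => s * K) (𝓝[>] 0) (𝓝 0) := by simpa using hid.mul_const K
    refine squeeze_zero_norm' ?_ h0
    filter_upwards [hsm] with s ⟨hs, hs1⟩
    have h := hK s hs hs1
    have e : (H s - 1) / s ^ 2 - I₁ / s - I₂ / 2 = (H s - (1 + s * I₁ + s ^ 2 / 2 * I₂)) / s ^ 2 := by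
      field_simp
      ring
    rw [e, norm_div, Real.norm_eq_abs, Real.norm_of_nonneg (by positivity), div_le_iff₀ (by positivity)]
    calc _ ≤ _ := h
      _ = _ := by ring
  have h1 : I₁ = 0 := by
    have h2 : Tendsto (fun s => ((H s - 1) / s ^ 2 - ((H s - 1) / s ^ 2 - I₁ / s - I₂ / 2) - I₂ / 2) * s)
        (𝓝[>] 0) (𝓝 0) := by
      have := ((hq.sub hr).sub_const (I₂ / 2)).mul hid
      rwa [mul_zero] at this
    have h3 : Tendsto (fun _ : ℝ => I₁) (𝓝[>] 0) (𝓝 0) := by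
      refine h2.congr' ?_
      filter_upwards [hsm] with s ⟨hs, _⟩
      field_simp
      ring
    exact tendsto_nhds_unique tendsto_const_nhds h3
  refine ⟨h1, ?_⟩
  have h2 := hq.sub hr
  have h3 : Tendsto (fun _ : ℝ => I₂ / 2) (𝓝[>] 0)
      (𝓝 ((Real.pi ^ 2 / 6 - 2 * stieltjesGammaOne - γ ^ 2) / 2 - 0)) := by
    refine h2.congr' ?_
    filter_upwards [hsm] with s ⟨hs, _⟩
    rw [h1]
    ring
  have := tendsto_nhds_unique tendsto_const_nhds h3
  linarith

/-! ### Averaging the counting function: expansion of the log generating function. -/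

/-- The logarithmic integral `∫_0^u N(t) / t dt` of the counting function. -/
def logCount (lam : ℕ → ℝ) (u : ℝ) : ℝ := ∫ t in (0 : ℝ)..u, (countingFn lam t : ℝ) / t

/-- The logarithm of the generating function `∏ (1 - e ^ (-σ lam_k))⁻¹`. -/
def logGen (lam : ℕ → ℝ) (σ : ℝ) : ℝ := ∑' k, -Real.log (1 - Real.exp (-(σ * lam k)))

theorem integral_indicator_Ici_inv {l u : ℝ} (hl : 0 < l) (hu : 0 ≤ u) :
    IntervalIntegrable (fun t => (Ici l).indicator (fun t => t⁻¹) t) volume 0 u ∧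
    ∫ t in (0 : ℝ)..u, (Ici l).indicator (fun t => t⁻¹) t = Real.posLog (u / l) := by
  have hset : Ici l ∩ Ioc 0 u = Icc l u := by
    ext t
    simp only [mem_inter_iff, mem_Ici, mem_Ioc, mem_Icc]
    constructor
    · rintro ⟨h1, _, h2⟩; exact ⟨h1, h2⟩
    · rintro ⟨h1, h2⟩; exact ⟨h1, hl.trans_le h1, h2⟩
  have hc : ContinuousOn (fun t : ℝ => t⁻¹) (Icc l u) :=
    continuousOn_inv₀.mono fun t ht => (hl.trans_le ht.1).ne'
  constructor
  · rw [intervalIntegrable_iff_integrableOn_Ioc_of_le hu, IntegrableOn,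
      integrable_indicator_iff measurableSet_Ici, IntegrableOn,
      Measure.restrict_restrict measurableSet_Ici, hset]
    exact hc.integrableOn_Icc
  · rw [intervalIntegral.integral_of_le hu, setIntegral_indicator measurableSet_Ici,
      inter_comm, hset]
    rcases le_or_gt l u with h | h
    · have h1 : 1 ≤ |u / l| := by
        rw [abs_of_nonneg (by positivity)]; exact (one_le_div hl).2 h
      rw [integral_Icc_eq_integral_Ioc, ← intervalIntegral.integral_of_le h,
        integral_inv_of_pos hl (hl.trans_le h), Real.posLog_eq_log h1]
    · have h1 : |u / l| ≤ 1 := by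
        rw [abs_of_nonneg (by positivity)]; exact (div_le_one hl).2 h.le
      rw [Icc_eq_empty (not_le.2 h), (Real.posLog_eq_zero_iff _).2 h1]
      simp

theorem lam_pos {lam : ℕ → ℝ} (hpos : 0 < lam 0) (hmono : StrictMono lam)
    (k : ℕ) : 0 < lam k := hpos.trans_le (hmono.monotone k.zero_le)

theorem countingFn_eq_zero {lam : ℕ → ℝ} (hmono : StrictMono lam) {t : ℝ}
    (ht : t < lam 0) : countingFn lam t = 0 := by
  have : {k : ℕ | lam k ≤ t} = ∅ := by
    ext k
    simp only [mem_ofPred_eq, mem_empty_iff_false, iff_false, not_le]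
    exact ht.trans_le (hmono.monotone k.zero_le)
  rw [countingFn, this, ncard_empty]

theorem logCount_of_nonpos {lam : ℕ → ℝ} (hpos : 0 < lam 0) (hmono : StrictMono lam) {u : ℝ}
    (hu : u ≤ 0) : logCount lam u = 0 := by
  rw [logCount, intervalIntegral.integral_congr (g := fun _ => 0), intervalIntegral.integral_zero]
  intro t ht
  rw [uIcc_of_ge hu] at ht
  simp [countingFn_eq_zero hmono (ht.2.trans_lt hpos)]

/-- The index set depends on `U` and not on `t`, so the same finite sum can be integrated over `t`
and used to compare `logCount` at different arguments. -/
theorem countingFn_div_eq_sum {lam : ℕ → ℝ} (htop : Tendsto lam atTop atTop) {t U : ℝ}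
    (ht : t ≤ U) :
    (countingFn lam t : ℝ) / t =
      ∑ k ∈ (finite_setOf_le htop U).toFinset, (Ici (lam k)).indicator (fun t => t⁻¹) t := by
  classical
  have hfin := finite_setOf_le htop U
  have hset : {k : ℕ | lam k ≤ t} = ↑(hfin.toFinset.filter fun k => lam k ≤ t) := by
    ext k
    simp only [mem_ofPred_eq, Finset.coe_filter, Finite.mem_toFinset]
    exact ⟨fun h => ⟨h.trans ht, h⟩, fun h => h.2⟩
  rw [countingFn, hset, ncard_coe_finset, div_eq_mul_inv, ← nsmul_eq_mul, ← Finset.sum_const,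
    Finset.sum_filter]
  refine Finset.sum_congr rfl fun k _ => ?_
  simp only [indicator_apply, mem_Ici]

theorem logCount_eq_sum {lam : ℕ → ℝ} (hpos : 0 < lam 0) (hmono : StrictMono lam)
    (htop : Tendsto lam atTop atTop) {u U : ℝ} (hu : 0 ≤ u) (huU : u ≤ U) :
    logCount lam u = ∑ k ∈ (finite_setOf_le htop U).toFinset, Real.posLog (u / lam k) := by
  rw [logCount, intervalIntegral.integral_congr (g := fun t =>
    ∑ k ∈ (finite_setOf_le htop U).toFinset, (Ici (lam k)).indicator (fun t => t⁻¹) t)]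
  · rw [intervalIntegral.integral_finsetSum]
    · exact Finset.sum_congr rfl fun k _ =>
        (integral_indicator_Ici_inv (lam_pos hpos hmono k) hu).2
    · exact fun k _ => (integral_indicator_Ici_inv (lam_pos hpos hmono k) hu).1
  · intro t ht
    rw [uIcc_of_le hu] at ht
    exact countingFn_div_eq_sum htop (ht.2.trans huU)

theorem hasSum_posLog {lam : ℕ → ℝ} (hpos : 0 < lam 0) (hmono : StrictMono lam)
    (htop : Tendsto lam atTop atTop) {u : ℝ} (hu : 0 ≤ u) :
    HasSum (fun k => Real.posLog (u / lam k)) (logCount lam u) := by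
  rw [logCount_eq_sum hpos hmono htop hu le_rfl]
  refine hasSum_sum_of_ne_finset_zero fun k hk => ?_
  have hk' : u < lam k := by simpa using hk
  have hl := lam_pos hpos hmono k
  rw [Real.posLog_eq_zero_iff, abs_of_nonneg (by positivity)]
  exact (div_le_one hl).2 hk'.le

theorem logCount_nonneg {lam : ℕ → ℝ} (hpos : 0 < lam 0) (hmono : StrictMono lam)
    (htop : Tendsto lam atTop atTop) (u : ℝ) : 0 ≤ logCount lam u := by
  rcases le_total u 0 with h | h
  · rw [logCount_of_nonpos hpos hmono h]
  · rw [logCount_eq_sum hpos hmono htop h le_rfl]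
    exact Finset.sum_nonneg fun k _ => Real.posLog_nonneg

theorem monotone_logCount {lam : ℕ → ℝ} (hpos : 0 < lam 0) (hmono : StrictMono lam)
    (htop : Tendsto lam atTop atTop) : Monotone (logCount lam) := by
  intro u v huv
  rcases le_total u 0 with h | h
  · rw [logCount_of_nonpos hpos hmono h]
    exact logCount_nonneg hpos hmono htop v
  · rw [logCount_eq_sum hpos hmono htop h huv, logCount_eq_sum hpos hmono htop (h.trans huv) le_rfl]
    refine Finset.sum_le_sum fun k _ => Real.posLog_le_posLog ?_ ?_
    · exact div_nonneg h (lam_pos hpos hmono k).le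
    · exact div_le_div_of_nonneg_right huv (lam_pos hpos hmono k).le

/-- Sum `integral_posLog_mul_kernelFn` at `y = σ lam k` over `k`. All terms are non-negative, and
the assumed integrability of the total bounds the partial sums, so sum and integral can be
exchanged. -/
theorem hasSum_log_one_sub_exp {lam : ℕ → ℝ} (hpos : 0 < lam 0) (hmono : StrictMono lam)
    (htop : Tendsto lam atTop atTop) {σ : ℝ} (hσ : 0 < σ)
    (hintegr : IntegrableOn (fun z => logCount lam (z / σ) * kernelFn z) (Ioi 0)) :
    HasSum (fun k => -Real.log (1 - Real.exp (-(σ * lam k))))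
      (∫ z in Ioi 0, logCount lam (z / σ) * kernelFn z) := by
  have hl : ∀ k, 0 < σ * lam k := fun k => mul_pos hσ (lam_pos hpos hmono k)
  set f : ℕ → ℝ → ℝ := fun k z => Real.posLog (z / (σ * lam k)) * kernelFn z with hf
  have hfi : ∀ k, IntegrableOn (f k) (Ioi 0) := fun k => (integral_posLog_mul_kernelFn (hl k)).1
  have hfv : ∀ k, ∫ z in Ioi 0, f k z = -Real.log (1 - Real.exp (-(σ * lam k))) :=
    fun k => (integral_posLog_mul_kernelFn (hl k)).2
  have hfn : ∀ k z, 0 ≤ f k z := fun k z => mul_nonneg Real.posLog_nonneg (kernelFn_nonneg z)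
  have hpt : ∀ z ∈ Ioi (0 : ℝ), HasSum (fun k => f k z) (logCount lam (z / σ) * kernelFn z) := by
    intro z hz
    have h := (hasSum_posLog hpos hmono htop (div_pos hz hσ).le).mul_right (kernelFn z)
    simpa only [hf, div_div] using h
  have hnorm : ∀ k, ∫ z in Ioi 0, ‖f k z‖ = ∫ z in Ioi 0, f k z := fun k =>
    integral_congr_ae (ae_of_all _ fun z => Real.norm_of_nonneg (hfn k z))
  have hS : Summable fun k => ∫ z in Ioi 0, ‖f k z‖ := by
    refine summable_of_sum_le (c := ∫ z in Ioi 0, logCount lam (z / σ) * kernelFn z)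
      (fun k => integral_nonneg fun z => norm_nonneg _) fun s => ?_
    simp_rw [hnorm]
    rw [← integral_finsetSum s fun k _ => hfi k]
    refine setIntegral_mono_on (integrable_finsetSum s fun k _ => hfi k) hintegr measurableSet_Ioi
      fun z hz => ?_
    exact sum_le_hasSum s (fun k _ => hfn k z) (hpt z hz)
  have h := hasSum_integral_of_summable_integral_norm hfi hS
  simp_rw [hfv] at h
  rwa [setIntegral_congr_fun measurableSet_Ioi fun z hz => (hpt z hz).tsum_eq] at h

/-- The expansion assumed for `∫_0^u N(t) / t dt`. -/
def logCountMain (A α B C D u : ℝ) : ℝ :=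
  A / α * u ^ α + B * Real.log u ^ 2 + C * Real.log u + D

/-- Far out the error is below 1 by hypothesis. On `[1, U]` monotonicity of `logCount` bounds it.
Near 0 `logCount` is bounded, and the main term is no worse than `log²`. -/
theorem exists_error_bound {lam : ℕ → ℝ} (hpos : 0 < lam 0) (hmono : StrictMono lam)
    (htop : Tendsto lam atTop atTop) {A α B C D : ℝ} (hα : 0 < α)
    (hN : Tendsto (fun u => logCount lam u - logCountMain A α B C D u) atTop (𝓝 0)) :
    ∃ K : ℝ, 0 ≤ K ∧
    (∀ u, 1 ≤ u → |logCount lam u - logCountMain A α B C D u| ≤ K) ∧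
    ∀ u, 0 < u → u < 1 → |logCount lam u - logCountMain A α B C D u| ≤ K * (1 + Real.log u ^ 2) := by
  have hev : ∀ᶠ u in atTop, |logCount lam u - logCountMain A α B C D u| < 1 := by
    have := hN.eventually (Metric.ball_mem_nhds 0 one_pos)
    filter_upwards [this] with u hu
    simpa using hu
  obtain ⟨U, hU1, hU⟩ : ∃ U, 1 ≤ U ∧ ∀ u, U ≤ u → |logCount lam u - logCountMain A α B C D u| < 1 := by
    obtain ⟨U, hU⟩ := eventually_atTop.1 hev
    exact ⟨max U 1, le_max_right _ _, fun u hu => hU u ((le_max_left _ _).trans hu)⟩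
  have hm := monotone_logCount hpos hmono htop
  have hn := logCount_nonneg hpos hmono htop
  have habs : ∀ u, |logCount lam u - logCountMain A α B C D u| ≤ logCount lam u +
      (|A / α| * |u ^ α| + |B| * Real.log u ^ 2 + |C| * |Real.log u| + |D|) := by
    intro u
    refine (abs_sub _ _).trans ?_
    rw [abs_of_nonneg (hn u)]
    refine add_le_add le_rfl ?_
    unfold logCountMain
    refine (abs_add_le _ _).trans (add_le_add ?_ le_rfl)
    refine (abs_add_le _ _).trans (add_le_add ?_ (abs_mul _ _).le)
    refine (abs_add_le _ _).trans (add_le_add (abs_mul _ _).le ?_)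
    rw [abs_mul, abs_of_nonneg (sq_nonneg (Real.log u))]
  set K₁ := logCount lam U + (|A / α| * U ^ α + |B| * Real.log U ^ 2 + |C| * Real.log U + |D|)
  set K₂ := logCount lam 1 + (|A / α| + |B| + |C| + |D|)
  have hlU : 0 ≤ Real.log U := Real.log_nonneg hU1
  have hK₁ : 0 ≤ K₁ := by have := hn U; positivity
  have hK₂ : 0 ≤ K₂ := by have := hn 1; positivity
  refine ⟨K₁ + K₂ + 1, by positivity, fun u hu => ?_, fun u hu hu1 => ?_⟩
  · rcases le_total U u with h | h
    · linarith [hU u h]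
    · refine (habs u).trans ?_
      have h0 : 0 < u := by linarith
      have hl0 := Real.log_nonneg hu
      have hl : Real.log u ≤ Real.log U := Real.log_le_log h0 h
      have h1 : u ^ α ≤ U ^ α := Real.rpow_le_rpow h0.le h hα.le
      have h2 : logCount lam u ≤ logCount lam U := hm h
      rw [abs_of_nonneg (Real.rpow_nonneg h0.le α), abs_of_nonneg hl0]
      have : logCount lam u + (|A / α| * u ^ α + |B| * Real.log u ^ 2 + |C| * Real.log u + |D|)
        ≤ logCount lam U +
          (|A / α| * U ^ α + |B| * Real.log U ^ 2 + |C| * Real.log U + |D|) := by gcongr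
      linarith
  · refine (habs u).trans ?_
    have h1 : |u ^ α| ≤ 1 := by
      rw [abs_of_nonneg (Real.rpow_nonneg hu.le α)]
      exact Real.rpow_le_one hu.le hu1.le hα.le
    have h2 : logCount lam u ≤ logCount lam 1 := hm hu1.le
    set x := Real.log u
    have h3 : |x| ≤ 1 + x ^ 2 := by
      rw [← sq_abs]; nlinarith [sq_nonneg (|x| - 1), abs_nonneg x]
    have h4 : logCount lam u + (|A / α| * |u ^ α| + |B| * x ^ 2 + |C| * |x| + |D|) ≤
        logCount lam 1 + (|A / α| * 1 + |B| * x ^ 2 + |C| * (1 + x ^ 2) + |D|) := by gcongr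
    refine h4.trans ?_
    have hx2 := sq_nonneg x
    have h5 : 0 ≤ K₁ * (1 + x ^ 2) := by positivity
    have h6 : K₂ * (1 + x ^ 2) = logCount lam 1 * (1 + x ^ 2) + (|A / α| * (1 + x ^ 2) +
      |B| * (1 + x ^ 2) + |C| * (1 + x ^ 2) + |D| * (1 + x ^ 2)) := by ring
    have h7 : 0 ≤ logCount lam 1 * x ^ 2 := mul_nonneg (hn 1) hx2
    have h8 : 0 ≤ |A / α| * x ^ 2 := by positivity
    have h9 : 0 ≤ |D| * x ^ 2 := by positivity
    have h10 : 0 ≤ |B| := abs_nonneg B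
    nlinarith

/-- Uniformity in `σ` is the point: it gives the dominating function for `σ → 0`. For `z < σ < 1`
one has `|log (z / σ)| ≤ |log z|`. -/
theorem exists_scaled_error_bound {lam : ℕ → ℝ} (hpos : 0 < lam 0) (hmono : StrictMono lam)
    (htop : Tendsto lam atTop atTop) {A α B C D : ℝ} (hα : 0 < α)
    (hN : Tendsto (fun u => logCount lam u - logCountMain A α B C D u) atTop (𝓝 0)) :
    ∃ K : ℝ, ∀ σ z : ℝ, 0 < σ → σ < 1 → 0 < z →
    |logCount lam (z / σ) - logCountMain A α B C D (z / σ)| ≤ K * (1 + Real.log z ^ 2) := by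
  obtain ⟨K, hK, h1, h2⟩ := exists_error_bound hpos hmono htop hα hN
  refine ⟨K, fun σ z hσ hσ1 hz => ?_⟩
  rcases le_or_gt σ z with h | h
  · refine (h1 _ ((one_le_div hσ).2 h)).trans ?_
    nlinarith [mul_nonneg hK (sq_nonneg (Real.log z))]
  · refine (h2 _ (by positivity) ((div_lt_one hσ).2 h)).trans ?_
    rw [Real.log_div hz.ne' hσ.ne']
    have h3 := Real.log_neg hσ hσ1
    have h4 := Real.log_lt_log hz h
    refine mul_le_mul_of_nonneg_left ?_ hK
    nlinarith

/-- After `log (z / σ) = log z - log σ`, everything linear in `log z` disappears because the first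
logarithmic moment is 0. The second moment, multiplied by `B`, adds to `D`. -/
theorem integral_logCountMain_mul_kernelFn {A α B C D : ℝ} (hα : 0 < α) {σ : ℝ} (hσ : 0 < σ) :
    IntegrableOn (fun z => logCountMain A α B C D (z / σ) * kernelFn z) (Ioi 0) ∧
    ∫ z in Ioi 0, logCountMain A α B C D (z / σ) * kernelFn z =
      A * Real.Gamma (α + 1) * (riemannZeta ((α : ℂ) + 1)).re * σ ^ (-α) +
        B * Real.log σ ^ 2 - C * Real.log σ + (D + (Real.pi ^ 2 / 6 - 2 * stieltjesGammaOne -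
          Real.eulerMascheroniConstant ^ 2) * B) := by
  obtain ⟨hI1, hI2⟩ := integral_log_mul_kernelFn_and_sq
  have i0 := integrableOn_rpow_mul_kernelFn hα.le
  have i1 : IntegrableOn (fun z => Real.log z * kernelFn z) (Ioi 0) := by
    have := integrableOn_log_pow_mul_kernelFn 1
    simp only [pow_one] at this
    exact this
  have i2 := integrableOn_log_pow_mul_kernelFn 2
  have iw := integrableOn_kernelFn
  have j0 : IntegrableOn (fun z => A / α * σ ^ (-α) * (z ^ α * kernelFn z)) (Ioi 0) :=
    i0.const_mul _
  have j1 : IntegrableOn (fun z => (C - 2 * B * Real.log σ) * (Real.log z * kernelFn z)) (Ioi 0) :=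
    i1.const_mul _
  have j2 : IntegrableOn (fun z => B * (Real.log z ^ 2 * kernelFn z)) (Ioi 0) := i2.const_mul _
  have j3 : IntegrableOn (fun z => (B * Real.log σ ^ 2 - C * Real.log σ + D) * kernelFn z) (Ioi 0) :=
    iw.const_mul _
  have j01 : IntegrableOn (fun z => A / α * σ ^ (-α) * (z ^ α * kernelFn z) +
      (C - 2 * B * Real.log σ) * (Real.log z * kernelFn z)) (Ioi 0) := j0.add j1
  have j012 : IntegrableOn (fun z => A / α * σ ^ (-α) * (z ^ α * kernelFn z) +
      (C - 2 * B * Real.log σ) * (Real.log z * kernelFn z) +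
      B * (Real.log z ^ 2 * kernelFn z)) (Ioi 0) := j01.add j2
  have j : IntegrableOn (fun z => A / α * σ ^ (-α) * (z ^ α * kernelFn z) +
      (C - 2 * B * Real.log σ) * (Real.log z * kernelFn z) +
      B * (Real.log z ^ 2 * kernelFn z) +
      (B * Real.log σ ^ 2 - C * Real.log σ + D) * kernelFn z) (Ioi 0) := j012.add j3
  have heq : EqOn (fun z => logCountMain A α B C D (z / σ) * kernelFn z)
      (fun z => A / α * σ ^ (-α) * (z ^ α * kernelFn z) +
      (C - 2 * B * Real.log σ) * (Real.log z * kernelFn z) +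
      B * (Real.log z ^ 2 * kernelFn z) +
      (B * Real.log σ ^ 2 - C * Real.log σ + D) * kernelFn z) (Ioi 0) := by
    intro z hz
    have hz : 0 < z := hz
    simp only [logCountMain]
    rw [Real.div_rpow hz.le hσ.le, Real.log_div hz.ne' hσ.ne', Real.rpow_neg hσ.le]
    ring
  refine ⟨(integrableOn_congr_fun heq measurableSet_Ioi).2 j, ?_⟩
  rw [setIntegral_congr_fun measurableSet_Ioi heq, integral_add j012 j3, integral_add j01 j2,
    integral_add j0 j1, integral_const_mul, integral_const_mul, integral_const_mul,
    integral_const_mul, hI1, hI2, integral_kernelFn, integral_rpow_mul_kernelFn hα,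
    zeta_re_eq_tsum hα]
  field_simp
  ring

theorem hasSum_logGen {lam : ℕ → ℝ} (hpos : 0 < lam 0) (hmono : StrictMono lam)
    (htop : Tendsto lam atTop atTop) {A α B C D : ℝ} (hα : 0 < α)
    (hN : Tendsto (fun u => logCount lam u - logCountMain A α B C D u) atTop (𝓝 0))
    {σ : ℝ} (hσ : 0 < σ) (hσ1 : σ < 1) :
    HasSum (fun k => -Real.log (1 - Real.exp (-(σ * lam k)))) (logGen lam σ) ∧
    IntegrableOn (fun z => logCount lam (z / σ) * kernelFn z) (Ioi 0) ∧
    logGen lam σ = ∫ z in Ioi 0, logCount lam (z / σ) * kernelFn z := by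
  obtain ⟨K, hK⟩ := exists_scaled_error_bound hpos hmono htop hα hN
  have hmeas : Measurable fun z => logCount lam (z / σ) :=
    (monotone_logCount hpos hmono htop).measurable.comp (measurable_id.div_const σ)
  have hmain := (integral_logCountMain_mul_kernelFn (A := A) (B := B) (C := C) (D := D) hα hσ).1
  have herr : IntegrableOn
      (fun z => (logCount lam (z / σ) - logCountMain A α B C D (z / σ)) * kernelFn z) (Ioi 0) := by
    have hb : IntegrableOn (fun z => K * (kernelFn z + Real.log z ^ 2 * kernelFn z)) (Ioi 0) :=
      (integrableOn_kernelFn.add (integrableOn_log_pow_mul_kernelFn 2)).const_mul K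
    refine Integrable.mono' hb ?_ ?_
    · have : Measurable fun z => logCountMain A α B C D (z / σ) := by
        unfold logCountMain; fun_prop
      exact ((hmeas.sub this).mul measurable_kernelFn).aestronglyMeasurable
    · filter_upwards [ae_restrict_mem measurableSet_Ioi] with z hz
      rw [norm_mul, Real.norm_eq_abs, Real.norm_of_nonneg (kernelFn_nonneg z)]
      calc _ ≤ K * (1 + Real.log z ^ 2) * kernelFn z :=
            mul_le_mul_of_nonneg_right (hK σ z hσ hσ1 hz) (kernelFn_nonneg z)
        _ = _ := by ring
  have hintegr : IntegrableOn (fun z => logCount lam (z / σ) * kernelFn z) (Ioi 0) := by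
    refine (hmain.add herr).congr (ae_of_all _ fun z => ?_)
    simp only [Pi.add_apply]
    ring
  have h := hasSum_log_one_sub_exp hpos hmono htop hσ hintegr
  have hv : logGen lam σ = ∫ z in Ioi 0, logCount lam (z / σ) * kernelFn z := h.tsum_eq
  exact ⟨hv ▸ h, hintegr, hv⟩

/-- The expansion of the logarithm of the generating function at `0`. -/
theorem tendsto_logGen {lam : ℕ → ℝ} (hpos : 0 < lam 0) (hmono : StrictMono lam)
    (htop : Tendsto lam atTop atTop) {A α B C D : ℝ} (hα : 0 < α)
    (hN : Tendsto (fun u => logCount lam u - logCountMain A α B C D u) atTop (𝓝 0)) :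
    Tendsto (fun σ => logGen lam σ -
    (A * Real.Gamma (α + 1) * (riemannZeta ((α : ℂ) + 1)).re * σ ^ (-α) +
        B * Real.log σ ^ 2 - C * Real.log σ + (D + (Real.pi ^ 2 / 6 - 2 * stieltjesGammaOne -
          Real.eulerMascheroniConstant ^ 2) * B))) (𝓝[>] 0) (𝓝 0) := by
  obtain ⟨K, hK⟩ := exists_scaled_error_bound hpos hmono htop hα hN
  have hsm : ∀ᶠ σ : ℝ in 𝓝[>] 0, 0 < σ ∧ σ < 1 := Ioo_mem_nhdsGT one_pos
  have hmeas : ∀ σ : ℝ, Measurable fun z => logCount lam (z / σ) := fun σ =>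
    (monotone_logCount hpos hmono htop).measurable.comp (measurable_id.div_const σ)
  -- For fixed `z > 0` the point `z / σ` tends to infinity, where the error vanishes; dominated
  -- convergence transfers this to the average.
  have key : Tendsto (fun σ => ∫ z in Ioi 0,
      (logCount lam (z / σ) - logCountMain A α B C D (z / σ)) * kernelFn z) (𝓝[>] 0)
      (𝓝 (∫ z in Ioi (0 : ℝ), 0)) := by
    refine tendsto_integral_filter_of_dominated_convergence
      (fun z => K * (kernelFn z + Real.log z ^ 2 * kernelFn z)) ?_ ?_ ?_ ?_
    · refine Eventually.of_forall fun σ => ?_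
      have : Measurable fun z => logCountMain A α B C D (z / σ) := by
        unfold logCountMain; fun_prop
      exact (((hmeas σ).sub this).mul measurable_kernelFn).aestronglyMeasurable
    · filter_upwards [hsm] with σ ⟨hσ, hσ1⟩
      filter_upwards [ae_restrict_mem measurableSet_Ioi] with z hz
      rw [norm_mul, Real.norm_eq_abs, Real.norm_of_nonneg (kernelFn_nonneg z)]
      calc _ ≤ K * (1 + Real.log z ^ 2) * kernelFn z :=
            mul_le_mul_of_nonneg_right (hK σ z hσ hσ1 hz) (kernelFn_nonneg z)
        _ = _ := by ring
    · exact (integrableOn_kernelFn.add (integrableOn_log_pow_mul_kernelFn 2)).const_mul K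
    · filter_upwards [ae_restrict_mem measurableSet_Ioi] with z hz
      have h1 : Tendsto (fun σ : ℝ => z / σ) (𝓝[>] 0) atTop := by
        simp only [div_eq_mul_inv]
        exact Tendsto.const_mul_atTop hz tendsto_inv_nhdsGT_zero
      have := (hN.comp h1).mul_const (kernelFn z)
      simpa using this
  rw [integral_zero] at key
  refine key.congr' ?_
  filter_upwards [hsm] with σ ⟨hσ, hσ1⟩
  obtain ⟨-, hi, hv⟩ := hasSum_logGen hpos hmono htop hα hN hσ hσ1
  obtain ⟨hmi, hmv⟩ := integral_logCountMain_mul_kernelFn (A := A) (B := B) (C := C) (D := D) hα hσ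
  rw [hv, ← hmv, ← integral_sub hi hmi]
  simp only [sub_mul]

/-! ### The generating product as a sum over multiplicity vectors. -/

/-- Finitely supported functions on `{0, …, K}` split off their value at `K`. -/
def supportedSuccEquiv (K : ℕ) :
    {n : ℕ →₀ ℕ // n.support ⊆ Finset.range K} × ℕ ≃
      {n : ℕ →₀ ℕ // n.support ⊆ Finset.range (K + 1)} where
  toFun p := ⟨p.1.1 + Finsupp.single K p.2, by
    refine Finsupp.support_add.trans (Finset.union_subset ?_ ?_)
    · exact p.1.2.trans (Finset.range_mono (Nat.le_succ K))
    · exact Finsupp.support_single_subset.trans (by simp)⟩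
  invFun n := (⟨n.1.erase K, by
    intro k hk
    rw [Finsupp.support_erase, Finset.mem_erase] at hk
    have := Finset.mem_range.1 (n.2 hk.2)
    exact Finset.mem_range.2 (by omega)⟩, n.1 K)
  left_inv p := by
    have hK : p.1.1 K = 0 := by
      by_contra h
      have := Finset.mem_range.1 (p.1.2 (Finsupp.mem_support_iff.2 h))
      omega
    refine Prod.ext (Subtype.ext ?_) ?_
    · ext k
      by_cases h : k = K
      · subst h; simp [hK]
      · simp [Finsupp.erase_ne h]
    · simp [hK]
  right_inv n := by
    refine Subtype.ext ?_
    exact Finsupp.erase_add_single K n.1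

section Product
variable {R : Type*} [NormedField R] [CompleteSpace R]

/-- A finite Euler product, by induction: the new coordinate contributes a geometric series,
multiplied in absolutely. The field is general because both the complex terms and their real norms
are needed. -/
theorem hasSum_supported_prod {z : ℕ → R} (hz : ∀ k, ‖z k‖ < 1) (K : ℕ) :
    Summable (fun n : {n : ℕ →₀ ℕ // n.support ⊆ Finset.range K} =>
      ‖n.1.prod fun k m => z k ^ m‖) ∧
    HasSum (fun n : {n : ℕ →₀ ℕ // n.support ⊆ Finset.range K} =>
      n.1.prod fun k m => z k ^ m) (∏ k ∈ Finset.range K, (1 - z k)⁻¹) := by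
  induction K with
  | zero =>
    have hu : ∀ n : {n : ℕ →₀ ℕ // n.support ⊆ Finset.range 0}, n = ⟨0, by simp⟩ := fun n =>
      Subtype.ext (Finsupp.support_eq_empty.1 (Finset.subset_empty.1 (by simpa using n.2)))
    have : Subsingleton {n : ℕ →₀ ℕ // n.support ⊆ Finset.range 0} :=
      ⟨fun a b => (hu a).trans (hu b).symm⟩
    refine ⟨Summable.of_finite, ?_⟩
    have h := hasSum_single (f := fun n : {n : ℕ →₀ ℕ // n.support ⊆ Finset.range 0} =>
      n.1.prod fun k m => z k ^ m) ⟨0, by simp⟩ fun n hn => absurd (hu n) hn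
    simpa using h
  | succ K ih =>
    obtain ⟨h1, h2⟩ := ih
    have hg := summable_norm_geometric_of_norm_lt_one (hz K)
    have hgs := hasSum_geometric_of_norm_lt_one (hz K)
    have hval : ∀ p : {n : ℕ →₀ ℕ // n.support ⊆ Finset.range K} × ℕ,
        ((supportedSuccEquiv K p).1.prod fun k m => z k ^ m) =
          (p.1.1.prod fun k m => z k ^ m) * z K ^ p.2 := by
      intro p
      simp only [supportedSuccEquiv, Equiv.coe_fn_mk]
      rw [Finsupp.prod_add_index' (by simp) (by intros; rw [pow_add]),
        Finsupp.prod_single_index (by simp)]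
    constructor
    · rw [← (supportedSuccEquiv K).summable_iff]
      have := h1.mul_norm hg
      simp only [Function.comp_def, hval]
      exact this
    · rw [← (supportedSuccEquiv K).hasSum_iff, Finset.prod_range_succ]
      simp only [Function.comp_def, hval]
      have hs := summable_mul_of_summable_norm h1 hg
      exact h2.mul hgs hs
end Product

theorem neg_log_one_sub_nonneg {r : ℝ} (h0 : 0 ≤ r) (h1 : r < 1) : 0 ≤ -Real.log (1 - r) :=
  neg_nonneg.2 (Real.log_nonpos (by linarith) (by linarith))

theorem exists_support_subset_range (n : ℕ →₀ ℕ) : ∃ K, n.support ⊆ Finset.range K :=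
  ⟨n.support.sup id + 1, fun _ hk => Finset.mem_range.2 (Nat.lt_succ_of_le (Finset.le_sup (f := id) hk))⟩

/-- Finitely many multiplicity vectors are all supported in some `{0, …, K-1}`, so their sum is at
most a partial Euler product of norms, and these products are bounded through their logarithms. -/
theorem summable_norm_finsupp_prod {z : ℕ → ℂ} (hz : ∀ k, ‖z k‖ < 1)
    (hs : Summable fun k => -Real.log (1 - ‖z k‖)) :
    Summable fun n : ℕ →₀ ℕ => ‖n.prod fun k m => z k ^ m‖ := by
  classical
  have hnorm : ∀ n : ℕ →₀ ℕ, ‖n.prod fun k m => z k ^ m‖ = n.prod fun k m => ‖z k‖ ^ m := by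
    intro n
    simp only [Finsupp.prod, norm_prod, norm_pow]
  refine summable_of_sum_le (c := Real.exp (∑' k, -Real.log (1 - ‖z k‖))) (fun _ => norm_nonneg _)
    fun t => ?_
  obtain ⟨K, hK⟩ : ∃ K, ∀ n ∈ t, n.support ⊆ Finset.range K := by
    choose κ hκ using exists_support_subset_range
    exact ⟨t.sup κ, fun n hn => (hκ n).trans (Finset.range_mono (Finset.le_sup hn))⟩
  have hz' : ∀ k, ‖‖z k‖‖ < 1 := fun k => by simpa using hz k
  have h := (hasSum_supported_prod hz' K).2
  have h1 := sum_le_hasSum (t.subtype fun n => n.support ⊆ Finset.range K)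
    (fun n _ => by unfold Finsupp.prod; positivity) h
  have h2 : ∑ n ∈ t.subtype (fun n : ℕ →₀ ℕ => n.support ⊆ Finset.range K),
      (n.1.prod fun k m => ‖z k‖ ^ m) = ∑ n ∈ t, ‖n.prod fun k m => z k ^ m‖ := by
    rw [Finset.sum_subtype_of_mem (fun n : ℕ →₀ ℕ => n.prod fun k m => ‖z k‖ ^ m) hK]
    exact Finset.sum_congr rfl fun n _ => (hnorm n).symm
  rw [← h2]
  refine h1.trans ?_
  have h3 : ∏ k ∈ Finset.range K, (1 - ‖z k‖)⁻¹ =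
      Real.exp (∑ k ∈ Finset.range K, -Real.log (1 - ‖z k‖)) := by
    rw [Real.exp_sum]
    refine Finset.prod_congr rfl fun k _ => ?_
    rw [Real.exp_neg, Real.exp_log (by linarith [hz k])]
  rw [h3, Real.exp_le_exp]
  exact hs.sum_le_tsum _ fun k _ => neg_log_one_sub_nonneg (norm_nonneg _) (hz k)

theorem summable_norm_log_series {z : ℕ → ℂ} (hz : ∀ k, ‖z k‖ < 1)
    (hs : Summable fun k => -Real.log (1 - ‖z k‖)) :
    Summable fun p : ℕ × ℕ => ‖z p.1‖ ^ (p.2 + 1) / ((p.2 : ℝ) + 1) := by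
  have hrow : ∀ k, HasSum (fun j : ℕ => ‖z k‖ ^ (j + 1) / ((j : ℝ) + 1)) (-Real.log (1 - ‖z k‖)) :=
    fun k => Real.hasSum_pow_div_log_of_abs_lt_one (by simpa using hz k)
  refine (summable_prod_of_nonneg fun p => by positivity).2 ⟨fun k => (hrow k).summable, ?_⟩
  simpa only [(hrow _).tsum_eq] using hs

/-- The partial products have two limits to be identified: the exponential of the sum of logarithms,
and the full sum over multiplicities by dominated convergence. The exponent is kept as a double
series so that its real and imaginary shifts can be taken termwise. -/
theorem hasSum_finsupp_prod {z : ℕ → ℂ} (hz : ∀ k, ‖z k‖ < 1)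
    (hs : Summable fun k => -Real.log (1 - ‖z k‖)) :
    HasSum (fun n : ℕ →₀ ℕ => n.prod fun k m => z k ^ m)
      (Complex.exp (∑' p : ℕ × ℕ, z p.1 ^ (p.2 + 1) / ((p.2 : ℂ) + 1))) := by
  have hsum := summable_norm_finsupp_prod hz hs
  have hdouble : Summable fun p : ℕ × ℕ => z p.1 ^ (p.2 + 1) / ((p.2 : ℂ) + 1) := by
    refine Summable.of_norm ?_
    refine (summable_norm_log_series hz hs).congr fun p => ?_
    rw [norm_div, norm_pow]
    congr 1
    rw [show ((p.2 : ℂ) + 1) = ((p.2 + 1 : ℕ) : ℂ) by push_cast; rfl, Complex.norm_natCast]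
    push_cast; rfl
  have hrow : ∀ k, HasSum (fun j : ℕ => z k ^ (j + 1) / ((j : ℂ) + 1)) (-Complex.log (1 - z k)) :=
    fun k => Complex.hasSum_taylorSeries_neg_log' (hz k)
  have hlog := hdouble.hasSum.prod_fiberwise hrow
  have h1 : Tendsto (fun K => ∏ k ∈ Finset.range K, (1 - z k)⁻¹) atTop
      (𝓝 (Complex.exp (∑' p : ℕ × ℕ, z p.1 ^ (p.2 + 1) / ((p.2 : ℂ) + 1)))) := by
    refine ((Complex.continuous_exp.tendsto _).comp hlog.tendsto_sum_nat).congr fun K => ?_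
    simp only [Function.comp, Complex.exp_sum]
    refine Finset.prod_congr rfl fun k _ => ?_
    have : 1 - z k ≠ 0 := by
      intro h
      have h2 := hz k
      rw [← sub_eq_zero.1 h] at h2
      simp at h2
    rw [Complex.exp_neg, Complex.exp_log this]
  have h2 : Tendsto (fun K => ∏ k ∈ Finset.range K, (1 - z k)⁻¹) atTop
      (𝓝 (∑' n : ℕ →₀ ℕ, n.prod fun k m => z k ^ m)) := by
    have h3 : Tendsto (fun K => ∑' n : ℕ →₀ ℕ, {n : ℕ →₀ ℕ | n.support ⊆ Finset.range K}.indicator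
        (fun n => n.prod fun k m => z k ^ m) n) atTop
        (𝓝 (∑' n : ℕ →₀ ℕ, n.prod fun k m => z k ^ m)) := by
      refine tendsto_tsum_of_dominated_convergence hsum (fun n => ?_) ?_
      · obtain ⟨K₀, hK₀⟩ := exists_support_subset_range n
        refine tendsto_const_nhds.congr' ?_
        filter_upwards [eventually_ge_atTop K₀] with K hK
        rw [indicator_of_mem]
        exact hK₀.trans (Finset.range_mono hK)
      · exact Eventually.of_forall fun K n => norm_indicator_le_norm_self _ _
    refine h3.congr fun K => ?_
    rw [← tsum_subtype]
    exact (hasSum_supported_prod hz K).2.tsum_eq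
  rw [tendsto_nhds_unique h1 h2]
  exact hsum.of_norm.hasSum

theorem finsupp_prod_exp (lam : ℕ → ℝ) (s : ℂ) (n : ℕ →₀ ℕ) :
    (n.prod fun k m => Complex.exp (-(s * lam k)) ^ m) = Complex.exp (-(s * weight lam n)) := by
  rw [weight, Finsupp.prod, Finsupp.sum]
  simp_rw [← Complex.exp_nat_mul]
  rw [← Complex.exp_sum]
  congr 1
  push_cast
  rw [Finset.mul_sum, ← Finset.sum_neg_distrib]
  exact Finset.sum_congr rfl fun k _ => by ring

/-- The double series `∑_{k, j ≥ 1} e ^ (-j s lam_k) / j`. -/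
def logGenC (lam : ℕ → ℝ) (s : ℂ) : ℂ :=
  ∑' p : ℕ × ℕ, Complex.exp (-(s * lam p.1)) ^ (p.2 + 1) / ((p.2 : ℂ) + 1)

theorem norm_exp_neg_mul (l : ℝ) (s : ℂ) : ‖Complex.exp (-(s * l))‖ = Real.exp (-(s.re * l)) := by
  rw [Complex.norm_exp]; simp

theorem hasSum_exp_weight {lam : ℕ → ℝ} (hl : ∀ k, 0 < lam k) {s : ℂ} (hs : 0 < s.re)
    (hsum : Summable fun k => -Real.log (1 - Real.exp (-(s.re * lam k)))) :
    HasSum (fun n : ℕ →₀ ℕ => Complex.exp (-(s * weight lam n))) (Complex.exp (logGenC lam s)) := by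
  have h := hasSum_finsupp_prod (z := fun k => Complex.exp (-(s * lam k)))
    (fun k => by
      rw [norm_exp_neg_mul, Real.exp_lt_one_iff]
      have := mul_pos hs (hl k)
      linarith)
    (by simpa only [norm_exp_neg_mul] using hsum)
  simp only [finsupp_prod_exp] at h
  exact h

/-- Sorting the vectors of weight at most `u` by their weight, `p(r)` is the size of a fibre. -/
theorem summedPartition_eq_ncard {lam : ℕ → ℝ} (hpos : 0 < lam 0) (hmono : StrictMono lam)
    (htop : Tendsto lam atTop atTop) (u : ℝ) :
    summedPartition lam u = {n : ℕ →₀ ℕ | weight lam n ≤ u}.ncard := by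
  classical
  have hf := finite_setOf_weight_le hpos hmono htop u
  have hr := finite_semigroupSet_le hpos hmono htop u
  rw [summedPartition, finsum_mem_eq_finite_toFinset_sum _ hr, ncard_eq_toFinset_card _ hf,
    Finset.card_eq_sum_card_fiberwise (f := weight lam) (t := hr.toFinset)]
  · refine Finset.sum_congr rfl fun r hr' => ?_
    have hru : r ≤ u := ((Finite.mem_toFinset hr).1 hr').2
    rw [partitionCount, ← ncard_coe_finset]
    congr 1
    ext n
    simp only [mem_ofPred_eq, Finset.coe_filter, Finite.mem_toFinset]
    constructor
    · rintro rfl; exact ⟨hru, rfl⟩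
    · rintro ⟨_, h⟩; exact h.symm
  · intro n hn
    simp only [Finite.coe_toFinset, mem_ofPred_eq] at hn ⊢
    exact ⟨⟨n, rfl⟩, hn⟩

/-! ### The exponentially tilted law. -/

/-- The coefficient `e ^ (-j x) / j`, `j = p.2 + 1`, `x = σ lam_k`, `k = p.1`. -/
def logCoeff (lam : ℕ → ℝ) (σ : ℝ) (p : ℕ × ℕ) : ℝ :=
  Real.exp (-(σ * lam p.1)) ^ (p.2 + 1) / ((p.2 : ℝ) + 1)

/-- The frequency `j lam_k`, `j = p.2 + 1`, `k = p.1`. -/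
def logFreq (lam : ℕ → ℝ) (p : ℕ × ℕ) : ℝ := ((p.2 : ℝ) + 1) * lam p.1

theorem logCoeff_nonneg (lam : ℕ → ℝ) (σ : ℝ) (p : ℕ × ℕ) : 0 ≤ logCoeff lam σ p := by
  unfold logCoeff; positivity

theorem hasSum_logCoeff {lam : ℕ → ℝ} (hl : ∀ k, 0 < lam k) {σ : ℝ} (hσ : 0 < σ)
    (hsum : Summable fun k => -Real.log (1 - Real.exp (-(σ * lam k)))) :
    HasSum (logCoeff lam σ) (logGen lam σ) := by
  have hlt : ∀ k, Real.exp (-(σ * lam k)) < 1 := fun k => by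
    rw [Real.exp_lt_one_iff]
    linarith [mul_pos hσ (hl k)]
  have hrow : ∀ k, HasSum (fun j : ℕ => logCoeff lam σ (k, j))
      (-Real.log (1 - Real.exp (-(σ * lam k)))) := fun k => by
    have h := Real.hasSum_pow_div_log_of_abs_lt_one
      (x := Real.exp (-(σ * lam k))) (by rw [abs_of_pos (Real.exp_pos _)]; exact hlt k)
    simp only [logCoeff]
    exact h
  have hS : Summable (logCoeff lam σ) := by
    refine (summable_prod_of_nonneg fun p => logCoeff_nonneg lam σ p).2
      ⟨fun k => (hrow k).summable, ?_⟩
    exact hsum.congr fun k => (hrow k).tsum_eq.symm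
  have h := hS.hasSum.prod_fiberwise hrow
  have e : logGen lam σ = ∑' p, logCoeff lam σ p := h.tsum_eq
  rw [e]
  exact hS.hasSum

theorem logCoeff_mul_exp (lam : ℕ → ℝ) (σ τ : ℝ) (p : ℕ × ℕ) :
    logCoeff lam (σ - τ) p = logCoeff lam σ p * Real.exp (τ * logFreq lam p) := by
  simp only [logCoeff, logFreq, ← Real.exp_nat_mul]
  rw [div_mul_eq_mul_div, ← Real.exp_add]
  congr 2
  push_cast
  ring

/-- The log moment generating function of the tilted weight, as a sum of `e ^ (τ freq) - 1` with
non-negative coefficients. `hasSum_logGenC_sub` is the same series at an imaginary argument; the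
common coefficients allow one to control the other. -/
theorem hasSum_logCoeff_sub {lam : ℕ → ℝ} (hl : ∀ k, 0 < lam k) {σ τ : ℝ} (hσ : 0 < σ)
    (hτ : 0 < σ - τ)
    (hsum : Summable fun k => -Real.log (1 - Real.exp (-(σ * lam k))))
    (hsum' : Summable fun k => -Real.log (1 - Real.exp (-((σ - τ) * lam k)))) :
    HasSum (fun p => logCoeff lam σ p * (Real.exp (τ * logFreq lam p) - 1))
      (logGen lam (σ - τ) - logGen lam σ) := by
  have h := (hasSum_logCoeff hl hτ hsum').sub (hasSum_logCoeff hl hσ hsum)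
  simp only [logCoeff_mul_exp] at h
  simpa only [mul_sub, mul_one] using h

theorem hasSum_logGenC_sub {lam : ℕ → ℝ} (hl : ∀ k, 0 < lam k) {σ : ℝ} (hσ : 0 < σ) (t : ℝ)
    (hsum : Summable fun k => -Real.log (1 - Real.exp (-(σ * lam k)))) :
    HasSum (fun p => (logCoeff lam σ p : ℂ) * (Complex.exp ((t * logFreq lam p : ℝ) * Complex.I) - 1))
      (logGenC lam (σ - t * Complex.I) - logGen lam σ) := by
  have h1 := hasSum_logCoeff hl hσ hsum
  have hterm : ∀ p : ℕ × ℕ, Complex.exp (-((σ - t * Complex.I) * lam p.1)) ^ (p.2 + 1) /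
      ((p.2 : ℂ) + 1) =
      (logCoeff lam σ p : ℂ) * Complex.exp ((t * logFreq lam p : ℝ) * Complex.I) := by
    intro p
    simp only [logCoeff, logFreq, ← Complex.exp_nat_mul, ← Real.exp_nat_mul]
    push_cast
    rw [div_mul_eq_mul_div, ← Complex.exp_add]
    congr 2
    ring
  have h2 : Summable fun p : ℕ × ℕ =>
      (logCoeff lam σ p : ℂ) * Complex.exp ((t * logFreq lam p : ℝ) * Complex.I) := by
    refine Summable.of_norm (h1.summable.congr fun p => ?_)
    rw [norm_mul, Complex.norm_exp_ofReal_mul_I, mul_one, Complex.norm_real,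
      Real.norm_of_nonneg (logCoeff_nonneg lam σ p)]
  have h3 : logGenC lam (σ - t * Complex.I) = ∑' p : ℕ × ℕ,
      (logCoeff lam σ p : ℂ) * Complex.exp ((t * logFreq lam p : ℝ) * Complex.I) :=
    tsum_congr hterm
  rw [h3]
  have h4 := h2.hasSum.sub ((Complex.hasSum_ofReal).2 h1)
  simpa only [mul_sub, mul_one] using h4

theorem logGenC_ofReal {lam : ℕ → ℝ} (hl : ∀ k, 0 < lam k) {σ : ℝ} (hσ : 0 < σ)
    (hsum : Summable fun k => -Real.log (1 - Real.exp (-(σ * lam k)))) :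
    logGenC lam σ = logGen lam σ := by
  have h := hasSum_logGenC_sub hl hσ 0 hsum
  simp only [zero_mul, Complex.ofReal_zero, Complex.exp_zero, sub_self, mul_zero, sub_zero] at h
  exact sub_eq_zero.1 (h.unique hasSum_zero)

/-- The law of `σ (weight - u)` when multiplicities `n` have probability proportional to
`e ^ (-σ weight n)`. -/
def tiltedMeasure (lam : ℕ → ℝ) (σ u : ℝ) : Measure ℝ :=
  Measure.sum fun n : ℕ →₀ ℕ =>
    ENNReal.ofReal (Real.exp (-(σ * weight lam n) - logGen lam σ)) •
      Measure.dirac (σ * (weight lam n - u))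

theorem hasSum_exp_weight_real {lam : ℕ → ℝ} (hl : ∀ k, 0 < lam k) {σ : ℝ} (hσ : 0 < σ)
    (hsum : Summable fun k => -Real.log (1 - Real.exp (-(σ * lam k)))) :
    HasSum (fun n : ℕ →₀ ℕ => Real.exp (-(σ * weight lam n) - logGen lam σ)) 1 := by
  have h := hasSum_exp_weight hl (s := σ) (by simpa using hσ) (by simpa using hsum)
  rw [logGenC_ofReal hl hσ hsum] at h
  have h2 : HasSum (fun n : ℕ →₀ ℕ => Real.exp (-(σ * weight lam n))) (Real.exp (logGen lam σ)) := by
    rw [← Complex.hasSum_ofReal]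
    push_cast
    exact h
  have h3 := h2.mul_right (Real.exp (-logGen lam σ))
  rw [← Real.exp_add, add_neg_cancel, Real.exp_zero] at h3
  simpa only [sub_eq_add_neg, Real.exp_add] using h3

theorem isProbabilityMeasure_tiltedMeasure {lam : ℕ → ℝ} (hl : ∀ k, 0 < lam k) {σ : ℝ}
    (hσ : 0 < σ) (u : ℝ)
    (hsum : Summable fun k => -Real.log (1 - Real.exp (-(σ * lam k)))) :
    IsProbabilityMeasure (tiltedMeasure lam σ u) := by
  have h := hasSum_exp_weight_real hl hσ hsum
  constructor
  rw [tiltedMeasure, Measure.sum_apply _ MeasurableSet.univ]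
  simp only [Measure.smul_apply, measure_univ, smul_eq_mul, mul_one]
  rw [← ENNReal.ofReal_tsum_of_nonneg (fun n => (Real.exp_pos _).le) h.summable, h.tsum_eq,
    ENNReal.ofReal_one]

theorem hasSum_integral_tiltedMeasure {E : Type*} [NormedAddCommGroup E] [NormedSpace ℝ E]
    [CompleteSpace E] {lam : ℕ → ℝ} {σ u : ℝ} {f : ℝ → E}
    (hf : Integrable f (tiltedMeasure lam σ u)) :
    HasSum (fun n : ℕ →₀ ℕ => Real.exp (-(σ * weight lam n) - logGen lam σ) •
      f (σ * (weight lam n - u))) (∫ x, f x ∂tiltedMeasure lam σ u) := by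
  have h := hasSum_integral_measure hf
  simp only [integral_smul_measure, integral_dirac,
    ENNReal.toReal_ofReal (Real.exp_pos _).le] at h
  exact h

theorem charFun_tiltedMeasure {lam : ℕ → ℝ} (hl : ∀ k, 0 < lam k) {σ : ℝ} (hσ : 0 < σ) (u y : ℝ)
    (hsum : Summable fun k => -Real.log (1 - Real.exp (-(σ * lam k)))) :
    charFun (tiltedMeasure lam σ u) y =
      Complex.exp (logGenC lam (σ - (σ * y : ℝ) * Complex.I) - logGen lam σ -
        (σ * y * u : ℝ) * Complex.I) := by
  have := isProbabilityMeasure_tiltedMeasure hl hσ u hsum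
  rw [charFun_apply_real]
  have hintegr : Integrable (fun x : ℝ => Complex.exp (y * x * Complex.I)) (tiltedMeasure lam σ u) := by
    refine Integrable.of_bound (by fun_prop) 1 (ae_of_all _ fun x => ?_)
    rw [← Complex.ofReal_mul, Complex.norm_exp_ofReal_mul_I]
  have h1 := hasSum_integral_tiltedMeasure hintegr
  have h2 := (hasSum_exp_weight hl (s := σ - (σ * y : ℝ) * Complex.I) (by simpa using hσ)
    (by simpa using hsum)).mul_right
      (Complex.exp (-(logGen lam σ : ℂ) - (σ * y * u : ℝ) * Complex.I))
  rw [← Complex.exp_add] at h2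
  rw [show logGenC lam (σ - (σ * y : ℝ) * Complex.I) - logGen lam σ -
        (σ * y * u : ℝ) * Complex.I = logGenC lam (σ - (σ * y : ℝ) * Complex.I) +
        (-(logGen lam σ : ℂ) - (σ * y * u : ℝ) * Complex.I) by ring]
  refine h1.unique (h2.congr_fun ?_)
  intro n
  rw [Complex.real_smul, Complex.ofReal_exp, ← Complex.exp_add, ← Complex.exp_add]
  congr 1
  push_cast
  ring

/-- The prefactor and the value `e ^ (σ (weight - u))` exactly cancel the mass of each `n` with
`weight ≤ u`, so each such `n` contributes 1. -/
theorem summedPartition_eq_integral {lam : ℕ → ℝ} (hpos : 0 < lam 0) (hmono : StrictMono lam)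
    (htop : Tendsto lam atTop atTop) {σ : ℝ} (hσ : 0 < σ) (u : ℝ)
    (hsum : Summable fun k => -Real.log (1 - Real.exp (-(σ * lam k)))) :
    (summedPartition lam u : ℝ) = Real.exp (logGen lam σ + σ * u) *
      ∫ x, (Iic 0).indicator Real.exp x ∂tiltedMeasure lam σ u := by
  classical
  have := isProbabilityMeasure_tiltedMeasure (lam_pos hpos hmono) hσ u hsum
  have hintegr : Integrable ((Iic 0).indicator Real.exp) (tiltedMeasure lam σ u) := by
    refine Integrable.of_bound (Real.measurable_exp.indicator measurableSet_Iic).aestronglyMeasurable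
      1 (ae_of_all _ fun x => ?_)
    rw [norm_indicator_eq_indicator_norm]
    refine indicator_le' (fun x hx => ?_) (fun x _ => zero_le_one) x
    rw [Real.norm_of_nonneg (Real.exp_pos x).le]
    exact Real.exp_le_one_iff.2 hx
  have hf := finite_setOf_weight_le hpos hmono htop u
  have h1 := (hasSum_integral_tiltedMeasure hintegr).mul_left (Real.exp (logGen lam σ + σ * u))
  have h2 : HasSum (fun n : ℕ →₀ ℕ => if n ∈ hf.toFinset then (1 : ℝ) else 0)
      (∑ n ∈ hf.toFinset, if n ∈ hf.toFinset then (1 : ℝ) else 0) :=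
    hasSum_sum_of_ne_finset_zero fun n hn => by simp only [hn, if_false]
  rw [summedPartition_eq_ncard hpos hmono htop, ncard_eq_toFinset_card _ hf]
  have h3 : ∑ n ∈ hf.toFinset, (if n ∈ hf.toFinset then (1 : ℝ) else 0) = hf.toFinset.card := by
    rw [Finset.sum_congr rfl fun n hn => if_pos hn]; simp
  rw [← h3]
  refine h2.unique (h1.congr_fun fun n => ?_)
  simp only [Finite.mem_toFinset, mem_ofPred_eq, indicator_apply, mem_Iic, smul_eq_mul]
  by_cases h : weight lam n ≤ u
  · have h' : σ * (weight lam n - u) ≤ 0 := mul_nonpos_of_nonneg_of_nonpos hσ.le (by linarith)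
    rw [if_pos h, if_pos h', ← Real.exp_add, ← Real.exp_add]
    rw [← Real.exp_zero]
    congr 1
    ring
  · have h' : ¬ σ * (weight lam n - u) ≤ 0 := not_le.2 (mul_pos hσ (by linarith))
    rw [if_neg h, if_neg h']
    simp

/-! ### From real cumulants to the characteristic function. -/

/-- By the mean value theorem: the derivative `cosh - 1` is increasing on `w ≥ 0`. The analogue for
`cosh` follows in the same way from this one. -/
theorem sinh_sub_self_le {w : ℝ} (hw : 0 ≤ w) : Real.sinh w - w ≤ w * (Real.cosh w - 1) := by
  rcases hw.eq_or_lt with rfl | hw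
  · simp
  obtain ⟨c, hc, h⟩ := exists_hasDerivAt_eq_slope (fun x => Real.sinh x - x)
    (fun x => Real.cosh x - 1) hw (by fun_prop)
    (fun x _ => (Real.hasDerivAt_sinh x).sub (hasDerivAt_id x))
  simp only [Real.sinh_zero, sub_zero] at h
  have h1 : Real.cosh c ≤ Real.cosh w := Real.cosh_le_cosh.2 (by
    rw [abs_of_pos hc.1, abs_of_pos hw]; exact hc.2.le)
  rw [eq_div_iff hw.ne'] at h
  rw [← h, mul_comm]
  exact mul_le_mul_of_nonneg_left (by linarith) hw.le

theorem cosh_sub_one_sub_le {w : ℝ} (hw : 0 ≤ w) :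
    Real.cosh w - 1 - w ^ 2 / 2 ≤ w ^ 2 * (Real.cosh w - 1) := by
  rcases hw.eq_or_lt with rfl | hw
  · simp
  obtain ⟨c, hc, h⟩ := exists_hasDerivAt_eq_slope (fun x => Real.cosh x - 1 - x ^ 2 / 2)
    (fun x => Real.sinh x - x) hw (by fun_prop)
    (fun x _ => by
      refine (((Real.hasDerivAt_cosh x).sub_const 1).fun_sub
        ((hasDerivAt_pow 2 x).div_const 2)).congr_deriv ?_
      norm_num)
  simp only [Real.cosh_zero, sub_zero, sub_self, ne_eq, OfNat.ofNat_ne_zero, not_false_eq_true,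
    zero_pow, zero_div] at h
  rw [eq_div_iff hw.ne'] at h
  rw [← h]
  have h1 : Real.cosh c ≤ Real.cosh w := Real.cosh_le_cosh.2 (by
    rw [abs_of_pos hc.1, abs_of_pos hw]; exact hc.2.le)
  have h2 := sinh_sub_self_le hc.1.le
  have h3 := Real.one_le_cosh c
  have h4 : c * (Real.cosh c - 1) ≤ w * (Real.cosh w - 1) :=
    mul_le_mul hc.2.le (by linarith) (by linarith) hw.le
  nlinarith

theorem sq_le_two_mul_cosh_sub_one (w : ℝ) : w ^ 2 ≤ 2 * (Real.cosh w - 1) := by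
  have h : Real.cosh w = 2 * Real.sinh (w / 2) ^ 2 + 1 := by
    have := Real.cosh_two_mul (w / 2)
    rw [show 2 * (w / 2) = w by ring, Real.cosh_sq] at this
    linarith
  have h2 : (w / 2) ^ 2 ≤ Real.sinh (w / 2) ^ 2 := by
    rw [sq_le_sq]
    rcases le_total 0 (w / 2) with h0 | h0
    · rw [abs_of_nonneg h0, abs_of_nonneg (Real.sinh_nonneg_iff.2 h0)]
      exact Real.self_le_sinh_iff.2 h0
    · rw [abs_of_nonpos h0, abs_of_nonpos (Real.sinh_nonpos_iff.2 h0)]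
      have := Real.sinh_le_self_iff.2 h0
      linarith
  rw [h]
  linarith

theorem norm_exp_mul_I_sub_taylor_le (x : ℝ) :
    ‖Complex.exp (x * Complex.I) - (1 + x * Complex.I - x ^ 2 / 2)‖ ≤ 4 * |x| ^ 3 := by
  rcases le_total |x| 1 with h | h
  · have h1 := Complex.norm_exp_sub_sum_le_norm_mul_exp (x * Complex.I) 3
    have e : ∑ m ∈ Finset.range 3, ((x : ℂ) * Complex.I) ^ m / (m.factorial : ℂ) =
        1 + x * Complex.I - x ^ 2 / 2 := by
      simp [Finset.sum_range_succ, Nat.factorial, mul_pow]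
      ring
    rw [e, norm_mul, Complex.norm_I, mul_one, Complex.norm_real, Real.norm_eq_abs] at h1
    refine h1.trans ?_
    have h2 : Real.exp |x| ≤ 4 :=
      (Real.exp_le_exp.2 h).trans (by linarith [Real.exp_one_lt_d9])
    rw [mul_comm]
    exact mul_le_mul_of_nonneg_right h2 (by positivity)
  · have h1 : ‖Complex.exp (x * Complex.I) - (1 + x * Complex.I - x ^ 2 / 2)‖ ≤
        1 + (1 + |x| + |x| ^ 2 / 2) := by
      refine (norm_sub_le _ _).trans (add_le_add (Complex.norm_exp_ofReal_mul_I x).le ?_)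
      refine (norm_sub_le _ _).trans (add_le_add ((norm_add_le _ _).trans (add_le_add (by simp) ?_)) ?_)
      · rw [norm_mul, Complex.norm_I, mul_one, Complex.norm_real, Real.norm_eq_abs]
      · rw [norm_div, norm_pow, Complex.norm_real, Real.norm_eq_abs]
        simp
    refine h1.trans ?_
    have h2 : |x| ≤ |x| ^ 3 := by
      have := pow_le_pow_right₀ h (show 1 ≤ 3 by norm_num); simpa using this
    have h3 : |x| ^ 2 ≤ |x| ^ 3 := pow_le_pow_right₀ h (by norm_num)
    have h4 : 1 ≤ |x| ^ 3 := one_le_pow₀ h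
    linarith

/-- Compares `e ^ (i t w) - 1` with `i t sinh w - t² (cosh w - 1)` instead of its Taylor polynomial,
because sums of `sinh` and `cosh` can be read off from real exponential moments. Every error is at
most a multiple of `w d` or `d²` with `d = cosh w - 1`, and `w d ≤ ε d + d² / (2ε)` leaves only `d`,
with a small factor, and `d²`. -/
theorem norm_exp_sub_cumulants_le {w : ℝ} (hw : 0 ≤ w) (t : ℝ) {ε : ℝ} (hε : 0 < ε) :
    ‖Complex.exp ((t * w : ℝ) * Complex.I) - 1 - (t * Real.sinh w : ℝ) * Complex.I +
        (t ^ 2 * (Real.cosh w - 1) : ℝ)‖ ≤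
      (8 * |t| ^ 3 + |t|) * (ε * (Real.cosh w - 1)) +
        ((8 * |t| ^ 3 + |t|) / (2 * ε) + 2 * t ^ 2) * (Real.cosh w - 1) ^ 2 := by
  set d := Real.cosh w - 1 with hd
  have hd0 : 0 ≤ d := by have := Real.one_le_cosh w; linarith
  have hw2 : w ^ 2 ≤ 2 * d := sq_le_two_mul_cosh_sub_one w
  have h1 := norm_exp_mul_I_sub_taylor_le (t * w)
  have h2 := sinh_sub_self_le hw
  have h3 := cosh_sub_one_sub_le hw
  have h2' : 0 ≤ Real.sinh w - w := by linarith [Real.self_le_sinh_iff.2 hw]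
  have h3' : 0 ≤ d - w ^ 2 / 2 := by linarith
  have hsplit : Complex.exp ((t * w : ℝ) * Complex.I) - 1 - (t * Real.sinh w : ℝ) * Complex.I +
        (t ^ 2 * d : ℝ) =
      (Complex.exp ((t * w : ℝ) * Complex.I) - (1 + (t * w : ℝ) * Complex.I - (t * w : ℝ) ^ 2 / 2)) -
        (t * (Real.sinh w - w) : ℝ) * Complex.I + (t ^ 2 * (d - w ^ 2 / 2) : ℝ) := by
    push_cast
    ring
  have hwd : w * d ≤ ε * d + d ^ 2 / (2 * ε) := by
    have : w * d ≤ (ε * w ^ 2) / 2 + d ^ 2 / (2 * ε) := by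
      rw [← sub_nonneg]
      have : ε * w ^ 2 / 2 + d ^ 2 / (2 * ε) - w * d = (ε * w - d) ^ 2 / (2 * ε) := by
        field_simp; ring
      rw [this]; positivity
    nlinarith
  have ha : ‖Complex.exp ((t * w : ℝ) * Complex.I) -
      (1 + (t * w : ℝ) * Complex.I - (t * w : ℝ) ^ 2 / 2)‖ ≤ 8 * |t| ^ 3 * (w * d) := by
    refine h1.trans ?_
    rw [abs_mul, mul_pow, abs_of_nonneg hw]
    have : w ^ 3 ≤ 2 * (w * d) := by nlinarith
    have h0 : 0 ≤ |t| ^ 3 := by positivity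
    nlinarith
  have hb : ‖((t * (Real.sinh w - w) : ℝ) : ℂ) * Complex.I‖ ≤ |t| * (w * d) := by
    rw [norm_mul, Complex.norm_I, mul_one, Complex.norm_real, Real.norm_eq_abs, abs_mul,
      abs_of_nonneg h2']
    exact mul_le_mul_of_nonneg_left h2 (abs_nonneg t)
  have hc : ‖((t ^ 2 * (d - w ^ 2 / 2) : ℝ) : ℂ)‖ ≤ 2 * t ^ 2 * d ^ 2 := by
    rw [Complex.norm_real, Real.norm_of_nonneg (mul_nonneg (sq_nonneg t) h3')]
    have h4 : d - w ^ 2 / 2 ≤ 2 * d ^ 2 := by nlinarith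
    nlinarith [sq_nonneg t]
  rw [hsplit]
  refine (norm_add_le _ _).trans ((add_le_add ((norm_sub_le _ _).trans (add_le_add ha hb)) hc).trans ?_)
  have h5 : 0 ≤ 8 * |t| ^ 3 + |t| := by positivity
  have h6 := mul_le_mul_of_nonneg_left hwd h5
  have h7 : (8 * |t| ^ 3 + |t|) * (ε * d + d ^ 2 / (2 * ε)) =
    (8 * |t| ^ 3 + |t|) * (ε * d) + (8 * |t| ^ 3 + |t|) / (2 * ε) * d ^ 2 := by ring
  linarith

theorem norm_sum_exp_sub_cumulants_le {ι : Type*} {c w : ι → ℝ} (hc : ∀ p, 0 ≤ c p)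
    (hw : ∀ p, 0 ≤ w p) {S : ℝ → ℝ}
    (hS : ∀ τ ∈ ({1, -1, 2, -2} : Set ℝ), HasSum (fun p => c p * (Real.exp (τ * w p) - 1)) (S τ))
    {t : ℝ} {G : ℂ}
    (hG : HasSum (fun p => (c p : ℂ) * (Complex.exp ((t * w p : ℝ) * Complex.I) - 1)) G)
    {ε : ℝ} (hε : 0 < ε) :
    ‖G - (t * ((S 1 - S (-1)) / 2) : ℝ) * Complex.I + (t ^ 2 * ((S 1 + S (-1)) / 2) : ℝ)‖ ≤
      (8 * |t| ^ 3 + |t|) * (ε * ((S 1 + S (-1)) / 2)) +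
        ((8 * |t| ^ 3 + |t|) / (2 * ε) + 2 * t ^ 2) *
          ((S 2 + S (-2)) / 4 - (S 1 + S (-1))) := by
  have h1 := hS 1 (by simp)
  have h1' := hS (-1) (by simp)
  have h2 := hS 2 (by simp)
  have h2' := hS (-2) (by simp)
  have hsinh : HasSum (fun p => c p * Real.sinh (w p)) ((S 1 - S (-1)) / 2) := by
    refine ((h1.sub h1').div_const 2).congr_fun fun p => ?_
    rw [Real.sinh_eq, one_mul, neg_one_mul]; ring
  have hcosh : HasSum (fun p => c p * (Real.cosh (w p) - 1)) ((S 1 + S (-1)) / 2) := by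
    refine ((h1.add h1').div_const 2).congr_fun fun p => ?_
    rw [Real.cosh_eq, one_mul, neg_one_mul]; ring
  -- The square of `cosh w - 1` is a combination of `e ^ (±2w) - 1` and `e ^ (±w) - 1`; this is why
  -- the points `τ = ±2` are needed.
  have hcosh2 : HasSum (fun p => c p * (Real.cosh (w p) - 1) ^ 2)
      ((S 2 + S (-2)) / 4 - (S 1 + S (-1))) := by
    refine (((h2.add h2').div_const 4).sub (h1.add h1')).congr_fun fun p => ?_
    have e1 : Real.exp (2 * w p) = Real.exp (w p) ^ 2 := by rw [← Real.exp_nat_mul]; norm_num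
    have e2 : Real.exp (-2 * w p) = Real.exp (-w p) ^ 2 := by
      rw [← Real.exp_nat_mul]; norm_num
    have e3 : Real.exp (w p) * Real.exp (-w p) = 1 := by rw [← Real.exp_add]; simp
    rw [Real.cosh_eq, one_mul, neg_one_mul, e1, e2]
    linear_combination (c p / 2) * e3
  have hL := (hG.sub (((Complex.hasSum_ofReal).2 (hsinh.mul_left t)).mul_right Complex.I)).add
    ((Complex.hasSum_ofReal).2 (hcosh.mul_left (t ^ 2)))
  have hR := ((hcosh.mul_left ε).mul_left (8 * |t| ^ 3 + |t|)).add
    (hcosh2.mul_left ((8 * |t| ^ 3 + |t|) / (2 * ε) + 2 * t ^ 2))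
  refine hL.norm_le_of_bounded hR fun p => ?_
  have hb := mul_le_mul_of_nonneg_left (norm_exp_sub_cumulants_le (hw p) t hε) (hc p)
  refine le_trans (le_of_eq ?_) (hb.trans (le_of_eq (by ring)))
  rw [← Complex.norm_of_nonneg (hc p), ← norm_mul]
  congr 1
  push_cast
  rw [Complex.norm_of_nonneg (hc p)]
  ring

/-- Convergence of the cumulant generating function to `τ² / 2` at `τ = ±1, ±2` implies
convergence on the imaginary axis, for a sum of compensated exponentials. -/
theorem tendsto_logCharFun_of_tendsto_cumulant {ι κ : Type*} {l : Filter κ} {c w : κ → ι → ℝ}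
    {b : κ → ℝ} {S : κ → ℝ → ℝ} (hc : ∀ᶠ u in l, ∀ p, 0 ≤ c u p) (hw : ∀ᶠ u in l, ∀ p, 0 ≤ w u p)
    (hS : ∀ᶠ u in l, ∀ τ ∈ ({1, -1, 2, -2} : Set ℝ),
      HasSum (fun p => c u p * (Real.exp (τ * w u p) - 1)) (S u τ))
    (hlim : ∀ τ ∈ ({1, -1, 2, -2} : Set ℝ), Tendsto (fun u => S u τ - b u * τ) l (𝓝 (τ ^ 2 / 2)))
    {t : ℝ} {G : κ → ℂ}
    (hG : ∀ᶠ u in l,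
      HasSum (fun p => (c u p : ℂ) * (Complex.exp ((t * w u p : ℝ) * Complex.I) - 1)) (G u)) :
    Tendsto (fun u => G u - (t * b u : ℝ) * Complex.I) l (𝓝 (-(t ^ 2 / 2 : ℝ) : ℂ)) := by
  have l1 := hlim 1 (by simp)
  have l1' := hlim (-1) (by simp)
  have l2 := hlim 2 (by simp)
  have l2' := hlim (-2) (by simp)
  have hodd : Tendsto (fun u => (S u 1 - S u (-1)) / 2 - b u) l (𝓝 0) := by
    have := (l1.sub l1').div_const 2
    norm_num at this
    refine this.congr fun u => by ring
  have heven : Tendsto (fun u => (S u 1 + S u (-1)) / 2) l (𝓝 (1 / 2)) := by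
    have := (l1.add l1').div_const 2
    norm_num at this ⊢
    refine this.congr fun u => by ring
  -- The limit is `(2 + 2) / 4 - (1/2 + 1/2) = 0`. It plays the part of a Lindeberg condition: no
  -- individual frequency matters in the limit.
  have hQ : Tendsto (fun u => (S u 2 + S u (-2)) / 4 - (S u 1 + S u (-1))) l (𝓝 0) := by
    have := ((l2.add l2').div_const 4).sub (l1.add l1')
    norm_num at this
    refine this.congr fun u => by ring
  set E : κ → ℂ := fun u => G u - (t * ((S u 1 - S u (-1)) / 2) : ℝ) * Complex.I +
    (t ^ 2 * ((S u 1 + S u (-1)) / 2) : ℝ) with hE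
  have hE0 : Tendsto E l (𝓝 0) := by
    rw [Metric.tendsto_nhds]
    intro δ hδ
    set k := 8 * |t| ^ 3 + |t| with hk
    have hk0 : 0 ≤ k := by positivity
    -- In the limit the bound is `k ε / 2`, which this choice makes smaller than `δ`.
    set ε := δ / (k + 1) with hε
    have hε0 : 0 < ε := by positivity
    have hB : Tendsto (fun u => k * (ε * ((S u 1 + S u (-1)) / 2)) +
        (k / (2 * ε) + 2 * t ^ 2) * ((S u 2 + S u (-2)) / 4 - (S u 1 + S u (-1)))) l
        (𝓝 (k * (ε * (1 / 2)) + (k / (2 * ε) + 2 * t ^ 2) * 0)) :=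
      ((heven.const_mul ε).const_mul k).add (hQ.const_mul _)
    have hlt : k * (ε * (1 / 2)) + (k / (2 * ε) + 2 * t ^ 2) * 0 < δ := by
      have : ε * (k + 1) = δ := by rw [hε]; field_simp
      nlinarith
    filter_upwards [hc, hw, hS, hG, hB.eventually_lt_const hlt] with u h1 h2 h3 h4 h5
    rw [dist_zero_right]
    exact (norm_sum_exp_sub_cumulants_le h1 h2 h3 h4 hε0).trans_lt h5
  have hodd' : Tendsto (fun u => ((t * ((S u 1 - S u (-1)) / 2 - b u) : ℝ) : ℂ) * Complex.I) l
      (𝓝 (((t * 0 : ℝ) : ℂ) * Complex.I)) :=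
    ((Complex.continuous_ofReal.tendsto _).comp (hodd.const_mul t)).mul_const _
  have heven' : Tendsto (fun u => ((t ^ 2 * ((S u 1 + S u (-1)) / 2) : ℝ) : ℂ)) l
      (𝓝 ((t ^ 2 * (1 / 2) : ℝ) : ℂ)) :=
    (Complex.continuous_ofReal.tendsto _).comp (heven.const_mul (t ^ 2))
  have h := (hE0.add hodd').sub heven'
  refine (h.congr fun u => ?_).trans (le_of_eq ?_)
  · simp only [hE]
    push_cast
    ring
  · congr 1
    push_cast
    ring

/-! ### A positive kernel with compactly supported Fourier transform. -/

/-- The triangle function supported on `[-1, 1]`. -/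
def triangle (v : ℝ) : ℝ := max 0 (1 - |v|)

/-- The Fejér kernel `(sin (x / 2) / (x / 2)) ^ 2`. -/
def fejer (x : ℝ) : ℝ := Real.sinc (x / 2) ^ 2

theorem continuous_triangle : Continuous triangle := by unfold triangle; fun_prop

theorem continuous_fejer : Continuous fejer := by
  have := Real.continuous_sinc
  unfold fejer
  fun_prop

theorem triangle_nonneg (v : ℝ) : 0 ≤ triangle v := le_max_left _ _

theorem triangle_le_one (v : ℝ) : triangle v ≤ 1 :=
  max_le zero_le_one (by linarith [abs_nonneg v])

theorem triangle_eq_zero {v : ℝ} (hv : 1 ≤ |v|) : triangle v = 0 := max_eq_left (by linarith)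

theorem integral_triangle_eq_interval (g : ℝ → ℂ) :
    ∫ v, (triangle v : ℂ) * g v = ∫ v in (-1 : ℝ)..1, (triangle v : ℂ) * g v := by
  rw [intervalIntegral.integral_of_le (by norm_num), ← integral_indicator measurableSet_Ioc]
  congr 1
  ext v
  by_cases hv : v ∈ Ioc (-1 : ℝ) 1
  · rw [indicator_of_mem hv]
  · rw [indicator_of_notMem hv, triangle_eq_zero, Complex.ofReal_zero, zero_mul]
    by_contra h
    have := abs_lt.1 (not_le.1 h)
    exact hv ⟨this.1, this.2.le⟩

theorem interval_triangle_split {g : ℝ → ℂ} (hg : Continuous g) :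
    ∫ v in (-1 : ℝ)..1, (triangle v : ℂ) * g v =
      (∫ v in (-1 : ℝ)..0, (1 + v : ℂ) * g v) + ∫ v in (0 : ℝ)..1, (1 - v : ℂ) * g v := by
  have hc : Continuous fun v : ℝ => (triangle v : ℂ) * g v :=
    (Complex.continuous_ofReal.comp continuous_triangle).mul hg
  rw [← intervalIntegral.integral_add_adjacent_intervals (b := 0) (hc.intervalIntegrable _ _)
    (hc.intervalIntegrable _ _)]
  congr 1
  · refine intervalIntegral.integral_congr fun v hv => ?_
    rw [uIcc_of_le (by norm_num)] at hv
    have : triangle v = 1 + v := by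
      rw [triangle, abs_of_nonpos hv.2, max_eq_right (by linarith [hv.1])]; ring
    simp [this]
  · refine intervalIntegral.integral_congr fun v hv => ?_
    rw [uIcc_of_le (by norm_num)] at hv
    have : triangle v = 1 - v := by
      rw [triangle, abs_of_nonneg hv.1, max_eq_right (by linarith [hv.2])]
    simp [this]

/-- Computed from explicit antiderivatives on the two halves. These divide by `a = i x`, so `x = 0`
is treated separately. -/
theorem integral_triangle_mul_exp (x : ℝ) :
    ∫ v, (triangle v : ℂ) * Complex.exp (v * x * Complex.I) = fejer x := by
  rw [integral_triangle_eq_interval, interval_triangle_split (by fun_prop)]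
  by_cases hx : x = 0
  · subst hx
    have h1 : ∀ v ∈ uIcc (-1 : ℝ) 0, HasDerivAt (fun v : ℝ => (v : ℂ) + (v : ℂ) ^ 2 / 2)
        (1 + (v : ℂ)) v := by
      intro v _
      have := (hasDerivAt_id v).ofReal_comp.fun_add
        (((hasDerivAt_id v).ofReal_comp.fun_pow 2).div_const 2)
      refine this.congr_deriv ?_
      simp
    have h2 : ∀ v ∈ uIcc (0 : ℝ) 1, HasDerivAt (fun v : ℝ => (v : ℂ) - (v : ℂ) ^ 2 / 2)
        (1 - (v : ℂ)) v := by
      intro v _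
      have := (hasDerivAt_id v).ofReal_comp.fun_sub
        (((hasDerivAt_id v).ofReal_comp.fun_pow 2).div_const 2)
      refine this.congr_deriv ?_
      simp
    simp only [Complex.ofReal_zero, mul_zero, zero_mul, Complex.exp_zero, mul_one]
    rw [intervalIntegral.integral_eq_sub_of_hasDerivAt h1
        (Continuous.intervalIntegrable (by fun_prop) _ _),
      intervalIntegral.integral_eq_sub_of_hasDerivAt h2
        (Continuous.intervalIntegrable (by fun_prop) _ _)]
    simp [fejer]
    norm_num
  · set a : ℂ := x * Complex.I with ha
    have ha0 : a ≠ 0 := mul_ne_zero (by exact_mod_cast hx) Complex.I_ne_zero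
    have hexp : ∀ v : ℝ, HasDerivAt (fun v : ℝ => Complex.exp (v * x * Complex.I))
        (Complex.exp (v * x * Complex.I) * a) v := by
      intro v
      have h := (((hasDerivAt_id v).ofReal_comp.mul_const (x : ℂ)).mul_const Complex.I).cexp
      refine h.congr_deriv ?_
      simp [ha]
    have hid : ∀ v : ℝ, HasDerivAt (fun v : ℝ => (v : ℂ)) 1 v := fun v => by
      simpa using (hasDerivAt_id v).ofReal_comp
    have h1 : ∀ v ∈ uIcc (-1 : ℝ) 0, HasDerivAt
        (fun v : ℝ => (1 + v : ℂ) * Complex.exp (v * x * Complex.I) / a -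
          Complex.exp (v * x * Complex.I) / a ^ 2)
        ((1 + v : ℂ) * Complex.exp (v * x * Complex.I)) v := by
      intro v _
      have := ((((hid v).const_add 1).fun_mul (hexp v)).div_const a).fun_sub ((hexp v).div_const (a ^ 2))
      refine this.congr_deriv ?_
      field_simp
      ring
    have h2 : ∀ v ∈ uIcc (0 : ℝ) 1, HasDerivAt
        (fun v : ℝ => (1 - v : ℂ) * Complex.exp (v * x * Complex.I) / a +
          Complex.exp (v * x * Complex.I) / a ^ 2)
        ((1 - v : ℂ) * Complex.exp (v * x * Complex.I)) v := by
      intro v _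
      have := ((((hid v).const_sub 1).fun_mul (hexp v)).div_const a).fun_add ((hexp v).div_const (a ^ 2))
      refine this.congr_deriv ?_
      field_simp
      ring
    rw [intervalIntegral.integral_eq_sub_of_hasDerivAt h1
        (Continuous.intervalIntegrable (by fun_prop) _ _),
      intervalIntegral.integral_eq_sub_of_hasDerivAt h2
        (Continuous.intervalIntegrable (by fun_prop) _ _)]
    have hx2 : x / 2 ≠ 0 := by simpa using hx
    have hf : (fejer x : ℂ) = (2 * Complex.cos x - 2) / a ^ 2 := by
      rw [fejer, Real.sinc_of_ne_zero hx2, div_pow, Real.sin_sq_eq_half_sub]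
      rw [show 2 * (x / 2) = x by ring, ha, mul_pow, Complex.I_sq]
      push_cast
      have : (x : ℂ) ≠ 0 := by exact_mod_cast hx
      field_simp
      ring
    rw [hf, Complex.two_cos]
    have e1 : Complex.exp (((-1 : ℝ) : ℂ) * x * Complex.I) = Complex.exp (-x * Complex.I) := by
      push_cast; ring_nf
    have e2 : Complex.exp (((1 : ℝ) : ℂ) * x * Complex.I) = Complex.exp (x * Complex.I) := by
      push_cast; ring_nf
    rw [e1, e2]
    simp only [Complex.ofReal_zero, Complex.ofReal_one, Complex.ofReal_neg, zero_mul,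
      Complex.exp_zero]
    field_simp
    ring

/-- A band-limited positive kernel. -/
def bandKernel (x : ℝ) : ℝ := fejer x + fejer (x + Real.pi)

/-- The multiplier `v ↦ (1 - |v|)₊ (1 + e ^ (i π v))` whose transform is `bandKernel`. -/
def bandMultiplier (v : ℝ) : ℂ := triangle v * (1 + Complex.exp (v * Real.pi * Complex.I))

theorem continuous_bandKernel : Continuous bandKernel := by
  have := continuous_fejer
  unfold bandKernel
  fun_prop

theorem continuous_bandMultiplier : Continuous bandMultiplier := by
  have := continuous_triangle
  unfold bandMultiplier
  fun_prop

theorem norm_bandMultiplier_le (v : ℝ) : ‖bandMultiplier v‖ ≤ 2 := by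
  rw [bandMultiplier, norm_mul, Complex.norm_real, Real.norm_of_nonneg (triangle_nonneg v)]
  have h1 : ‖1 + Complex.exp (v * Real.pi * Complex.I)‖ ≤ 2 := by
    refine (norm_add_le _ _).trans ?_
    rw [← Complex.ofReal_mul, Complex.norm_exp_ofReal_mul_I]
    norm_num
  calc _ ≤ 1 * 2 := mul_le_mul (triangle_le_one v) h1 (norm_nonneg _) zero_le_one
    _ = 2 := by norm_num

theorem bandMultiplier_eq_zero {v : ℝ} (hv : 1 ≤ |v|) : bandMultiplier v = 0 := by
  simp [bandMultiplier, triangle_eq_zero hv]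

theorem bandMultiplier_zero : bandMultiplier 0 = 2 := by
  simp [bandMultiplier, triangle]
  norm_num

theorem integrable_bandMultiplier : Integrable bandMultiplier := by
  refine continuous_bandMultiplier.integrable_of_hasCompactSupport ?_
  refine HasCompactSupport.intro (isCompact_Icc (a := (-1 : ℝ)) (b := 1)) fun v hv => ?_
  refine bandMultiplier_eq_zero ?_
  by_contra h
  have := abs_lt.1 (not_le.1 h)
  exact hv ⟨this.1.le, this.2.le⟩

theorem integral_bandMultiplier_mul_exp (x : ℝ) :
    ∫ v, bandMultiplier v * Complex.exp (v * x * Complex.I) = bandKernel x := by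
  have hi : ∀ y : ℝ, Integrable fun v : ℝ => (triangle v : ℂ) * Complex.exp (v * y * Complex.I) := by
    intro y
    have hc := continuous_triangle
    refine Continuous.integrable_of_hasCompactSupport (by fun_prop) ?_
    refine HasCompactSupport.intro (isCompact_Icc (a := (-1 : ℝ)) (b := 1)) fun v hv => ?_
    rw [triangle_eq_zero, Complex.ofReal_zero, zero_mul]
    by_contra h
    have := abs_lt.1 (not_le.1 h)
    exact hv ⟨this.1.le, this.2.le⟩
  rw [bandKernel, Complex.ofReal_add, ← integral_triangle_mul_exp, ← integral_triangle_mul_exp,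
    ← integral_add (hi _) (hi _)]
  congr 1
  ext v
  have e : Complex.exp (v * ((x + Real.pi : ℝ) : ℂ) * Complex.I) =
      Complex.exp (v * Real.pi * Complex.I) * Complex.exp (v * x * Complex.I) := by
    rw [← Complex.exp_add]
    congr 1
    push_cast
    ring
  rw [bandMultiplier, e]
  ring

theorem fejer_nonneg (x : ℝ) : 0 ≤ fejer x := sq_nonneg _

theorem bandKernel_nonneg (x : ℝ) : 0 ≤ bandKernel x :=
  add_nonneg (fejer_nonneg _) (fejer_nonneg _)

theorem fejer_mul_sq (x : ℝ) : fejer x * x ^ 2 = 2 * (1 - Real.cos x) := by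
  by_cases hx : x = 0
  · simp [hx]
  · rw [fejer, Real.sinc_of_ne_zero (by simpa using hx), div_pow, Real.sin_sq_eq_half_sub,
      show 2 * (x / 2) = x by ring]
    field_simp

theorem fejer_le (x : ℝ) : fejer x ≤ 5 * (1 + x ^ 2)⁻¹ := by
  rw [← div_eq_mul_inv, le_div_iff₀ (by positivity), mul_add, fejer_mul_sq, mul_one]
  have h1 : fejer x ≤ 1 := by
    rw [fejer, ← sq_abs]
    exact pow_le_one₀ (abs_nonneg _) (Real.abs_sinc_le_one _)
  linarith [Real.neg_one_le_cos x]

/-- The reason for adding a translate by `π`: `fejer x * x² + fejer (x + π) * (x + π)² = 4`, since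
the two cosines cancel. The sum therefore never vanishes, although a single Fejér kernel does, and
it decays no faster than quadratically. -/
theorem le_bandKernel (x : ℝ) : 4 / (|x| + Real.pi) ^ 2 ≤ bandKernel x := by
  have hpi := Real.pi_pos
  have hx := abs_nonneg x
  rw [div_le_iff₀ (by positivity), bandKernel, add_mul]
  have h1 : fejer x * x ^ 2 ≤ fejer x * (|x| + Real.pi) ^ 2 := by
    refine mul_le_mul_of_nonneg_left ?_ (fejer_nonneg x)
    rw [← sq_abs x]; gcongr; linarith
  have h2 : fejer (x + Real.pi) * (x + Real.pi) ^ 2 ≤ fejer (x + Real.pi) * (|x| + Real.pi) ^ 2 := by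
    refine mul_le_mul_of_nonneg_left ?_ (fejer_nonneg _)
    rw [← sq_abs (x + Real.pi)]
    gcongr
    exact (abs_add_le _ _).trans (by rw [abs_of_pos hpi])
  rw [fejer_mul_sq] at h1 h2
  rw [Real.cos_add_pi] at h2
  linarith

theorem bandKernel_pos (x : ℝ) : 0 < bandKernel x :=
  lt_of_lt_of_le (by have := Real.pi_pos; positivity) (le_bandKernel x)

theorem integrable_bandKernel : Integrable bandKernel := by
  have h1 : Integrable fejer := by
    refine (integrable_inv_one_add_sq.const_mul 5).mono' continuous_fejer.aestronglyMeasurable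
      (ae_of_all _ fun x => ?_)
    rw [Real.norm_of_nonneg (fejer_nonneg x)]
    exact fejer_le x
  exact h1.add (h1.comp_add_right Real.pi)

theorem bandKernel_le (x : ℝ) : bandKernel x ≤ 2 := by
  have h1 : ∀ y, fejer y ≤ 1 := fun y => by
    rw [fejer, ← sq_abs]
    exact pow_le_one₀ (abs_nonneg _) (Real.abs_sinc_le_one _)
  unfold bandKernel
  linarith [h1 x, h1 (x + Real.pi)]

open FourierTransform in
/-- Fourier inversion for the kernel. -/
theorem integral_bandKernel_mul_exp (a : ℝ) :
    ∫ x, (bandKernel x : ℂ) * Complex.exp (a * x * Complex.I) =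
      2 * Real.pi * bandMultiplier (-a) := by
  have hpi := Real.pi_pos
  -- The library transform carries the phase `e ^ (-2πi v ξ)`, hence the rescaling by `-2π` and the
  -- evaluation of the inversion formula at `-a`.
  have hF : ∀ ξ : ℝ, 𝓕 bandMultiplier ξ = bandKernel ((-2 * Real.pi) * ξ) := by
    intro ξ
    rw [Real.fourier_real_eq_integral_exp_smul, ← integral_bandMultiplier_mul_exp]
    congr 1
    ext v
    rw [smul_eq_mul, mul_comm]
    congr 2
    push_cast
    ring
  have hintegr : Integrable (𝓕 bandMultiplier) := by
    have h1 := (integrable_bandKernel.comp_mul_left' (R := -2 * Real.pi)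
      (by simp [hpi.ne'])).ofReal (𝕜 := ℂ)
    refine h1.congr (ae_of_all _ fun ξ => ?_)
    exact (hF ξ).symm
  have hinv := congrFun (continuous_bandMultiplier.fourierInv_fourier_eq
    integrable_bandMultiplier hintegr) (-a)
  rw [Real.fourierInv_eq'] at hinv
  have h2 := Measure.integral_comp_mul_left
    (fun x : ℝ => (bandKernel x : ℂ) * Complex.exp (a * x * Complex.I)) (-2 * Real.pi)
  have h3 : ∫ ξ : ℝ, (bandKernel ((-2 * Real.pi) * ξ) : ℂ) *
      Complex.exp (a * ((-2 * Real.pi * ξ : ℝ) : ℂ) * Complex.I) = bandMultiplier (-a) := by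
    rw [← hinv]
    congr 1
    ext ξ
    rw [hF, smul_eq_mul, mul_comm]
    congr 2
    simp
    ring
  rw [h3] at h2
  rw [h2, abs_inv, abs_mul, abs_neg, abs_of_pos hpi, Complex.real_smul]
  generalize ∫ x, (bandKernel x : ℂ) * Complex.exp (a * x * Complex.I) = J
  have : (Real.pi : ℂ) ≠ 0 := by exact_mod_cast hpi.ne'
  norm_num
  field_simp

/-! ### Local limit theorem against band-limited and dominated test functions. -/

/-- The probability measure proportional to `bandKernel • μ`. -/
def bandMeasure (μ : Measure ℝ) : Measure ℝ :=
  μ.withDensity fun x => ENNReal.ofReal (bandKernel x / ∫ y, bandKernel y ∂μ)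

theorem integral_bandMeasure {E : Type*} [NormedAddCommGroup E] [NormedSpace ℝ E]
    (μ : Measure ℝ) (f : ℝ → E) :
    ∫ x, f x ∂bandMeasure μ = (∫ y, bandKernel y ∂μ)⁻¹ • ∫ x, bandKernel x • f x ∂μ := by
  have hI : 0 ≤ ∫ y, bandKernel y ∂μ := integral_nonneg bandKernel_nonneg
  rw [bandMeasure, integral_withDensity_eq_integral_toReal_smul
    ((continuous_bandKernel.measurable.div_const _).ennreal_ofReal)
    (ae_of_all _ fun x => ENNReal.ofReal_lt_top), ← integral_smul]
  congr 1
  ext x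
  rw [ENNReal.toReal_ofReal (div_nonneg (bandKernel_nonneg x) hI), smul_smul, div_eq_inv_mul]

theorem isProbabilityMeasure_bandMeasure {μ : Measure ℝ} (hμ : Integrable bandKernel μ)
    (h0 : 0 < ∫ y, bandKernel y ∂μ) : IsProbabilityMeasure (bandMeasure μ) := by
  constructor
  rw [bandMeasure, withDensity_apply _ MeasurableSet.univ, Measure.restrict_univ,
    ← ofReal_integral_eq_lintegral_ofReal (hμ.div_const _)
      (ae_of_all _ fun x => div_nonneg (bandKernel_nonneg x) h0.le),
    integral_div, div_self h0.ne', ENNReal.ofReal_one]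

theorem charFun_bandMeasure (μ : Measure ℝ) (a : ℝ) :
    charFun (bandMeasure μ) a = ((∫ y, bandKernel y ∂μ : ℝ) : ℂ)⁻¹ *
      ∫ x, (bandKernel x : ℂ) * Complex.exp (a * x * Complex.I) ∂μ := by
  rw [charFun_apply_real, integral_bandMeasure, Complex.real_smul, Complex.ofReal_inv]
  simp only [Complex.real_smul]

theorem integrable_bandKernel_finite (μ : Measure ℝ) [IsFiniteMeasure μ] :
    Integrable bandKernel μ :=
  Integrable.of_bound continuous_bandKernel.aestronglyMeasurable 2 (ae_of_all _ fun x => by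
    rw [Real.norm_of_nonneg (bandKernel_nonneg x)]; exact bandKernel_le x)

theorem integral_bandKernel_pos (μ : Measure ℝ) [IsProbabilityMeasure μ] :
    0 < ∫ y, bandKernel y ∂μ := by
  rw [integral_pos_iff_support_of_nonneg bandKernel_nonneg (integrable_bandKernel_finite μ)]
  have : Function.support bandKernel = univ := by
    ext x
    simp [(bandKernel_pos x).ne']
  rw [this]
  simp

/-- Parseval for the band-limited kernel. -/
theorem integral_bandKernel_mul_exp_eq (μ : Measure ℝ) [IsFiniteMeasure μ] (a : ℝ) :
    ∫ x, (bandKernel x : ℂ) * Complex.exp (a * x * Complex.I) ∂μ =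
      ∫ y, bandMultiplier (y - a) * charFun μ y := by
  have h1 : ∀ x : ℝ, (bandKernel x : ℂ) * Complex.exp (a * x * Complex.I) =
      ∫ y, bandMultiplier (y - a) * Complex.exp (y * x * Complex.I) := by
    intro x
    rw [← integral_bandMultiplier_mul_exp, ← integral_mul_const,
      ← integral_sub_right_eq_self _ a]
    congr 1
    ext y
    rw [mul_assoc, ← Complex.exp_add]
    congr 2
    push_cast
    ring
  simp_rw [h1]
  rw [integral_integral_swap]
  · congr 1
    ext y
    rw [charFun_apply_real, integral_const_mul]
  · have h2 : Integrable (fun y => bandMultiplier (y - a)) :=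
      integrable_bandMultiplier.comp_sub_right a
    have h3 : Integrable (fun p : ℝ × ℝ => (1 : ℂ) * bandMultiplier (p.2 - a)) (μ.prod volume) :=
      (integrable_const (1 : ℂ)).mul_prod h2
    refine h3.mono ?_ (ae_of_all _ fun p => ?_)
    · have := continuous_bandMultiplier
      refine Continuous.aestronglyMeasurable ?_
      unfold Function.uncurry
      fun_prop
    · simp only [Function.uncurry, norm_mul, one_mul]
      rw [← Complex.ofReal_mul, Complex.norm_exp_ofReal_mul_I, mul_one]

section Limit
variable {μ : ℕ → Measure ℝ} [∀ n, IsProbabilityMeasure (μ n)] {T : ℕ → ℝ}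

/-- By Parseval, with `y = τ / T n`, the integrand is supported in `|y - a| ≤ 1`, so the
characteristic function is needed only on `|y| ≤ 1 + |a|`. There the Gaussian bound dominates, and
the limit is the Gaussian integral times the multiplier at `-a`. -/
theorem tendsto_integral_bandKernel_mul_exp (hT : Tendsto T atTop atTop)
    (hpt : ∀ τ : ℝ, Tendsto (fun n => charFun (μ n) (τ / T n)) atTop
      (𝓝 (Complex.exp (-(τ ^ 2 / 2 : ℝ)))))
    (hdom : ∀ Δ : ℝ, 0 < Δ → ∃ c : ℝ, 0 < c ∧ ∀ᶠ n in atTop, ∀ y : ℝ, |y| ≤ Δ →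
      ‖charFun (μ n) y‖ ≤ Real.exp (-c * (T n * y) ^ 2)) (a : ℝ) :
    Tendsto (fun n => (T n : ℂ) * ∫ x, (bandKernel x : ℂ) * Complex.exp (a * x * Complex.I) ∂μ n)
      atTop (𝓝 (Real.sqrt (2 * Real.pi) * bandMultiplier (-a))) := by
  obtain ⟨c, hc, hcb⟩ := hdom (1 + |a|) (by positivity)
  have hgauss : ∫ τ : ℝ, bandMultiplier (-a) * Complex.exp (-(τ ^ 2 / 2 : ℝ)) =
      Real.sqrt (2 * Real.pi) * bandMultiplier (-a) := by
    rw [integral_const_mul, mul_comm]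
    congr 1
    have h := integral_gaussian (1 / 2)
    rw [show Real.pi / (1 / 2) = 2 * Real.pi by ring] at h
    rw [← h, ← integral_complex_ofReal]
    congr 1
    ext τ
    rw [Complex.ofReal_exp]
    congr 1
    push_cast
    ring
  have key : Tendsto (fun n => ∫ τ : ℝ, bandMultiplier (τ / T n - a) * charFun (μ n) (τ / T n))
      atTop (𝓝 (∫ τ : ℝ, bandMultiplier (-a) * Complex.exp (-(τ ^ 2 / 2 : ℝ)))) := by
    refine tendsto_integral_filter_of_dominated_convergence
      (fun τ => 2 * Real.exp (-c * τ ^ 2)) ?_ ?_ ?_ ?_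
    · refine Eventually.of_forall fun n => Continuous.aestronglyMeasurable ?_
      have h1 := continuous_bandMultiplier
      have h2 : Continuous (charFun (μ n)) := continuous_charFun
      fun_prop
    · filter_upwards [hcb, hT.eventually_gt_atTop 0] with n hn hTn
      refine ae_of_all _ fun τ => ?_
      rw [norm_mul]
      by_cases h : |τ / T n| ≤ 1 + |a|
      · have h1 := hn _ h
        rw [mul_div_cancel₀ _ hTn.ne'] at h1
        exact mul_le_mul (norm_bandMultiplier_le _) h1 (norm_nonneg _) (by norm_num)
      · have h1 : 1 ≤ |τ / T n - a| := by
          have := abs_sub_abs_le_abs_sub (τ / T n) a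
          linarith
        rw [bandMultiplier_eq_zero h1, norm_zero, zero_mul]
        positivity
    · exact (integrable_exp_neg_mul_sq hc).const_mul 2
    · refine ae_of_all _ fun τ => ?_
      refine Tendsto.mul ?_ (hpt τ)
      have h1 : Tendsto (fun n => τ / T n - a) atTop (𝓝 (0 - a)) :=
        (tendsto_const_nhds.div_atTop hT).sub_const a
      rw [zero_sub] at h1
      exact (continuous_bandMultiplier.tendsto _).comp h1
  rw [hgauss] at key
  refine key.congr' ?_
  filter_upwards [hT.eventually_gt_atTop 0] with n hTn
  rw [integral_bandKernel_mul_exp_eq]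
  have := Measure.integral_comp_div (fun y => bandMultiplier (y - a) * charFun (μ n) y) (T n)
  rw [this, abs_of_pos hTn, Complex.real_smul]

theorem integral_bandKernel_volume : ∫ x, bandKernel x = 4 * Real.pi := by
  have h := integral_bandKernel_mul_exp 0
  simp only [Complex.ofReal_zero, zero_mul, Complex.exp_zero, mul_one, neg_zero,
    bandMultiplier_zero] at h
  rw [integral_complex_ofReal] at h
  have h2 : ((∫ x, bandKernel x : ℝ) : ℂ) = ((4 * Real.pi : ℝ) : ℂ) := by
    rw [h]; push_cast; ring
  exact_mod_cast h2

/-- The assertion is that `T n • μ n` behaves like Lebesgue measure divided by `√(2π)`. Both have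
mass issues as they stand; multiplied by `bandKernel` and normalised they are probability measures,
so weak convergence applies to the bounded continuous function `h / bandKernel`. -/
theorem tendsto_integral_of_le_bandKernel (hT : Tendsto T atTop atTop)
    (hpt : ∀ τ : ℝ, Tendsto (fun n => charFun (μ n) (τ / T n)) atTop
      (𝓝 (Complex.exp (-(τ ^ 2 / 2 : ℝ)))))
    (hdom : ∀ Δ : ℝ, 0 < Δ → ∃ c : ℝ, 0 < c ∧ ∀ᶠ n in atTop, ∀ y : ℝ, |y| ≤ Δ →
      ‖charFun (μ n) y‖ ≤ Real.exp (-c * (T n * y) ^ 2))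
    {h : ℝ → ℝ} (hh : Continuous h) {L : ℝ} (hL : ∀ x, |h x| ≤ L * bandKernel x) :
    Tendsto (fun n => T n * ∫ x, h x ∂μ n) atTop
      (𝓝 ((Real.sqrt (2 * Real.pi))⁻¹ * ∫ x, h x)) := by
  have hpi := Real.pi_pos
  have hexp := tendsto_integral_bandKernel_mul_exp hT hpt hdom
  have hvol : 0 < ∫ x, bandKernel x := by rw [integral_bandKernel_volume]; positivity
  let ν : ℕ → ProbabilityMeasure ℝ := fun n => ⟨bandMeasure (μ n),
    isProbabilityMeasure_bandMeasure (integrable_bandKernel_finite _) (integral_bandKernel_pos _)⟩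
  let ν₀ : ProbabilityMeasure ℝ := ⟨bandMeasure volume,
    isProbabilityMeasure_bandMeasure integrable_bandKernel hvol⟩
  have hZc : Tendsto (fun n => ((T n * ∫ x, bandKernel x ∂μ n : ℝ) : ℂ)) atTop
      (𝓝 ((2 * Real.sqrt (2 * Real.pi) : ℝ) : ℂ)) := by
    have h0 := hexp 0
    simp only [Complex.ofReal_zero, zero_mul, Complex.exp_zero, mul_one, neg_zero,
      bandMultiplier_zero, integral_complex_ofReal] at h0
    refine (h0.congr fun n => ?_).trans (le_of_eq ?_)
    · push_cast; rfl
    · congr 1; push_cast; ring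
  have hZ : Tendsto (fun n => T n * ∫ x, bandKernel x ∂μ n) atTop
      (𝓝 (2 * Real.sqrt (2 * Real.pi))) := by
    have := (Complex.continuous_re.tendsto _).comp hZc
    simpa only [Function.comp_def, Complex.ofReal_re] using this
  have hsq : 0 < Real.sqrt (2 * Real.pi) := Real.sqrt_pos.2 (by positivity)
  -- Lévy's continuity theorem. The factor `T n` cancels between the weighted characteristic
  -- function and the normalising constant.
  have hweak : Tendsto ν atTop (𝓝 ν₀) := by
    refine ProbabilityMeasure.tendsto_of_tendsto_charFun fun a => ?_
    simp only [ν, ν₀, ProbabilityMeasure.coe_mk]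
    rw [charFun_bandMeasure, integral_bandKernel_volume, integral_bandKernel_mul_exp]
    have h1 := (hexp a).div hZc (by exact_mod_cast (by positivity))
    refine (h1.congr' ?_).trans (le_of_eq ?_)
    · filter_upwards [hT.eventually_gt_atTop 0] with n hTn
      simp only [Pi.div_apply]
      rw [charFun_bandMeasure]
      push_cast
      have hT0 : (T n : ℂ) ≠ 0 := by exact_mod_cast hTn.ne'
      rw [mul_div_mul_left _ _ hT0, div_eq_inv_mul]
    · congr 1
      have e1 : ((Real.sqrt (2 * Real.pi) : ℝ) : ℂ) ≠ 0 := by exact_mod_cast hsq.ne'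
      have e2 : (Real.pi : ℂ) ≠ 0 := by exact_mod_cast hpi.ne'
      push_cast
      field_simp
      norm_num
  have hf : Continuous fun x => h x / bandKernel x :=
    hh.div continuous_bandKernel fun x => (bandKernel_pos x).ne'
  let f : BoundedContinuousFunction ℝ ℝ := BoundedContinuousFunction.ofNormedAddCommGroup
    (fun x => h x / bandKernel x) hf L fun x => by
      rw [norm_div, Real.norm_eq_abs, Real.norm_of_nonneg (bandKernel_nonneg x),
        div_le_iff₀ (bandKernel_pos x)]
      exact hL x
  have hfe : ∀ m : Measure ℝ, ∫ x, f x ∂bandMeasure m =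
      (∫ x, bandKernel x ∂m)⁻¹ * ∫ x, h x ∂m := by
    intro m
    rw [integral_bandMeasure, smul_eq_mul]
    congr 2
    ext x
    simp only [f, BoundedContinuousFunction.coe_ofNormedAddCommGroup, smul_eq_mul]
    rw [mul_div_cancel₀ _ (bandKernel_pos x).ne']
  have hlim := (ProbabilityMeasure.tendsto_iff_forall_integral_tendsto.1 hweak) f
  simp only [ν, ν₀, ProbabilityMeasure.coe_mk, hfe] at hlim
  rw [integral_bandKernel_volume] at hlim
  refine ((hZ.mul hlim).congr fun n => ?_).trans (le_of_eq ?_)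
  · have := (integral_bandKernel_pos (μ n)).ne'
    field_simp
  · congr 1
    have : Real.sqrt (2 * Real.pi) ^ 2 = 2 * Real.pi := Real.sq_sqrt (by positivity)
    field_simp
    rw [this]
    ring
end Limit

/-! ### Sandwiching the discontinuous test function. -/

/-- A continuous cut-off of `e ^ x` to the negative axis. -/
def expCutoff (δ x : ℝ) : ℝ := Real.exp x * max 0 (min 1 (1 - x / δ))

theorem continuous_expCutoff (δ : ℝ) : Continuous (expCutoff δ) := by
  unfold expCutoff
  fun_prop

theorem expCutoff_nonneg (δ x : ℝ) : 0 ≤ expCutoff δ x :=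
  mul_nonneg (Real.exp_pos x).le (le_max_left _ _)

theorem indicator_exp_le_expCutoff {δ : ℝ} (hδ : 0 < δ) (x : ℝ) :
    (Iic 0).indicator Real.exp x ≤ expCutoff δ x := by
  by_cases hx : x ∈ Iic (0 : ℝ)
  · rw [indicator_of_mem hx, expCutoff, min_eq_left, max_eq_right zero_le_one, mul_one]
    have : x / δ ≤ 0 := div_nonpos_of_nonpos_of_nonneg hx hδ.le
    linarith
  · rw [indicator_of_notMem hx]
    exact expCutoff_nonneg δ x

theorem expCutoff_le_indicator {δ : ℝ} (hδ : 0 < δ) (x : ℝ) :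
    expCutoff δ x ≤ (Iic δ).indicator Real.exp x := by
  by_cases hx : x ∈ Iic δ
  · rw [indicator_of_mem hx, expCutoff]
    exact mul_le_of_le_one_right (Real.exp_pos x).le (max_le zero_le_one (min_le_left _ _))
  · rw [indicator_of_notMem hx, expCutoff, max_eq_left, mul_zero]
    refine (min_le_right _ _).trans ?_
    have : 1 ≤ x / δ := (one_le_div hδ).2 (not_le.1 hx).le
    linarith

/-- Exponential decay on the left beats the quadratic decay of the kernel. The half-line ends at 1
to leave room for all cut-offs with `δ ≤ 1`; the constant is generous. -/
theorem exists_indicator_exp_le_bandKernel :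
    ∃ L : ℝ, ∀ x, (Iic 1).indicator Real.exp x ≤ L * bandKernel x := by
  refine ⟨100, fun x => ?_⟩
  by_cases hx : x ∈ Iic (1 : ℝ)
  · rw [indicator_of_mem hx]
    have hx : x ≤ 1 := hx
    have hpi := Real.pi_pos
    have hpi4 := Real.pi_lt_four
    have h1 := le_bandKernel x
    have h2 : Real.exp x ≤ 100 * (4 / (|x| + Real.pi) ^ 2) := by
      rw [← mul_div_assoc, le_div_iff₀ (by positivity)]
      have hax := abs_nonneg x
      have h3 : (|x| + Real.pi) ^ 2 ≤ 2 * |x| ^ 2 + 32 := by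
        nlinarith [sq_nonneg (|x| - Real.pi)]
      rcases le_total x 0 with h | h
      · have h4 := Real.quadratic_le_exp_of_nonneg (x := |x|) hax
        have h5 : Real.exp x * Real.exp |x| = 1 := by
          rw [abs_of_nonpos h, ← Real.exp_add]; simp
        have h6 : (|x| + Real.pi) ^ 2 ≤ 100 * Real.exp |x| := by nlinarith
        have := mul_le_mul_of_nonneg_left h6 (Real.exp_pos x).le
        nlinarith
      · have h4 : Real.exp x ≤ 3 :=
          (Real.exp_le_exp.2 hx).trans (by linarith [Real.exp_one_lt_d9])
        have h5 : |x| ^ 2 ≤ 1 := by rw [abs_of_nonneg h]; nlinarith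
        have h6 : (|x| + Real.pi) ^ 2 ≤ 34 := by linarith
        calc Real.exp x * (|x| + Real.pi) ^ 2 ≤ 3 * 34 :=
            mul_le_mul h4 h6 (sq_nonneg _) (by norm_num)
          _ ≤ 100 * 4 := by norm_num
    linarith
  · rw [indicator_of_notMem hx]
    have := bandKernel_pos x
    positivity

theorem integral_indicator_Iic_exp (δ : ℝ) :
    Integrable ((Iic δ).indicator Real.exp) ∧ ∫ x, (Iic δ).indicator Real.exp x = Real.exp δ :=
  ⟨(integrable_indicator_iff measurableSet_Iic).2 (integrableOn_exp_Iic δ), by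
    rw [integral_indicator measurableSet_Iic, integral_exp_Iic]⟩

theorem integral_expCutoff_bounds {δ : ℝ} (hδ : 0 < δ) :
    Integrable (expCutoff δ) ∧ 1 ≤ ∫ x, expCutoff δ x ∧ ∫ x, expCutoff δ x ≤ Real.exp δ := by
  obtain ⟨i0, v0⟩ := integral_indicator_Iic_exp 0
  obtain ⟨i1, v1⟩ := integral_indicator_Iic_exp δ
  have hi : Integrable (expCutoff δ) := by
    refine i1.mono' (continuous_expCutoff δ).aestronglyMeasurable (ae_of_all _ fun x => ?_)
    rw [Real.norm_of_nonneg (expCutoff_nonneg δ x)]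
    exact expCutoff_le_indicator hδ x
  refine ⟨hi, ?_, ?_⟩
  · rw [← Real.exp_zero, ← v0]
    exact integral_mono i0 hi (indicator_exp_le_expCutoff hδ)
  · rw [← v1]
    exact integral_mono hi i1 (expCutoff_le_indicator hδ)

/-- The local limit theorem at unit scale, tested against `e ^ x` on the negative axis. -/
theorem tendsto_integral_indicator_exp {μ : ℕ → Measure ℝ} [∀ n, IsProbabilityMeasure (μ n)]
    {T : ℕ → ℝ} (hT : Tendsto T atTop atTop)
    (hpt : ∀ τ : ℝ, Tendsto (fun n => charFun (μ n) (τ / T n)) atTop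
      (𝓝 (Complex.exp (-(τ ^ 2 / 2 : ℝ)))))
    (hdom : ∀ Δ : ℝ, 0 < Δ → ∃ c : ℝ, 0 < c ∧ ∀ᶠ n in atTop, ∀ y : ℝ, |y| ≤ Δ →
      ‖charFun (μ n) y‖ ≤ Real.exp (-c * (T n * y) ^ 2)) :
    Tendsto (fun n => T n * ∫ x, (Iic 0).indicator Real.exp x ∂μ n) atTop
      (𝓝 (Real.sqrt (2 * Real.pi))⁻¹) := by
  obtain ⟨L, hL⟩ := exists_indicator_exp_le_bandKernel
  set q := (Real.sqrt (2 * Real.pi))⁻¹ with hq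
  have hq0 : 0 < q := inv_pos.2 (Real.sqrt_pos.2 (by have := Real.pi_pos; positivity))
  have hupper : ∀ δ : ℝ, 0 < δ → δ ≤ 1 → ∀ x, |expCutoff δ x| ≤ L * bandKernel x := by
    intro δ hδ hδ1 x
    rw [abs_of_nonneg (expCutoff_nonneg δ x)]
    refine (expCutoff_le_indicator hδ x).trans ((indicator_le_indicator_of_subset
      (Iic_subset_Iic.2 hδ1) (fun x => (Real.exp_pos x).le) x).trans (hL x))
  -- The lower approximant is the upper one moved left by `δ`; since `expCutoff δ` lives on `x ≤ δ`,
  -- the translate lives on `x ≤ 0`, and `e ^ (-δ)` undoes the change of `e ^ x`.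
  have hlower_le : ∀ δ : ℝ, 0 < δ → ∀ x,
      Real.exp (-δ) * expCutoff δ (x + δ) ≤ (Iic 0).indicator Real.exp x := by
    intro δ hδ x
    have h1 := mul_le_mul_of_nonneg_left (expCutoff_le_indicator hδ (x + δ)) (Real.exp_pos (-δ)).le
    refine h1.trans (le_of_eq ?_)
    by_cases hx : x ≤ 0
    · rw [indicator_of_mem (show x + δ ∈ Iic δ by simpa using hx),
        indicator_of_mem (show x ∈ Iic (0 : ℝ) from hx), ← Real.exp_add]
      congr 1; ring
    · rw [indicator_of_notMem (show x + δ ∉ Iic δ by simpa using hx),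
        indicator_of_notMem (show x ∉ Iic (0 : ℝ) from hx), mul_zero]
  have hbdd : ∀ n, Integrable ((Iic 0).indicator Real.exp) (μ n) := fun n => by
    refine Integrable.of_bound (Real.measurable_exp.indicator measurableSet_Iic).aestronglyMeasurable
      1 (ae_of_all _ fun x => ?_)
    rw [norm_indicator_eq_indicator_norm]
    refine indicator_le' (fun x hx => ?_) (fun x _ => zero_le_one) x
    rw [Real.norm_of_nonneg (Real.exp_pos x).le]
    exact Real.exp_le_one_iff.2 hx
  have hcutint : ∀ n (δ : ℝ), 0 < δ → Integrable (expCutoff δ) (μ n) := fun n δ hδ => by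
    refine Integrable.of_bound (continuous_expCutoff δ).aestronglyMeasurable (Real.exp δ)
      (ae_of_all _ fun x => ?_)
    rw [Real.norm_of_nonneg (expCutoff_nonneg δ x)]
    refine (expCutoff_le_indicator hδ x).trans (indicator_le' (fun x hx => ?_)
      (fun x _ => (Real.exp_pos δ).le) x)
    exact Real.exp_le_exp.2 hx
  have hcutint' : ∀ n (δ : ℝ), 0 < δ →
      Integrable (fun x => Real.exp (-δ) * expCutoff δ (x + δ)) (μ n) := fun n δ hδ => by
    refine (hbdd n).mono' (Continuous.aestronglyMeasurable ?_) (ae_of_all _ fun x => ?_)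
    · have := continuous_expCutoff δ
      fun_prop
    · rw [Real.norm_of_nonneg (mul_nonneg (Real.exp_pos _).le (expCutoff_nonneg _ _))]
      exact hlower_le δ hδ x
  have hexp_lim : Tendsto (fun δ : ℝ => q * Real.exp δ) (𝓝[>] 0) (𝓝 q) := by
    have : Tendsto (fun δ : ℝ => q * Real.exp δ) (𝓝 0) (𝓝 (q * Real.exp 0)) :=
      (continuous_const.mul Real.continuous_exp).tendsto 0
    rw [Real.exp_zero, mul_one] at this
    exact this.mono_left nhdsWithin_le_nhds
  have hexp_lim' : Tendsto (fun δ : ℝ => q * Real.exp (-δ)) (𝓝[>] 0) (𝓝 q) := by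
    have : Tendsto (fun δ : ℝ => q * Real.exp (-δ)) (𝓝 0) (𝓝 (q * Real.exp (-0))) :=
      (continuous_const.mul (Real.continuous_exp.comp continuous_neg)).tendsto 0
    rw [neg_zero, Real.exp_zero, mul_one] at this
    exact this.mono_left nhdsWithin_le_nhds
  have hsmall : ∀ᶠ δ : ℝ in 𝓝[>] 0, 0 < δ ∧ δ ≤ 1 := Ioc_mem_nhdsGT one_pos
  rw [tendsto_order]
  constructor
  · intro m hm
    obtain ⟨δ, hδm, hδ, hδ1⟩ := ((hexp_lim'.eventually_const_lt hm).and hsmall).exists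
    have hLb : ∀ x, |Real.exp (-δ) * expCutoff δ (x + δ)| ≤ L * bandKernel x := by
      intro x
      rw [abs_of_nonneg (mul_nonneg (Real.exp_pos _).le (expCutoff_nonneg _ _))]
      exact (hlower_le δ hδ x).trans ((indicator_le_indicator_of_subset
        (Iic_subset_Iic.2 zero_le_one) (fun x => (Real.exp_pos x).le) x).trans (hL x))
    have hcont : Continuous fun x => Real.exp (-δ) * expCutoff δ (x + δ) := by
      have := continuous_expCutoff δ
      fun_prop
    have hlim := tendsto_integral_of_le_bandKernel hT hpt hdom hcont hLb
    have hval : q * Real.exp (-δ) ≤ q * ∫ x, Real.exp (-δ) * expCutoff δ (x + δ) := by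
      refine mul_le_mul_of_nonneg_left ?_ hq0.le
      rw [integral_const_mul, integral_add_right_eq_self (expCutoff δ)]
      exact le_mul_of_one_le_right (Real.exp_pos _).le (integral_expCutoff_bounds hδ).2.1
    filter_upwards [hlim.eventually_const_lt (hδm.trans_le hval), hT.eventually_gt_atTop 0]
      with n hn hTn
    exact hn.trans_le (mul_le_mul_of_nonneg_left
      (integral_mono (hcutint' n δ hδ) (hbdd n) (hlower_le δ hδ)) hTn.le)
  · intro m hm
    obtain ⟨δ, hδm, hδ, hδ1⟩ := ((hexp_lim.eventually_lt_const hm).and hsmall).exists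
    have hlim := tendsto_integral_of_le_bandKernel hT hpt hdom (continuous_expCutoff δ)
      (hupper δ hδ hδ1)
    have hval : q * ∫ x, expCutoff δ x ≤ q * Real.exp δ :=
      mul_le_mul_of_nonneg_left (integral_expCutoff_bounds hδ).2.2 hq0.le
    filter_upwards [hlim.eventually_lt_const (hval.trans_lt hδm), hT.eventually_gt_atTop 0]
      with n hn hTn
    exact (mul_le_mul_of_nonneg_left (integral_mono (hbdd n) (hcutint n δ hδ)
      (indicator_exp_le_expCutoff hδ)) hTn.le).trans_lt hn

/-! ### Expansion of the log generating function around the saddle point. -/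

theorem tendsto_one_sub_rpow_second_order (α : ℝ) :
    Tendsto (fun x : ℝ => ((1 - x) ^ (-α) - 1 - α * x) / x ^ 2) (𝓝[≠] 0)
      (𝓝 (α * (α + 1) / 2)) := by
  have hlt : ∀ᶠ x : ℝ in 𝓝[≠] 0, x < 1 := nhdsWithin_le_nhds (Iio_mem_nhds one_pos)
  have hd : ∀ (r x : ℝ), x < 1 →
      HasDerivAt (fun x : ℝ => (1 - x) ^ r) (-(r * (1 - x) ^ (r - 1))) x := by
    intro r x hx
    have := ((hasDerivAt_id x).const_sub 1).rpow_const (p := r) (Or.inl (by simp; linarith))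
    refine this.congr_deriv ?_
    simp
  refine HasDerivAt.lhopital_zero_nhdsNE
    (f' := fun x => α * (1 - x) ^ (-α - 1) - α) (g' := fun x => 2 * x) ?_ ?_ ?_ ?_ ?_ ?_
  · filter_upwards [hlt] with x hx
    refine (((hd (-α) x hx).sub_const 1).fun_sub ((hasDerivAt_id x).const_mul α)).congr_deriv ?_
    ring
  · filter_upwards with x
    simpa using hasDerivAt_pow 2 x
  · filter_upwards [self_mem_nhdsWithin] with x hx
    exact mul_ne_zero two_ne_zero hx
  · have h : ContinuousAt (fun x : ℝ => (1 - x) ^ (-α) - 1 - α * x) 0 :=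
      (((hd (-α) 0 one_pos).continuousAt).sub continuousAt_const).sub (by fun_prop)
    have := h.tendsto
    simp only [sub_zero, Real.one_rpow, sub_self, mul_zero] at this
    exact this.mono_left nhdsWithin_le_nhds
  · have : Tendsto (fun x : ℝ => x ^ 2) (𝓝 0) (𝓝 (0 ^ 2)) := (continuous_pow 2).tendsto 0
    rw [zero_pow two_ne_zero] at this
    exact this.mono_left nhdsWithin_le_nhds
  · have h := (((hd (-α - 1) 0 one_pos).const_mul (α / 2))).tendsto_slope_zero
    simp only [zero_add, sub_zero, Real.one_rpow, smul_eq_mul, mul_one] at h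
    refine (h.congr' ?_).trans (le_of_eq ?_)
    · filter_upwards [self_mem_nhdsWithin] with x hx
      have hx0 : x ≠ 0 := hx
      field_simp
    · congr 1; ring

theorem tendsto_log_one_sub_of_tendsto_zero {κ : Type*} {l : Filter κ} {x : κ → ℝ}
    (hx : Tendsto x l (𝓝 0)) :
    Tendsto (fun i => Real.log (1 - x i)) l (𝓝 0) := by
  have h : Tendsto (fun i => 1 - x i) l (𝓝 1) := by simpa using hx.const_sub 1
  simpa using h.log one_ne_zero

theorem abs_log_one_sub_le {x : ℝ} (hx : |x| ≤ 1 / 2) : |Real.log (1 - x)| ≤ 2 * |x| := by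
  obtain ⟨h1, h2⟩ := abs_le.1 hx
  have h0 : 0 < 1 - x := by linarith
  rw [abs_le]
  have hup := Real.log_le_sub_one_of_pos h0
  have hlow := Real.one_sub_inv_le_log_of_pos h0
  have h3 : 1 - (1 - x)⁻¹ = -x / (1 - x) := by field_simp; ring
  rw [h3] at hlow
  constructor
  · refine le_trans ?_ hlow
    rw [le_div_iff₀ h0]
    rcases abs_cases x with ⟨h, _⟩ | ⟨h, _⟩ <;> rw [h] <;> nlinarith
  · rcases abs_cases x with ⟨h, _⟩ | ⟨h, _⟩ <;> rw [h] <;> linarith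

/-- Second order expansion of the logarithm of the generating function around a point. -/
theorem tendsto_expansion_sub {L : ℝ → ℝ} {a α B C D : ℝ} (ha : 0 < a) (hα : 0 < α)
    (hL : Tendsto (fun σ => L σ - (a * σ ^ (-α) + B * Real.log σ ^ 2 - C * Real.log σ + D))
      (𝓝[>] 0) (𝓝 0)) {τ : ℝ} (hτ : τ ≠ 0) {T : ℝ → ℝ}
    (hT : ∀ σ, 0 < σ → T σ = Real.sqrt (α * (α + 1) * a * σ ^ (-α))) :
    Tendsto (fun σ => L (σ - τ * (σ / T σ)) - L σ - σ * (a * α * σ ^ (-α - 1)) / T σ * τ)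
      (𝓝[>] 0) (𝓝 (τ ^ 2 / 2)) := by
  have hpos : ∀ᶠ σ : ℝ in 𝓝[>] 0, 0 < σ := self_mem_nhdsWithin
  have hid : Tendsto (fun σ : ℝ => σ) (𝓝[>] 0) (𝓝 0) := nhdsWithin_le_nhds
  set k := α * (α + 1) * a with hk
  have hk0 : 0 < k := by positivity
  have hT0 : ∀ σ, 0 < σ → 0 < T σ := fun σ hσ => by rw [hT σ hσ]; positivity
  have hT2 : ∀ σ, 0 < σ → T σ ^ 2 = k * σ ^ (-α) := fun σ hσ => by
    rw [hT σ hσ, Real.sq_sqrt (by positivity)]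
  -- The relative shift `τ / T` is of order `σ ^ (α/2)`, a positive power, so it tends to 0 even
  -- after multiplication by `log σ`; hence the logarithmic terms do not affect the limit.
  have hη : ∀ σ, 0 < σ → 1 / T σ = (Real.sqrt k)⁻¹ * σ ^ (α / 2) := fun σ hσ => by
    rw [hT σ hσ, Real.sqrt_mul hk0.le, Real.sqrt_eq_rpow (σ ^ (-α)), ← Real.rpow_mul hσ.le,
      one_div, mul_inv, ← Real.rpow_neg hσ.le]
    congr 2; ring
  have hη0 : Tendsto (fun σ => 1 / T σ) (𝓝[>] 0) (𝓝 0) := by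
    have h1 : Tendsto (fun σ : ℝ => (Real.sqrt k)⁻¹ * σ ^ (α / 2)) (𝓝[>] 0) (𝓝 0) := by
      have := (Real.continuousAt_rpow_const 0 (α / 2) (Or.inr (by positivity))).tendsto
      rw [Real.zero_rpow (by positivity)] at this
      simpa using (this.mono_left nhdsWithin_le_nhds).const_mul (Real.sqrt k)⁻¹
    refine h1.congr' ?_
    filter_upwards [hpos] with σ hσ
    exact (hη σ hσ).symm
  have hx0 : Tendsto (fun σ => τ / T σ) (𝓝[>] 0) (𝓝 0) := by
    have := hη0.const_mul τ
    simp only [mul_one_div, mul_zero] at this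
    exact this
  have hxlog : Tendsto (fun σ => Real.log σ * (τ / T σ)) (𝓝[>] 0) (𝓝 0) := by
    have h1 := (tendsto_log_mul_rpow_nhdsGT_zero (r := α / 2) (by positivity)).const_mul
      (τ * (Real.sqrt k)⁻¹)
    rw [mul_zero] at h1
    refine h1.congr' ?_
    filter_upwards [hpos] with σ hσ
    rw [show τ / T σ = τ * (1 / T σ) by ring, hη σ hσ]
    ring
  have hxsmall : ∀ᶠ σ in 𝓝[>] 0, |τ / T σ| ≤ 1 / 2 := by
    have := hx0.eventually (Metric.closedBall_mem_nhds 0 (by norm_num : (0 : ℝ) < 1 / 2))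
    filter_upwards [this] with σ hσ
    rwa [dist_zero_right, Real.norm_eq_abs] at hσ
  have hl1 := tendsto_log_one_sub_of_tendsto_zero hx0
  have hl2 : Tendsto (fun σ => Real.log σ * Real.log (1 - τ / T σ)) (𝓝[>] 0) (𝓝 0) := by
    have h1 : Tendsto (fun σ => 2 * |Real.log σ * (τ / T σ)|) (𝓝[>] 0) (𝓝 0) := by
      simpa using (hxlog.abs).const_mul 2
    refine squeeze_zero_norm' ?_ h1
    filter_upwards [hxsmall] with σ hσ
    rw [norm_mul, Real.norm_eq_abs, Real.norm_eq_abs, abs_mul]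
    have := mul_le_mul_of_nonneg_left (abs_log_one_sub_le hσ) (abs_nonneg (Real.log σ))
    linarith
  have hshift : Tendsto (fun σ => σ - τ * (σ / T σ)) (𝓝[>] 0) (𝓝[>] 0) := by
    refine tendsto_nhdsWithin_of_tendsto_nhds_of_eventually_within _ ?_ ?_
    · have := hid.sub (hid.mul hx0)
      simp only [mul_zero, sub_zero] at this
      refine this.congr fun σ => by ring
    · filter_upwards [hpos, hxsmall] with σ hσ h
      have h2 := (abs_le.1 h).2
      have : σ - τ * (σ / T σ) = σ * (1 - τ / T σ) := by ring
      rw [mem_Ioi, this]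
      exact mul_pos hσ (by linarith)
  have hxne : Tendsto (fun σ => τ / T σ) (𝓝[>] 0) (𝓝[≠] 0) := by
    refine tendsto_nhdsWithin_of_tendsto_nhds_of_eventually_within _ hx0 ?_
    filter_upwards [hpos] with σ hσ
    exact div_ne_zero hτ (hT0 σ hσ).ne'
  -- With `x = τ / T` and `T² = α (α+1) a σ ^ (-α)`, the quantity `a σ ^ (-α) ((1 - x) ^ (-α) - 1 -
  -- α x)` is this constant times the second order quotient, and its limit is `τ² / 2`.
  have hmain := ((tendsto_one_sub_rpow_second_order α).comp hxne).const_mul (τ ^ 2 / (α * (α + 1)))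
  have htot := (((hL.comp hshift).sub hL).add hmain).add
    (((hl2.const_mul (2 * B)).add ((hl1.pow 2).const_mul B)).sub (hl1.const_mul C))
  refine (htot.congr' ?_).trans (le_of_eq ?_)
  · filter_upwards [hpos, hxsmall] with σ hσ h
    have h2 := (abs_le.1 h).2
    have h1x : 0 < 1 - τ / T σ := by linarith
    have e : σ - τ * (σ / T σ) = σ * (1 - τ / T σ) := by ring
    have hTσ := (hT0 σ hσ).ne'
    simp only [Function.comp]
    rw [e, Real.mul_rpow hσ.le h1x.le, Real.log_mul hσ.ne' h1x.ne']
    have e2 : σ * (a * α * σ ^ (-α - 1)) = a * α * σ ^ (-α) := by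
      rw [Real.rpow_sub_one hσ.ne']; field_simp
    have e3 : a * σ ^ (-α) = T σ ^ 2 / (α * (α + 1)) := by
      rw [hT2 σ hσ, hk]; field_simp
    have e4 : σ * (a * α * σ ^ (-α - 1)) = α * (T σ ^ 2 / (α * (α + 1))) := by
      rw [e2, ← e3]; ring
    rw [e4, ← mul_assoc a, e3]
    field_simp
    ring
  · congr 1
    field_simp
    ring

/-! ### Many `lam k` of size `1/σ`, and the Gaussian bound. -/

/-- Dividing by `e` lowers `log⁺` by at most 1. If `θ x > e`, the term `log⁺ (θ x)` pays for that 1;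
otherwise the indicator does. Summed over `x = u / lam k`, this extracts a count from the integrated
function `logCount` without differentiating its asymptotics. -/
theorem posLog_le_add_ite (x θ : ℝ) :
    Real.posLog x ≤ Real.posLog (Real.exp (-1) * x) + Real.posLog (θ * x) +
      if θ * x ≤ Real.exp 1 then 1 else 0 := by
  have h1 : Real.posLog x ≤ Real.posLog (Real.exp (-1) * x) + 1 := by
    have h := Real.posLog_mul (x := Real.exp 1) (y := Real.exp (-1) * x)
    rw [← mul_assoc, ← Real.exp_add, add_neg_cancel, Real.exp_zero, one_mul] at h
    have h2 : Real.posLog (Real.exp 1) = 1 := by simp [Real.posLog]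
    linarith
  split_ifs with h
  · have := Real.posLog_nonneg (x := θ * x)
    linarith
  · have h2 : 1 ≤ Real.posLog (θ * x) := by
      have h3 : Real.log (Real.exp 1) ≤ Real.log (θ * x) :=
        Real.log_le_log (Real.exp_pos 1) (not_le.1 h).le
      rw [Real.log_exp] at h3
      exact h3.trans (le_max_right _ _)
    linarith

theorem logCount_le_add_card {lam : ℕ → ℝ} (hpos : 0 < lam 0) (hmono : StrictMono lam)
    (htop : Tendsto lam atTop atTop) {u θ : ℝ} (hu : 0 < u) (hθ : 0 < θ) (hθ1 : θ ≤ 1) :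
    logCount lam u ≤ logCount lam (Real.exp (-1) * u) + logCount lam (θ * u) +
      ((finite_setOf_le htop u).toFinset.filter
        fun k => θ * Real.exp (-1) * u ≤ lam k).card := by
  have he1 : Real.exp (-1) ≤ 1 := by rw [Real.exp_le_one_iff]; norm_num
  rw [logCount_eq_sum hpos hmono htop hu.le le_rfl,
    logCount_eq_sum hpos hmono htop (u := Real.exp (-1) * u) (by positivity)
      (mul_le_of_le_one_left hu.le he1),
    logCount_eq_sum hpos hmono htop (u := θ * u) (by positivity)
      (mul_le_of_le_one_left hu.le hθ1),
    Finset.card_filter, Nat.cast_sum, ← Finset.sum_add_distrib, ← Finset.sum_add_distrib]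
  refine Finset.sum_le_sum fun k _ => ?_
  have hk := lam_pos hpos hmono k
  have h := posLog_le_add_ite (u / lam k) θ
  rw [← mul_div_assoc, ← mul_div_assoc] at h
  refine h.trans (le_of_eq ?_)
  have hiff : θ * u / lam k ≤ Real.exp 1 ↔ θ * Real.exp (-1) * u ≤ lam k := by
    rw [div_le_iff₀ hk, Real.exp_neg,
      show θ * (Real.exp 1)⁻¹ * u = θ * u / Real.exp 1 by ring,
      div_le_iff₀ (Real.exp_pos 1), mul_comm (Real.exp 1)]
  simp only [hiff]
  push_cast
  rfl

theorem tendsto_logCount_div_rpow {lam : ℕ → ℝ} {A α B C D : ℝ} (hα : 0 < α)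
    (hN : Tendsto (fun u => logCount lam u - logCountMain A α B C D u) atTop (𝓝 0)) :
    Tendsto (fun u => logCount lam u / u ^ α) atTop (𝓝 (A / α)) := by
  have hinv : Tendsto (fun u : ℝ => (u ^ α)⁻¹) atTop (𝓝 0) :=
    (tendsto_rpow_atTop hα).inv_tendsto_atTop
  have hlog : ∀ s : ℝ, 0 < s → Tendsto (fun u : ℝ => Real.log u / u ^ s) atTop (𝓝 0) :=
    fun s hs => (isLittleO_log_rpow_atTop hs).tendsto_div_nhds_zero
  have h := ((((hN.mul hinv).add_const (A / α)).add
    (((hlog (α / 2) (by positivity)).pow 2).const_mul B)).add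
      ((hlog α hα).const_mul C)).add (hinv.const_mul D)
  refine (h.congr' ?_).trans (le_of_eq (by norm_num))
  filter_upwards [eventually_gt_atTop 0] with u hu
  have h2 : u ^ α = (u ^ (α / 2)) ^ 2 := by
    rw [← Real.rpow_natCast, ← Real.rpow_mul hu.le]; congr 1; push_cast; ring
  have h3 : 0 < u ^ (α / 2) := by positivity
  rw [logCountMain, h2]
  field_simp
  ring

/-- A positive proportion of the `lam k ≤ u` are comparable to `u`, up to the expected order. -/
theorem exists_card_lower_bound {lam : ℕ → ℝ} (hpos : 0 < lam 0) (hmono : StrictMono lam)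
    (htop : Tendsto lam atTop atTop) {A α B C D : ℝ} (hA : 0 < A) (hα : 0 < α)
    (hN : Tendsto (fun u => logCount lam u - logCountMain A α B C D u) atTop (𝓝 0)) :
    ∃ θ > 0, ∃ κ > 0, ∀ᶠ u in atTop, κ * u ^ α ≤
      ((finite_setOf_le htop u).toFinset.filter fun k => θ * u ≤ lam k).card := by
  have hR := tendsto_logCount_div_rpow hα hN
  have hscale : ∀ c : ℝ, 0 < c →
      Tendsto (fun u => logCount lam (c * u) / u ^ α) atTop (𝓝 (c ^ α * (A / α))) := by
    intro c hc
    have h := (hR.comp (tendsto_id.const_mul_atTop hc)).const_mul (c ^ α)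
    refine h.congr' ?_
    filter_upwards [eventually_gt_atTop 0] with u hu
    simp only [Function.comp, id]
    rw [Real.mul_rpow hc.le hu.le]
    field_simp
  set δ := 1 - Real.exp (-1) ^ α with hδ
  have hδ0 : 0 < δ := by
    rw [hδ, ← Real.exp_mul, sub_pos, Real.exp_lt_one_iff]; linarith
  have hδ1 : δ ≤ 1 := by
    have : 0 < Real.exp (-1) ^ α := by positivity
    linarith
  -- Chosen so that `ν ^ α = δ / 2`: half of the gain `δ = 1 - e ^ (-α)` then survives, and `κ`
  -- keeps half of that again as a margin.
  set ν := (δ / 2) ^ (1 / α) with hν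
  have hν0 : 0 < ν := by positivity
  have hν1 : ν ≤ 1 := Real.rpow_le_one (by positivity) (by linarith) (by positivity)
  have hνα : ν ^ α = δ / 2 := by
    rw [hν, ← Real.rpow_mul (by positivity), one_div_mul_cancel hα.ne', Real.rpow_one]
  have hlim := (hR.sub (hscale _ (Real.exp_pos (-1)))).sub (hscale ν hν0)
  have hval : A / α - Real.exp (-1) ^ α * (A / α) - ν ^ α * (A / α) = δ / 2 * (A / α) := by
    rw [hνα, hδ]; ring
  rw [hval] at hlim
  refine ⟨ν * Real.exp (-1), by positivity, δ / 4 * (A / α), by positivity, ?_⟩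
  have hlt : δ / 4 * (A / α) < δ / 2 * (A / α) := by
    have : 0 < δ * (A / α) := by positivity
    linarith
  filter_upwards [hlim.eventually_const_lt hlt, eventually_gt_atTop 0] with u hu hu0
  have hb := logCount_le_add_card hpos hmono htop hu0 hν0 hν1
  rw [← sub_div, ← sub_div, lt_div_iff₀ (by positivity)] at hu
  linarith

/-- The logarithm of the modulus of the characteristic function as a series of cosines. -/
theorem hasSum_re_logGenC_sub {lam : ℕ → ℝ} (hl : ∀ k, 0 < lam k) {σ : ℝ} (hσ : 0 < σ) (t : ℝ)
    (hsum : Summable fun k => -Real.log (1 - Real.exp (-(σ * lam k)))) :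
    HasSum (fun p => logCoeff lam σ p * (Real.cos (t * logFreq lam p) - 1))
      (logGenC lam (σ - t * Complex.I) - logGen lam σ).re := by
  have h := Complex.hasSum_re (hasSum_logGenC_sub hl hσ t hsum)
  refine h.congr_fun fun p => ?_
  rw [Complex.re_ofReal_mul, Complex.sub_re, Complex.exp_ofReal_mul_I_re, Complex.one_re]

/-- All terms of the cosine series have the same sign, so it may be cut down to the terms `j = 1`
with `k ∈ F`. There the coefficient is at least `e ^ (-q)`, and `|σ lam k y| ≤ π` permits `1 - cos x
≥ 2 x² / π²`. -/
theorem norm_charFun_tiltedMeasure_le {lam : ℕ → ℝ} (hl : ∀ k, 0 < lam k) {σ : ℝ} (hσ : 0 < σ)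
    (u y : ℝ) (hsum : Summable fun k => -Real.log (1 - Real.exp (-(σ * lam k)))) (F : Finset ℕ)
    {θ q : ℝ} (hθ : 0 ≤ θ) (hF : ∀ k ∈ F, θ ≤ σ * lam k ∧ σ * lam k ≤ q) (hy : |y| * q ≤ Real.pi) :
    ‖charFun (tiltedMeasure lam σ u) y‖ ≤
      Real.exp (-(F.card * (Real.exp (-q) * (2 / Real.pi ^ 2 * (θ * y) ^ 2)))) := by
  rw [charFun_tiltedMeasure hl hσ u y hsum, Complex.norm_exp, Real.exp_le_exp]
  have hre := (hasSum_re_logGenC_sub hl hσ (σ * y) hsum).neg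
  rw [Complex.sub_re _ (_ * Complex.I), Complex.re_ofReal_mul, Complex.I_re, mul_zero, sub_zero]
  have hinj : Function.Injective fun k : ℕ => (k, (0 : ℕ)) := fun a b h => (Prod.mk.inj h).1
  have hle := sum_le_hasSum (F.map ⟨_, hinj⟩) (fun p _ => by
    have h1 := logCoeff_nonneg lam σ p
    have h2 := Real.cos_le_one (σ * y * logFreq lam p)
    rw [← mul_neg]
    exact mul_nonneg h1 (by linarith)) hre
  rw [Finset.sum_map] at hle
  have hterm : ∀ k ∈ F, Real.exp (-q) * (2 / Real.pi ^ 2 * (θ * y) ^ 2) ≤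
      -(logCoeff lam σ (k, 0) * (Real.cos (σ * y * logFreq lam (k, 0)) - 1)) := by
    intro k hk
    obtain ⟨h1, h2⟩ := hF k hk
    have hc : logCoeff lam σ (k, 0) = Real.exp (-(σ * lam k)) := by simp [logCoeff]
    have hw : σ * y * logFreq lam (k, 0) = σ * lam k * y := by simp [logFreq]; ring
    have hs : 0 < σ * lam k := mul_pos hσ (hl k)
    have habs : |σ * lam k * y| ≤ Real.pi := by
      rw [abs_mul, abs_of_pos hs, mul_comm]
      exact (mul_le_mul_of_nonneg_left h2 (abs_nonneg y)).trans hy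
    have hcos := Real.cos_le_one_sub_mul_cos_sq habs
    rw [hc, hw, ← mul_neg]
    refine mul_le_mul (Real.exp_le_exp.2 (by linarith)) ?_ (by positivity) (Real.exp_pos _).le
    have hsq : (θ * y) ^ 2 ≤ (σ * lam k * y) ^ 2 := by
      rw [mul_pow, mul_pow (σ * lam k)]
      gcongr
    have := mul_le_mul_of_nonneg_left hsq (by positivity : 0 ≤ 2 / Real.pi ^ 2)
    linarith
  have hF2 := Finset.card_nsmul_le_sum F _ _ hterm
  rw [nsmul_eq_mul] at hF2
  have hle' := hF2.trans hle
  linarith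

/-- The standard deviation of the tilted measure at the saddle point, to first order. -/
def saddleScale (a α σ : ℝ) : ℝ := Real.sqrt (α * (α + 1) * a * σ ^ (-α))

theorem saddleScale_pos {a α σ : ℝ} (ha : 0 < a) (hα : 0 < α) (hσ : 0 < σ) :
    0 < saddleScale a α σ := by unfold saddleScale; positivity

theorem saddleScale_sq {a α σ : ℝ} (ha : 0 < a) (hα : 0 < α) (hσ : 0 < σ) :
    saddleScale a α σ ^ 2 = α * (α + 1) * a * σ ^ (-α) := by
  unfold saddleScale; exact Real.sq_sqrt (by positivity)

theorem tendsto_saddleScale {a α : ℝ} (ha : 0 < a) (hα : 0 < α) :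
    Tendsto (saddleScale a α) (𝓝[>] 0) atTop := by
  have h1 : Tendsto (fun σ : ℝ => σ ^ (-α)) (𝓝[>] 0) atTop :=
    tendsto_rpow_neg_nhdsGT_zero (neg_lt_zero.2 hα)
  exact Real.tendsto_sqrt_atTop.comp (h1.const_mul_atTop (by positivity))

/-- With `q = π / Δ`, the `lam k` between `θ q / σ` and `q / σ` keep all phases within `[-π, π]` on
the band. Their number is at least `κ (q / σ) ^ α`, which is of the order of `saddleScale²`. The
centring `U` is arbitrary, since it only changes the phase. -/
theorem exists_charFun_gaussian_bound {lam : ℕ → ℝ} (hpos : 0 < lam 0) (hmono : StrictMono lam)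
    (htop : Tendsto lam atTop atTop) {A α B C D : ℝ} (hA : 0 < A) (hα : 0 < α)
    (hN : Tendsto (fun u => logCount lam u - logCountMain A α B C D u) atTop (𝓝 0))
    {a : ℝ} (ha : 0 < a) (U : ℝ → ℝ) {Δ : ℝ} (hΔ : 0 < Δ) :
    ∃ c > 0, ∀ᶠ σ in 𝓝[>] 0, ∀ y, |y| ≤ Δ →
      ‖charFun (tiltedMeasure lam σ (U σ)) y‖ ≤ Real.exp (-c * (saddleScale a α σ * y) ^ 2) := by
  obtain ⟨θ, hθ, κ, hκ, hev⟩ := exists_card_lower_bound hpos hmono htop hA hα hN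
  set q := Real.pi / Δ with hq
  have hq0 : 0 < q := by positivity
  set k := α * (α + 1) * a with hk
  have hk0 : 0 < k := by positivity
  have hlim : Tendsto (fun σ : ℝ => q / σ) (𝓝[>] 0) atTop := by
    simpa only [div_eq_mul_inv] using tendsto_inv_nhdsGT_zero.const_mul_atTop hq0
  have hsm : ∀ᶠ σ : ℝ in 𝓝[>] 0, 0 < σ ∧ σ < 1 := Ioo_mem_nhdsGT one_pos
  refine ⟨κ * q ^ α * (Real.exp (-q) * (2 / Real.pi ^ 2 * (θ * q) ^ 2)) / k, by positivity, ?_⟩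
  filter_upwards [hlim.eventually hev, hsm] with σ hcard ⟨hσ, hσ1⟩ y hy
  have hsum := (hasSum_logGen hpos hmono htop hα hN hσ hσ1).1.summable
  refine (norm_charFun_tiltedMeasure_le (lam_pos hpos hmono) hσ (U σ) y hsum
    ((finite_setOf_le htop (q / σ)).toFinset.filter fun k => θ * (q / σ) ≤ lam k)
    (θ := θ * q) (q := q) (by positivity) (fun k hk => ?_) ?_).trans ?_
  · rw [Finset.mem_filter, Set.Finite.mem_toFinset, mem_ofPred_eq] at hk
    obtain ⟨h1, h2⟩ := hk
    rw [le_div_iff₀ hσ] at h1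
    rw [← mul_div_assoc, div_le_iff₀ hσ] at h2
    constructor <;> linarith
  · calc |y| * q ≤ Δ * q := by gcongr
      _ = Real.pi := by rw [hq]; field_simp
  · rw [Real.exp_le_exp, neg_mul, neg_le_neg_iff, mul_pow (saddleScale a α σ),
      saddleScale_sq ha hα hσ, ← hk]
    have e1 : κ * q ^ α * (Real.exp (-q) * (2 / Real.pi ^ 2 * (θ * q) ^ 2)) / k *
        (k * σ ^ (-α) * y ^ 2) = κ * (q / σ) ^ α *
          (Real.exp (-q) * (2 / Real.pi ^ 2 * (θ * q * y) ^ 2)) := by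
      rw [Real.div_rpow hq0.le hσ.le, Real.rpow_neg hσ.le]
      field_simp
    rw [e1]
    gcongr

theorem tendsto_charFun_tiltedMeasure {lam : ℕ → ℝ} (hpos : 0 < lam 0) (hmono : StrictMono lam)
    (htop : Tendsto lam atTop atTop) {A α B C D : ℝ} (hα : 0 < α)
    (hN : Tendsto (fun u => logCount lam u - logCountMain A α B C D u) atTop (𝓝 0))
    {a E : ℝ} (ha : 0 < a)
    (hL : Tendsto (fun σ => logGen lam σ -
      (a * σ ^ (-α) + B * Real.log σ ^ 2 - C * Real.log σ + E)) (𝓝[>] 0) (𝓝 0)) (t : ℝ) :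
    Tendsto (fun σ => charFun (tiltedMeasure lam σ (a * α * σ ^ (-α - 1))) (t / saddleScale a α σ))
      (𝓝[>] 0) (𝓝 (Complex.exp (-(t ^ 2 / 2 : ℝ)))) := by
  have hsm : ∀ᶠ σ : ℝ in 𝓝[>] 0, 0 < σ ∧ σ < 1 / 2 := Ioo_mem_nhdsGT (by norm_num)
  have hl := lam_pos hpos hmono
  have hsum : ∀ σ : ℝ, 0 < σ → σ < 1 →
      Summable fun k => -Real.log (1 - Real.exp (-(σ * lam k))) := fun σ h0 h1 =>
    (hasSum_logGen hpos hmono htop hα hN h0 h1).1.summable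
  have key := tendsto_logCharFun_of_tendsto_cumulant (l := 𝓝[>] (0 : ℝ))
    (c := fun σ => logCoeff lam σ) (w := fun σ p => σ / saddleScale a α σ * logFreq lam p)
    (b := fun σ => σ * (a * α * σ ^ (-α - 1)) / saddleScale a α σ)
    (S := fun σ τ => logGen lam (σ - τ * (σ / saddleScale a α σ)) - logGen lam σ) (t := t)
    (G := fun σ => logGenC lam (σ - (t * (σ / saddleScale a α σ) : ℝ) * Complex.I) - logGen lam σ)
    (.of_forall fun σ p => logCoeff_nonneg lam σ p) ?_ ?_ ?_ ?_
  · refine ((Complex.continuous_exp.tendsto _).comp key).congr' ?_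
    filter_upwards [hsm] with σ ⟨hσ, hσ1⟩
    rw [charFun_tiltedMeasure hl hσ _ _ (hsum σ hσ (by linarith))]
    simp only [Function.comp]
    congr 3
    · congr 3; push_cast; ring
    · push_cast; ring
  · filter_upwards [hsm] with σ ⟨hσ, hσ1⟩ p
    have h1 := saddleScale_pos ha hα hσ
    have h2 := hl p.1
    unfold logFreq
    positivity
  · filter_upwards [hsm, (tendsto_saddleScale ha hα).eventually_gt_atTop 4] with σ ⟨hσ, hσ1⟩ hT τ hτ
    have hτ2 : |τ| ≤ 2 := by
      simp only [mem_insert_iff, mem_singleton_iff] at hτ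
      rcases hτ with rfl | rfl | rfl | rfl <;> norm_num
    have hq : |τ * (σ / saddleScale a α σ)| ≤ σ / 2 := by
      rw [abs_mul, abs_of_pos (by positivity : 0 < σ / saddleScale a α σ)]
      calc |τ| * (σ / saddleScale a α σ) ≤ 2 * (σ / 4) := by gcongr
        _ = σ / 2 := by ring
    obtain ⟨hq1, hq2⟩ := abs_le.1 hq
    have h := hasSum_logCoeff_sub hl hσ (τ := τ * (σ / saddleScale a α σ)) (by linarith)
      (hsum σ hσ (by linarith)) (hsum _ (by linarith) (by linarith))
    simpa only [mul_assoc] using h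
  · intro τ hτ
    have hτ0 : τ ≠ 0 := by
      simp only [mem_insert_iff, mem_singleton_iff] at hτ
      rcases hτ with rfl | rfl | rfl | rfl <;> norm_num
    exact tendsto_expansion_sub ha hα hL hτ0 fun σ _ => rfl
  · filter_upwards [hsm] with σ ⟨hσ, hσ1⟩
    have h := hasSum_logGenC_sub hl hσ (t * (σ / saddleScale a α σ)) (hsum σ hσ (by linarith))
    simpa only [mul_assoc] using h

theorem tendsto_integral_tiltedMeasure {lam : ℕ → ℝ} (hpos : 0 < lam 0) (hmono : StrictMono lam)
    (htop : Tendsto lam atTop atTop) {A α B C D : ℝ} (hA : 0 < A) (hα : 0 < α)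
    (hN : Tendsto (fun u => logCount lam u - logCountMain A α B C D u) atTop (𝓝 0))
    {a E : ℝ} (ha : 0 < a)
    (hL : Tendsto (fun σ => logGen lam σ -
      (a * σ ^ (-α) + B * Real.log σ ^ 2 - C * Real.log σ + E)) (𝓝[>] 0) (𝓝 0)) :
    Tendsto (fun σ => saddleScale a α σ *
      ∫ x, (Iic 0).indicator Real.exp x ∂tiltedMeasure lam σ (a * α * σ ^ (-α - 1)))
      (𝓝[>] 0) (𝓝 (Real.sqrt (2 * Real.pi))⁻¹) := by
  refine tendsto_of_seq_tendsto fun s hs => ?_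
  have hsm : ∀ᶠ σ : ℝ in 𝓝[>] 0, 0 < σ ∧ σ < 1 := Ioo_mem_nhdsGT one_pos
  -- The beginning of the sequence is dropped so that every remaining member is a probability
  -- measure, as the local limit theorem requires.
  obtain ⟨n₀, hn₀⟩ := eventually_atTop.1 (hs.eventually hsm)
  rw [← tendsto_add_atTop_iff_nat n₀]
  have hs' : Tendsto (fun n => s (n + n₀)) atTop (𝓝[>] 0) := (tendsto_add_atTop_iff_nat n₀).2 hs
  have hprob : ∀ n, IsProbabilityMeasure
      (tiltedMeasure lam (s (n + n₀)) (a * α * s (n + n₀) ^ (-α - 1))) := fun n => by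
    obtain ⟨h0, h1⟩ := hn₀ (n + n₀) (by omega)
    exact isProbabilityMeasure_tiltedMeasure (lam_pos hpos hmono) h0 _
      (hasSum_logGen hpos hmono htop hα hN h0 h1).1.summable
  refine tendsto_integral_indicator_exp ((tendsto_saddleScale ha hα).comp hs')
    (fun t => (tendsto_charFun_tiltedMeasure hpos hmono htop hα hN ha hL t).comp hs')
    fun Δ hΔ => ?_
  obtain ⟨c, hc, h⟩ := exists_charFun_gaussian_bound hpos hmono htop hA hα hN ha
    (fun σ => a * α * σ ^ (-α - 1)) hΔ
  exact ⟨c, hc, hs'.eventually h⟩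

/-! ### Evaluation at the saddle point. -/

/-- The saddle point equation. -/
theorem saddle_equation {M a α u : ℝ} (hM : 0 < M) (hα : 0 < α) (hu : 0 < u)
    (hMa : M ^ (α + 1) = a * α) :
    a * α * (M * u ^ (-(1 / (α + 1)))) ^ (-α - 1) = u := by
  have hα1 : α + 1 ≠ 0 := by positivity
  rw [Real.mul_rpow hM.le (by positivity), ← Real.rpow_mul hu.le, ← hMa, ← mul_assoc,
    ← Real.rpow_add hM]
  have e1 : α + 1 + (-α - 1) = 0 := by ring
  have e2 : -(1 / (α + 1)) * (-α - 1) = 1 := by field_simp; ring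
  rw [e1, e2, Real.rpow_zero, Real.rpow_one, one_mul]

/-- The value of the main term at the saddle point. -/
theorem exp_saddle_value {M a α u β : ℝ} (B C D : ℝ) (hM : 0 < M) (ha : 0 < a) (hα : 0 < α)
    (hu : 0 < u) (hMa : M ^ (α + 1) = a * α) (hβ : β = α / (α + 1)) {σ : ℝ}
    (hσ : σ = M * u ^ (-(1 / (α + 1)))) :
    Real.exp (a * σ ^ (-α) + B * Real.log σ ^ 2 - C * Real.log σ + D + σ * u) =
      ((1 - β) / (2 * Real.pi)) ^ (1 / 2 : ℝ) * Real.exp D * M ^ (-(C + 1 / 2)) *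
        u ^ (C - β * C - β / 2) *
        Real.exp (M * u ^ β / β + B * Real.log (u ^ (1 - β) / M) ^ 2) *
        (saddleScale a α σ * Real.sqrt (2 * Real.pi)) := by
  have hα1 : 0 < α + 1 := by positivity
  have hβ1 : 1 - β = (α + 1)⁻¹ := by rw [hβ]; field_simp; ring
  have hβ0 : 0 < β := by rw [hβ]; positivity
  have hσ0 : 0 < σ := by rw [hσ]; positivity
  have hlogσ : Real.log σ = Real.log M - (1 - β) * Real.log u := by
    rw [hσ, Real.log_mul hM.ne' (by positivity), Real.log_rpow hu, hβ1, one_div]; ring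
  have hlogM : (α + 1) * Real.log M = Real.log (a * α) := by rw [← hMa, Real.log_rpow hM]
  have hlogT : Real.log (saddleScale a α σ) =
      (Real.log (α + 1) + Real.log M + β * Real.log u) / 2 := by
    rw [saddleScale, Real.log_sqrt (by positivity),
      show α * (α + 1) * a = (a * α) * (α + 1) by ring, Real.log_mul (by positivity)
      (by positivity), Real.log_mul (by positivity) (by positivity), Real.log_rpow hσ0, ← hlogM,
      hlogσ, hβ1, hβ]
    field_simp
    ring
  have hσu : σ * u = M * u ^ β := by
    have e : β = -(1 / (α + 1)) + 1 := by linarith [hβ1, one_div (α + 1)]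
    rw [hσ, e, Real.rpow_add hu, Real.rpow_one]; ring
  have hpow : a * σ ^ (-α) = M * u ^ β / α := by
    have e : -(1 / (α + 1)) * -α = β := by rw [hβ]; ring
    rw [hσ, Real.mul_rpow hM.le (by positivity), ← Real.rpow_mul hu.le, e,
      show a = M ^ (α + 1) / α by rw [hMa]; field_simp, div_mul_eq_mul_div, ← mul_assoc,
      ← Real.rpow_add hM, show α + 1 + -α = 1 by ring, Real.rpow_one]
  have hlogu : Real.log (u ^ (1 - β) / M) = -Real.log σ := by
    rw [Real.log_div (by positivity) hM.ne', Real.log_rpow hu, hlogσ]; ring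
  have hT0 := saddleScale_pos ha hα hσ0
  have hβpos : 0 < 1 - β := by rw [hβ1]; positivity
  have h2π : 0 < 2 * Real.pi := by positivity
  -- This is `1/β = 1/α + 1`: the main term `a σ ^ (-α)` and `σ u` together make up the exponent.
  -- The remaining identity between positive quantities is checked on logarithms, where it is
  -- linear.
  have hsplit : M * u ^ β / β = M * u ^ β / α + M * u ^ β := by
    rw [hβ]; field_simp; ring
  refine Real.log_injOn_pos (mem_Ioi.2 (Real.exp_pos _)) (mem_Ioi.2 (by positivity)) ?_
  rw [Real.log_exp, Real.log_mul (by positivity) (by positivity),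
    Real.log_mul (by positivity) (by positivity), Real.log_mul (by positivity) (by positivity),
    Real.log_mul (by positivity) (by positivity), Real.log_mul (by positivity) (by positivity),
    Real.log_mul hT0.ne' (by positivity), Real.log_exp, Real.log_exp, Real.log_rpow hM,
    Real.log_rpow hu, Real.log_rpow (by positivity), Real.log_div hβpos.ne' h2π.ne',
    Real.log_sqrt h2π.le, hlogT, hlogu, hσu, hpow, hsplit, hlogσ,
    show Real.log (α + 1) = -Real.log (1 - β) by rw [hβ1, Real.log_inv, neg_neg]]
  ring

theorem zeta_re_pos {s : ℝ} (hs : 0 < s) : 0 < (riemannZeta ((s : ℂ) + 1)).re := by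
  have hsum : Summable fun n : ℕ => 1 / ((n : ℝ) + 1) ^ (s + 1) := by
    have := (summable_nat_add_iff 1).2 (Real.summable_one_div_nat_rpow.2 (by linarith : 1 < s + 1))
    simpa using this
  rw [zeta_re_eq_tsum hs]
  exact hsum.tsum_pos (fun n => by positivity) 0 (by positivity)

end PartitionAsymptotics

end

/-! ### Assembly of the asymptotic formula. -/

theorem theorem2 (lam : ℕ → ℝ) (hpos : 0 < lam 0) (hmono : StrictMono lam)
    (htop : Filter.Tendsto lam Filter.atTop Filter.atTop)
    (A α B C D : ℝ) (hA : 0 < A) (hα : 0 < α)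
    (hN : Asymptotics.IsLittleO Filter.atTop
      (fun u : ℝ => (∫ t in (0 : ℝ)..u, (PartitionAsymptotics.countingFn lam t : ℝ) / t) -
        (A / α * u ^ α + B * Real.log u ^ 2 + C * Real.log u + D))
      (fun _ : ℝ => (1 : ℝ)))
    (β M D' : ℝ) (hβ : β = α / (α + 1))
    (hM : M = (A * α * Real.Gamma (α + 1) * (riemannZeta ((α : ℂ) + 1)).re) ^ (1 / (α + 1)))
    (hD' : D' = D + (Real.pi ^ 2 / 6 - 2 * PartitionAsymptotics.stieltjesGammaOne -
      Real.eulerMascheroniConstant ^ 2) * B) :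
    Asymptotics.IsEquivalent Filter.atTop
      (fun u : ℝ => (PartitionAsymptotics.summedPartition lam u : ℝ))
      (fun u : ℝ => ((1 - β) / (2 * Real.pi)) ^ (1 / 2 : ℝ) * Real.exp D' * M ^ (-(C + 1 / 2)) *
        u ^ (C - β * C - β / 2) *
        Real.exp (M * u ^ β / β + B * Real.log (u ^ (1 - β) / M) ^ 2)) := by
  open PartitionAsymptotics in
  have hN' : Tendsto (fun u => logCount lam u - logCountMain A α B C D u) atTop (𝓝 0) :=
    (Asymptotics.isLittleO_one_iff ℝ).1 hN
  have hL := tendsto_logGen hpos hmono htop hα hN'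
  rw [← hD'] at hL
  set a := A * Real.Gamma (α + 1) * (riemannZeta ((α : ℂ) + 1)).re with ha_def
  have hα1 : 0 < α + 1 := by positivity
  have ha : 0 < a := mul_pos (mul_pos hA (Real.Gamma_pos_of_pos hα1)) (zeta_re_pos hα)
  have hM' : M = (a * α) ^ (1 / (α + 1)) := by rw [hM, ha_def]; congr 1; ring
  have hM0 : 0 < M := by rw [hM']; positivity
  have hMa : M ^ (α + 1) = a * α := by
    rw [hM', ← Real.rpow_mul (by positivity), one_div_mul_cancel hα1.ne', Real.rpow_one]
  have hβ1 : 0 < 1 - β := by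
    rw [hβ, sub_pos, div_lt_one hα1]; linarith
  -- This `σ(u)` solves `a α σ ^ (-α - 1) = u` exactly, so the limits as `σ → 0+` can be composed
  -- with it.
  have hσ : Tendsto (fun u : ℝ => M * u ^ (-(1 / (α + 1)))) atTop (𝓝[>] 0) := by
    refine tendsto_nhdsWithin_of_tendsto_nhds_of_eventually_within _ ?_ ?_
    · simpa using (tendsto_rpow_neg_atTop (y := 1 / (α + 1)) (by positivity)).const_mul M
    · filter_upwards [eventually_gt_atTop 0] with u hu
      exact Set.mem_Ioi.2 (by positivity)
  have hI := (tendsto_integral_tiltedMeasure hpos hmono htop hA hα hN' ha hL).comp hσ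
  have hexp := (Real.continuous_exp.tendsto 0).comp (hL.comp hσ)
  have h2π : 0 < Real.sqrt (2 * Real.pi) := by positivity
  have hlim := (hexp.mul hI).mul_const (Real.sqrt (2 * Real.pi))
  rw [Real.exp_zero, one_mul, inv_mul_cancel₀ h2π.ne'] at hlim
  refine (Asymptotics.isEquivalent_iff_tendsto_one ?_).2 (hlim.congr' ?_)
  · filter_upwards [eventually_gt_atTop 0] with u hu
    positivity
  · filter_upwards [eventually_gt_atTop 0, hσ.eventually (Ioo_mem_nhdsGT one_pos)] with u hu hσu
    obtain ⟨hσ0, hσ1⟩ := hσu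
    have hP := summedPartition_eq_integral hpos hmono htop hσ0 u
      (hasSum_logGen hpos hmono htop hα hN' hσ0 hσ1).1.summable
    -- The saddle value is the claimed main term times `saddleScale * √(2π)`. The local limit
    -- theorem supplies the reciprocal of this factor, so the quotient is `exp (o(1))` times a
    -- quantity tending to 1.
    have hX := exp_saddle_value B C D' hM0 ha hα hu hMa hβ rfl
    simp only [Function.comp, Pi.div_apply, saddle_equation hM0 hα hu hMa]
    rw [eq_div_iff (by positivity), hP]
    set σ := M * u ^ (-(1 / (α + 1)))
    have hsplit : Real.exp (logGen lam σ + σ * u) =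
        Real.exp (logGen lam σ -
          (a * σ ^ (-α) + B * Real.log σ ^ 2 - C * Real.log σ + D')) *
        Real.exp (a * σ ^ (-α) + B * Real.log σ ^ 2 - C * Real.log σ + D' + σ * u) := by
      rw [← Real.exp_add]; congr 1; ring
    rw [hsplit, hX]
    ring
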